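/- Let $\mathbb{A}$ be a countable relational structure over a finite vocabulary, whose elements are called atoms. **Definable sets.** An expression is a variable, or a formal finite (possibly empty) union of set-builder expressions $\{e \mid a_1,\dots,a_n\in\mathbb{A},\ \varphi\}$, where $e$ is an expression, $a_1,\dots,a_n$ are variables (bound in $e$ and $\varphi$), and $\varphi$ is a first-order formula over the vocabulary of $\mathbb{A}$. Under a valuation of its free variables by atoms, an expression has a value in the cumulative hierarchy of sets over the atoms: an atom or a set. For a finite $S\subseteq\mathbb{A}$, an object is $S$-definable if it is the value of some expression under a valuation that maps the free variables into $S$; it is definable if it is $S$-definable for some finite $S$. Pairs and tuples are encoded by Kuratowski pairs. A ($T$-)definable signature is a finite sequence of pairwise disjoint ($T$-)definable sets $\Sigma=\Sigma_1\uplus\dots\uplus\Sigma_l$, where $\Sigma_r$ is the set of symbols of arity $r$. A ($T$-)definable $\Sigma$-structure is a tuple $(A,I_1,\dots,I_l)$ of ($T$-)definable sets with $I_r\subseteq\Sigma_r\times A^r$; a symbol $\sigma\in\Sigma_r$ is interpreted as $\{(a_1,\dots,a_r) \mid (\sigma,a_1,\dots,a_r)\in I_r\}$. An ($S$-)definable isomorphism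 between two $\Sigma$-structures is a bijection between their universes that preserves and reflects every relation in $\Sigma$ and whose graph is an ($S$-)definable set. **Parameter elimination property of $\mathbb{A}$.** For every finite $T\subseteq\mathbb{A}$, every $T$-definable signature $\Sigma$ and all $T$-definable $\Sigma$-structures $\mathbb{B},\mathbb{C}$: if $\mathbb{B}$ and $\mathbb{C}$ are related by a definable isomorphism, then they are related by a $T$-definable one. **Effective $\omega$-categoricity.** Fix an encoding of atoms by binary strings, i.e. a surjection $\{0,1\}^*\to\mathbb{A}$, and an encoding of the symbols of the vocabulary by distinct strings; formulas, expressions and valuations thereby become inputs to algorithms. The structure $\mathbb{A}$ is effectively $\omega$-categorical if (i) every countable structure that satisfies the same first-order sentences as $\mathbb{A}$ is isomorphic to $\mathbb{A}$; (ii) there is an algorithm which, given a first-order formula and a valuation of its free variables in $\mathbb{A}$, determines whether the valuation satisfies the formula; (iii) there is a computable function $\mathbb{N}\to\mathbb{N}$ which maps each $n$ to the number of orbits of the automorphism group of $\mathbb{A}$ on $\mathbb{A}^n$. **Statement.** If $\mathbb{A}$ is effectively $\omega$-categorical and has the parameter elimination property, then the following problem Definable-isomorphism($\mathbb{A}$)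 is decidable: given expressions with parameters for a definable signature $\Sigma$ and two definable $\Sigma$-structures $\mathbb{B}$ and $\mathbb{C}$, is there a definable isomorphism from $\mathbb{B}$ to $\mathbb{C}$? More precisely, there is an algorithm that takes arbitrary expressions with parameters as input and decides whether they define a signature $\Sigma$ and two $\Sigma$-structures that are related by a definable isomorphism. -/

import Mathlib

universe u v w

namespace AtomSets

open FirstOrder

noncomputable section

/-! ### The universe of sets with atoms -/

/-- Well-founded trees whose nodes are either atoms or families of trees: names for the elements
of the cumulative hierarchy of sets built over the set `A` of atoms. -/
inductive PreASet (A : Type u) : Type (u + 1)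
  | atom (a : A) : PreASet A
  | family (ι : Type u) (f : ι → PreASet A) : PreASet A

/-- Extensional equality of names: an atom only equals itself (in particular it differs from
every set, also from the empty set), and sets are equal if they have the same elements. -/
def PreASet.Equiv {A : Type u} : PreASet A → PreASet A → Prop
  | .atom a, .atom b => a = b
  | .family _ f, .family _ g =>
      (∀ i, ∃ j, PreASet.Equiv (f i) (g j)) ∧ (∀ j, ∃ i, PreASet.Equiv (f i) (g j))
  | .atom _, .family _ _ => False
  | .family _ _, .atom _ => False

theorem PreASet.Equiv.refl {A : Type u} (x : PreASet A) : PreASet.Equiv x x := by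
  induction x with
  | atom a => simp [PreASet.Equiv]
  | family ι f ih => exact ⟨fun i => ⟨i, ih i⟩, fun i => ⟨i, ih i⟩⟩

theorem PreASet.Equiv.symm {A : Type u} {x y : PreASet A} (h : PreASet.Equiv x y) :
    PreASet.Equiv y x := by
  induction x generalizing y with
  | atom a =>
    cases y with
    | atom b => simpa [PreASet.Equiv] using (show a = b by simpa [PreASet.Equiv] using h).symm
    | family κ g => simp [PreASet.Equiv] at h
  | family ι f ih =>
    cases y with
    | atom b => simp [PreASet.Equiv] at h
    | family κ g =>
      simp only [PreASet.Equiv] at h ⊢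
      exact ⟨fun j => (h.2 j).imp fun i hi => ih i hi, fun i => (h.1 i).imp fun j hj => ih i hj⟩

theorem PreASet.Equiv.trans {A : Type u} {x y z : PreASet A} (h : PreASet.Equiv x y)
    (h' : PreASet.Equiv y z) : PreASet.Equiv x z := by
  induction x generalizing y z with
  | atom a => cases y <;> cases z <;> simp_all [PreASet.Equiv]
  | family ι f ih =>
    cases y with
    | atom b => simp [PreASet.Equiv] at h
    | family κ g =>
      cases z with
      | atom c => simp [PreASet.Equiv] at h'
      | family μ k =>
        simp only [PreASet.Equiv] at h h' ⊢
        refine ⟨fun i => ?_, fun m => ?_⟩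
        · obtain ⟨j, hj⟩ := h.1 i
          obtain ⟨m, hm⟩ := h'.1 j
          exact ⟨m, ih i hj hm⟩
        · obtain ⟨j, hj⟩ := h'.2 m
          obtain ⟨i, hi⟩ := h.2 j
          exact ⟨i, ih i hi hj⟩

instance PreASet.setoid (A : Type u) : Setoid (PreASet A) :=
  ⟨PreASet.Equiv, PreASet.Equiv.refl, PreASet.Equiv.symm, PreASet.Equiv.trans⟩

/-- Objects (atoms and sets) of the cumulative hierarchy over the set `A` of atoms. -/
def ASet (A : Type u) : Type (u + 1) := Quotient (PreASet.setoid A)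

namespace ASet

variable {A : Type u}

/-- An atom, as an object of the hierarchy. -/
def atom (a : A) : ASet A := Quotient.mk _ (.atom a)

/-- The set `{f i | i : ι}`. -/
def ofFamily (ι : Type u) (f : ι → ASet A) : ASet A :=
  Quotient.mk _ (.family ι fun i => Quotient.out (f i))

/-- The object is a set, not an atom. -/
def IsSet (x : ASet A) : Prop := ∃ (ι : Type u) (f : ι → ASet A), x = ofFamily ι f

/-- Membership. Atoms have no elements. -/
instance : Membership (ASet A) (ASet A) :=
  ⟨fun y x => ∃ (ι : Type u) (f : ι → ASet A), y = ofFamily ι f ∧ ∃ i, x = f i⟩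

theorem ofFamily_eq_iff {ι κ : Type u} {f : ι → ASet A} {g : κ → ASet A} :
    ofFamily ι f = ofFamily κ g ↔ (∀ i, ∃ j, f i = g j) ∧ (∀ j, ∃ i, f i = g j) := by
  have key : ∀ x y : ASet A, PreASet.Equiv (Quotient.out x) (Quotient.out y) ↔ x = y := fun x y =>
    Quotient.out_equiv_out (s := PreASet.setoid A)
  have h : ofFamily ι f = ofFamily κ g ↔ PreASet.Equiv (.family ι fun i => Quotient.out (f i))
      (.family κ fun i => Quotient.out (g i)) := Quotient.eq (r := PreASet.setoid A)
  rw [h]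
  simp only [PreASet.Equiv, key]

theorem mem_ofFamily {ι : Type u} {f : ι → ASet A} {x : ASet A} :
    x ∈ ofFamily ι f ↔ ∃ i, x = f i := by
  constructor
  · rintro ⟨κ, g, h, j, rfl⟩
    obtain ⟨i, hi⟩ := (ofFamily_eq_iff.1 h).2 j
    exact ⟨i, hi.symm⟩
  · rintro ⟨i, rfl⟩
    exact ⟨ι, f, rfl, i, rfl⟩

/-- The unordered pair `{x, y}`. -/
def upair (x y : ASet A) : ASet A := ofFamily (ULift Bool) fun b => if b.down then x else y

/-- The Kuratowski pair `(x, y) = {{x, y}, {x}}`. -/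
def pair (x y : ASet A) : ASet A := upair (upair x y) (upair x x)

/-- The tuple `(x, a₁, …, aᵣ) = ((…((x, a₁), a₂), …), aᵣ)`. -/
def tuple (x : ASet A) {r : ℕ} (a : Fin r → ASet A) : ASet A := (List.ofFn a).foldl pair x

/-- The elements of `x`, as a type. -/
def Elem (x : ASet A) : Type (u + 1) := {y : ASet A // y ∈ x}

end ASet

/-! ### Expressions and definable sets -/

/-- Expressions: variables (named by natural numbers), and formal finite unions
`⋃_{i < k} {body i | bound i ∈ 𝔸, guard i}` of set-builder expressions, where `bound i` lists the
variables that are bound in `body i` and in `guard i`. (The order and repetitions in this list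
have no influence on the meaning of the expression.) -/
inductive SetExpr (L : FirstOrder.Language.{v, w}) : Type (max v w)
  | var (i : ℕ) : SetExpr L
  | union (k : ℕ) (body : Fin k → SetExpr L) (bound : Fin k → List ℕ)
      (guard : Fin k → L.Formula ℕ) : SetExpr L

namespace SetExpr

variable {L : FirstOrder.Language.{v, w}}

/-- The free variables of an expression. -/
def free : SetExpr L → Set ℕ
  | .var i => {i}
  | .union _ body bound guard =>
      {x | ∃ i, (x ∈ (body i).free ∨ x ∈ (guard i).freeVarFinset) ∧ x ∉ bound i}

/-- The value of an expression under a valuation of the variables. It depends only on the values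
of the free variables. -/
def eval {A : Type u} [L.Structure A] : SetExpr L → (ℕ → A) → ASet A
  | .var i, val => ASet.atom (val i)
  | .union k body bound guard, val =>
      ASet.ofFamily
        {p : Fin k × (ℕ → A) // (∀ x, x ∉ bound p.1 → p.2 x = val x) ∧ (guard p.1).Realize p.2}
        fun p => (body p.1.1).eval p.1.2

end SetExpr

/-- `x` is `S`-definable: it is the value of an expression under a valuation that maps all free
variables of the expression into `S`. -/
def DefinableOver (L : FirstOrder.Language.{v, w}) {A : Type u} [L.Structure A] (S : Finset A)
    (x : ASet A) : Prop :=
  ∃ (e : SetExpr L) (val : ℕ → A), (∀ i ∈ e.free, val i ∈ S) ∧ e.eval val = x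

/-! ### Relational structures in the universe of sets with atoms -/

/-- The data of a relational signature `Σ = Σ₁ ⊎ … ⊎ Σ_l`; `sym i` is the set `Σ_{i+1}` of the
symbols of arity `i + 1`. -/
structure Signature (A : Type u) (l : ℕ) where
  sym : Fin l → ASet A

/-- The data `(univ, I₁, …, I_l)` of a relational structure; `interp i` is
`I_{i+1} = {(σ, a₁, …, a_{i+1}) | σ ∈ Σ_{i+1}, (a₁, …, a_{i+1}) ∈ σ^𝔸}`. -/
structure RelStructure (A : Type u) (l : ℕ) where
  univ : ASet A
  interp : Fin l → ASet A

namespace Signature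

variable {A : Type u} {l : ℕ}

/-- The `Σᵣ` are pairwise disjoint sets. -/
def IsValid (Sg : Signature A l) : Prop :=
  (∀ i, (Sg.sym i).IsSet) ∧ ∀ i j, i ≠ j → ∀ σ, σ ∈ Sg.sym i → σ ∉ Sg.sym j

/-- The signature is `T`-definable. -/
def DefinableOver (L : FirstOrder.Language.{v, w}) [L.Structure A] (T : Finset A)
    (Sg : Signature A l) : Prop :=
  ∀ i, AtomSets.DefinableOver L T (Sg.sym i)

end Signature

namespace RelStructure

variable {A : Type u} {l : ℕ}

/-- The data form a structure over the signature `Sg`. -/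
def IsStructure (Sg : Signature A l) (M : RelStructure A l) : Prop :=
  M.univ.IsSet ∧ ∀ i, (M.interp i).IsSet ∧
    ∀ t ∈ M.interp i, ∃ σ ∈ Sg.sym i, ∃ a : Fin (i + 1) → ASet A,
      (∀ j, a j ∈ M.univ) ∧ t = ASet.tuple σ a

/-- The universe and the interpretations of the structure are `T`-definable. -/
def DefinableOver (L : FirstOrder.Language.{v, w}) [L.Structure A] (T : Finset A)
    (M : RelStructure A l) : Prop :=
  AtomSets.DefinableOver L T M.univ ∧ ∀ i, AtomSets.DefinableOver L T (M.interp i)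

/-- A bijection between the universes is an isomorphism of structures over `Sg`: it preserves and
reflects every relation. -/
def IsIso (Sg : Signature A l) (M N : RelStructure A l) (h : M.univ.Elem ≃ N.univ.Elem) : Prop :=
  ∀ i, ∀ σ ∈ Sg.sym i, ∀ a : Fin (i + 1) → M.univ.Elem,
    ASet.tuple σ (fun j => (a j).1) ∈ M.interp i ↔
      ASet.tuple σ (fun j => (h (a j)).1) ∈ N.interp i

end RelStructure

/-- The set `G` is the graph of the function `h`. -/
def IsGraph {A : Type u} {x y : ASet A} (G : ASet A) (h : x.Elem → y.Elem) : Prop :=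
  G.IsSet ∧ ∀ z, z ∈ G ↔ ∃ a : x.Elem, z = ASet.pair a.1 (h a).1

/-- `M` and `N` are related by an `S`-definable isomorphism. -/
def IsoOver (L : FirstOrder.Language.{v, w}) {A : Type u} [L.Structure A] {l : ℕ} (S : Finset A)
    (Sg : Signature A l) (M N : RelStructure A l) : Prop :=
  ∃ h : M.univ.Elem ≃ N.univ.Elem, M.IsIso Sg N h ∧ ∃ G, IsGraph G h ∧ DefinableOver L S G

/-- `M` and `N` are related by a definable isomorphism. -/
def DefinablyIso (L : FirstOrder.Language.{v, w}) {A : Type u} [L.Structure A] {l : ℕ}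
    (Sg : Signature A l) (M N : RelStructure A l) : Prop :=
  ∃ S : Finset A, IsoOver L S Sg M N

/-- The parameter elimination property: `T`-definable structures (over the same `T`-definable
signature) that are related by a definable isomorphism are related by a `T`-definable one. -/
def ParameterElimination (L : FirstOrder.Language.{v, w}) (A : Type u) [L.Structure A] : Prop :=
  ∀ (T : Finset A) (l : ℕ) (Sg : Signature A l) (M N : RelStructure A l),
    Sg.IsValid → M.IsStructure Sg → N.IsStructure Sg →
    Sg.DefinableOver L T → M.DefinableOver L T → N.DefinableOver L T →
    DefinablyIso L Sg M N → IsoOver L T Sg M N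

/-! ### Omega-categoricity -/

/-- A countable structure is `ω`-categorical if it is isomorphic to each countable structure that
satisfies the same first-order sentences. -/
def OmegaCategorical (L : FirstOrder.Language.{v, w}) (A : Type u) [L.Structure A] : Prop :=
  Countable A ∧ ∀ (B : Type u) [L.Structure B], Countable B → L.ElementarilyEquivalent A B →
    Nonempty (A ≃[L] B)

/-- Two `n`-tuples of atoms are in the same orbit of the automorphism group. -/
def orbitSetoid (L : FirstOrder.Language.{v, w}) (A : Type u) [L.Structure A] (n : ℕ) :
    Setoid (Fin n → A) where
  r a b := ∃ g : A ≃[L] A, ∀ i, g (a i) = b i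
  iseqv :=
    { refl := fun _ => ⟨Language.Equiv.refl L A, fun _ => rfl⟩
      symm := by
        rintro a b ⟨g, hg⟩
        exact ⟨g.symm, fun i => by rw [← hg i]; exact g.symm_apply_apply (a i)⟩
      trans := by
        rintro a b c ⟨g, hg⟩ ⟨k, hk⟩
        exact ⟨k.comp g, fun i => by rw [FirstOrder.Language.Equiv.comp_apply, hg i, hk i]⟩ }

/-- The number of orbits of `Aⁿ` is a computable function of `n`. -/
def ComputableRyllNardzewski (L : FirstOrder.Language.{v, w}) (A : Type u) [L.Structure A] : Prop :=
  ∃ f : ℕ → ℕ, Computable f ∧ ∀ n, ENat.card (Quotient (orbitSetoid L A n)) = (f n : ℕ∞)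

/-! ### Representing inputs, and effectivity -/

/-- The property `P` of the objects of type `α`, which are presented to algorithms through
`code`, is decidable. -/
def DecidableVia {α : Type*} {β : Type*} [Primcodable β] (code : α → β) (P : α → Prop) : Prop :=
  ∃ q : β → Prop, ComputablePred q ∧ ∀ x, P x ↔ q (code x)

/-- An encoding of the atoms by strings (each string denotes an atom and each atom is denoted by
a string) and of the relation symbols by strings. -/
structure Encoding (L : FirstOrder.Language.{v, w}) (A : Type u) where
  atom : List Bool → A
  atom_surjective : Function.Surjective atom
  symb : (Σ n, L.Relations n) → List Bool
  symb_injective : Function.Injective symb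

/-- The code of a term, which is a variable (free or bound) as there are no function symbols. -/
def termCode {L : FirstOrder.Language.{v, w}} [L.IsRelational] {n : ℕ} : L.Term (ℕ ⊕ Fin n) → ℕ
  | .var (.inl i) => 2 * i
  | .var (.inr j) => 2 * (j : ℕ) + 1
  | .func f _ => isEmptyElim f

namespace Encoding

variable {L : FirstOrder.Language.{v, w}} {A : Type u} (E : Encoding L A)

/-- The code of a first-order formula. -/
def formulaCode [L.IsRelational] : ∀ {n : ℕ}, L.BoundedFormula ℕ n → ℕ
  | _, .falsum => 0
  | _, .equal s t => 4 * Nat.pair (termCode s) (termCode t) + 1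
  | _, .rel (l := l) R ts =>
      4 * Nat.pair (Encodable.encode (E.symb ⟨l, R⟩))
        (Encodable.encode (List.ofFn fun i => termCode (ts i))) + 2
  | _, .imp φ ψ => 4 * Nat.pair (formulaCode φ) (formulaCode ψ) + 3
  | _, .all φ => 4 * formulaCode φ + 4

/-- The code of an expression. -/
def exprCode [L.IsRelational] : SetExpr L → ℕ
  | .var i => 2 * i
  | .union _ body bound guard =>
      2 * Encodable.encode
        (List.ofFn fun i => (exprCode (body i), bound i, E.formulaCode (guard i))) + 1

/-- The valuation represented by a list of strings: the `i`-th variable is mapped to the atom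
denoted by the `i`-th string of the list (the empty string, if the list is too short). -/
def val (p : List (List Bool)) (i : ℕ) : A := E.atom (p.getD i [])

/-- The first-order theory of the atoms, with parameters, is decidable: there is an algorithm
which inputs a formula and a valuation and determines if the formula is satisfied. -/
def DecidableTheory [L.IsRelational] [L.Structure A] : Prop :=
  DecidableVia
    (fun x : L.Formula ℕ × List (List Bool) => ((E.formulaCode x.1, x.2) : ℕ × List (List Bool)))
    fun x => x.1.Realize (E.val x.2)

/-- Effective `ω`-categoricity of the atoms, with respect to the encoding. -/
structure EffectivelyOmegaCategorical [L.IsRelational] [L.Structure A] : Prop where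
  omegaCategorical : OmegaCategorical L A
  decidableTheory : E.DecidableTheory
  ryllNardzewski : ComputableRyllNardzewski L A

end Encoding

/-! ### The definable isomorphism problem -/

/-- Inputs: expressions for a signature and two structures over it, with strings for the
parameters (atoms) that occur in the expressions. -/
structure IsoInput (L : FirstOrder.Language.{v, w}) where
  /-- The maximal arity. -/
  l : ℕ
  params : List (List Bool)
  sig : Fin l → SetExpr L
  univ₁ : SetExpr L
  interp₁ : Fin l → SetExpr L
  univ₂ : SetExpr L
  interp₂ : Fin l → SetExpr L

namespace IsoInput

variable {L : FirstOrder.Language.{v, w}} {A : Type u} (x : IsoInput L) (E : Encoding L A)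

/-- The code of an input. -/
def code [L.IsRelational] :
    List (List Bool) × List ℕ × (ℕ × List ℕ) × (ℕ × List ℕ) :=
  (x.params, List.ofFn fun i => E.exprCode (x.sig i),
    (E.exprCode x.univ₁, List.ofFn fun i => E.exprCode (x.interp₁ i)),
    (E.exprCode x.univ₂, List.ofFn fun i => E.exprCode (x.interp₂ i)))

variable [L.Structure A]

/-- The signature given by the input. -/
def signature : Signature A x.l := ⟨fun i => (x.sig i).eval (E.val x.params)⟩

/-- The first structure given by the input. -/
def structure₁ : RelStructure A x.l :=
  ⟨x.univ₁.eval (E.val x.params), fun i => (x.interp₁ i).eval (E.val x.params)⟩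

/-- The second structure given by the input. -/
def structure₂ : RelStructure A x.l :=
  ⟨x.univ₂.eval (E.val x.params), fun i => (x.interp₂ i).eval (E.val x.params)⟩

/-- The expressions do define a signature and two structures over this signature. -/
def IsInstance : Prop :=
  (x.signature E).IsValid ∧ (x.structure₁ E).IsStructure (x.signature E) ∧
    (x.structure₂ E).IsStructure (x.signature E)

end IsoInput

/-- The definable isomorphism problem is decidable: there is an algorithm which inputs
expressions with parameters and determines if they define a signature and two structures over
this signature that are related by a definable isomorphism. -/
def DefinableIsomorphismDecidable {L : FirstOrder.Language.{v, w}} [L.IsRelational] {A : Type u}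
    [L.Structure A] (E : Encoding L A) : Prop :=
  DecidableVia (fun x : IsoInput L => x.code E) fun x =>
    x.IsInstance E ∧ DefinablyIso L (x.signature E) (x.structure₁ E) (x.structure₂ E)

end

end AtomSets

/-! ### Computability of functions on lists -/

-- Let `T` consist of the atoms denoted by the strings of the input, together with the atom of the
-- empty string. The sets in the input are `T`-definable, so parameter elimination leaves only the
-- search for a `T`-definable isomorphism. The graph of such an isomorphism is invariant under the
-- automorphisms that fix `T`, hence it is a union of orbits of pairs under this group. There are
-- finitely many of these orbits. Conversely each union of them is `T`-definable: if every power of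
-- `A` has finitely many orbits, then a back-and-forth argument shows that orbits of tuples are cut
-- out by formulas (`exists_orbit_formula`, `exists_definableOver_orbits`). So it suffices to run
-- through the subsets of a finite list of pairs that meets every orbit, and to test whether the
-- corresponding union of orbits is an isomorphism (`Toolkit.exists_isoRel_iff`).
--
-- The tests are quantified statements about elements of definable sets. Whatever is tested is
-- invariant under the automorphisms that fix a finite context of atoms, so a quantifier over a set
-- may be restricted to representatives of its elements; the parameters of the chosen representative
-- then join the context (`Toolkit.forall_mems_iff`, `Toolkit.forall_seqs_iff`). Applied to
-- extensionality this decides equality and membership, by recursion on a rank read off from the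
-- codes (`Toolkit.isEqOrMem_iff`). It then decides membership in a union of orbits
-- (`Toolkit.inG_iff`), and finally validity of the signature and the structures, and the
-- isomorphism condition.
--
-- All this needs two algorithms on tuples of atoms: a test for lying in the same orbit, and a list
-- of representatives of the extensions of a given tuple (`exists_toolkit`). Both come from a
-- search. The number `f n` of orbits is computable, so one looks for `f n` tuples and a list of
-- formulas in `n` variables that separate them pairwise. Definability of orbits makes the search
-- succeed. By counting, the tuples found represent all orbits, and agreement on the formulas found
-- characterizes equality of orbits (`separation_spec`).

attribute [fun_prop] Computable

namespace AtomSets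

section Toolbox

variable {α β γ σ : Type} [Primcodable α] [Primcodable β] [Primcodable γ] [Primcodable σ]

@[fun_prop] theorem computable_id : Computable (fun a : α => a) := Computable.id

@[fun_prop] theorem computable_const (c : β) : Computable (fun _ : α => c) := Computable.const c

@[fun_prop] theorem computable_comp {g : β → γ} {f : α → β} (hg : Computable g)
    (hf : Computable f) : Computable (fun a => g (f a)) := hg.comp hf

@[fun_prop] theorem computable_pair {f : α → β} {g : α → γ} (hf : Computable f)
    (hg : Computable g) : Computable fun a => (f a, g a) := hf.pair hg

@[fun_prop] theorem computable_fst {f : α → β × γ} (hf : Computable f) :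
    Computable fun a => (f a).1 := Computable.fst.comp hf

@[fun_prop] theorem computable_snd {f : α → β × γ} (hf : Computable f) :
    Computable fun a => (f a).2 := Computable.snd.comp hf

@[fun_prop] theorem computable_append {f g : α → List β} (hf : Computable f)
    (hg : Computable g) : Computable fun a => f a ++ g a := Computable.list_append.comp hf hg

@[fun_prop] theorem computable_cons {f : α → β} {g : α → List β} (hf : Computable f)
    (hg : Computable g) : Computable fun a => f a :: g a := Computable.list_cons.comp hf hg

@[fun_prop] theorem computable_length {f : α → List β} (hf : Computable f) :
    Computable fun a => (f a).length := Computable.list_length.comp hf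

@[fun_prop] theorem computable_getElem? {f : α → List β} {g : α → ℕ} (hf : Computable f)
    (hg : Computable g) : Computable fun a => (f a)[g a]? := Computable.list_getElem?.comp hf hg

@[fun_prop] theorem computable_option_getD {f : α → Option β} {g : α → β} (hf : Computable f)
    (hg : Computable g) : Computable fun a => (f a).getD (g a) := Computable.option_getD hf hg

@[fun_prop] theorem computable_getD {f : α → List β} {g : α → ℕ} {h : α → β} (hf : Computable f)
    (hg : Computable g) (hh : Computable h) : Computable fun a => (f a).getD (g a) (h a) := by
  simp only [List.getD_eq_getElem?_getD]
  fun_prop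

@[fun_prop] theorem computable_cond {c : α → Bool} {f g : α → β} (hc : Computable c)
    (hf : Computable f) (hg : Computable g) : Computable fun a => bif c a then f a else g a :=
  Computable.cond hc hf hg

@[fun_prop] theorem computable_and {f g : α → Bool} (hf : Computable f) (hg : Computable g) :
    Computable fun a => f a && g a := Primrec.and.to_comp.comp hf hg

@[fun_prop] theorem computable_or {f g : α → Bool} (hf : Computable f) (hg : Computable g) :
    Computable fun a => f a || g a := Primrec.or.to_comp.comp hf hg

@[fun_prop] theorem computable_not {f : α → Bool} (hf : Computable f) :
    Computable fun a => !f a := Primrec.not.to_comp.comp hf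

@[fun_prop] theorem computable_xor {f g : α → Bool} (hf : Computable f) (hg : Computable g) :
    Computable fun a => f a ^^ g a :=
  (computable_cond hf (computable_not hg) hg).of_eq fun a => by cases f a <;> simp

@[fun_prop] theorem computable_add {f g : α → ℕ} (hf : Computable f) (hg : Computable g) :
    Computable fun a => f a + g a := Primrec.nat_add.to_comp.comp hf hg

@[fun_prop] theorem computable_sub {f g : α → ℕ} (hf : Computable f) (hg : Computable g) :
    Computable fun a => f a - g a := Primrec.nat_sub.to_comp.comp hf hg

@[fun_prop] theorem computable_mul {f g : α → ℕ} (hf : Computable f) (hg : Computable g) :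
    Computable fun a => f a * g a := Primrec.nat_mul.to_comp.comp hf hg

@[fun_prop] theorem computable_div {f g : α → ℕ} (hf : Computable f) (hg : Computable g) :
    Computable fun a => f a / g a := Primrec.nat_div.to_comp.comp hf hg

@[fun_prop] theorem computable_mod {f g : α → ℕ} (hf : Computable f) (hg : Computable g) :
    Computable fun a => f a % g a := Primrec.nat_mod.to_comp.comp hf hg

@[fun_prop] theorem computable_max {f g : α → ℕ} (hf : Computable f) (hg : Computable g) :
    Computable fun a => max (f a) (g a) := Primrec.nat_max.to_comp.comp hf hg

@[fun_prop] theorem computable_beq [DecidableEq β] {f g : α → β} (hf : Computable f)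
    (hg : Computable g) : Computable fun a => f a == g a := by
  have : Computable₂ fun a b : β => decide (a = b) := (Primrec.eq (α := β)).decide.to_comp
  exact (this.comp hf hg).of_eq fun a => by rw [beq_eq_decide]

@[fun_prop] theorem computable_ble {f g : α → ℕ} (hf : Computable f) (hg : Computable g) :
    Computable fun a => (f a).ble (g a) := by
  have : Computable₂ fun a b : ℕ => decide (a ≤ b) := Primrec.nat_le.decide.to_comp
  exact (this.comp hf hg).of_eq fun a => by
    rw [Bool.eq_iff_iff]; simp

@[fun_prop] theorem computable_unpair {f : α → ℕ} (hf : Computable f) :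
    Computable fun a => (f a).unpair := Computable.unpair.comp hf

@[fun_prop] theorem computable_natPair {f g : α → ℕ} (hf : Computable f) (hg : Computable g) :
    Computable fun a => Nat.pair (f a) (g a) := Primrec₂.natPair.to_comp.comp hf hg

@[fun_prop] theorem computable_encode {f : α → β} (hf : Computable f) :
    Computable fun a => Encodable.encode (f a) := Computable.encode.comp hf

@[fun_prop] theorem computable_decode {f : α → ℕ} (hf : Computable f) :
    Computable fun a => (Encodable.decode (f a) : Option β) := Computable.decode.comp hf

@[fun_prop] theorem computable_natRec {f : α → ℕ} {g : α → σ} {h : α → ℕ → σ → σ}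
    (hf : Computable f) (hg : Computable g)
    (hh : Computable fun p : α × ℕ × σ => h p.1 p.2.1 p.2.2) :
    Computable fun a => Nat.rec (motive := fun _ => σ) (g a) (h a) (f a) :=
  Computable.nat_rec (h := fun a p => h a p.1 p.2) hf hg hh

/-- Turns a fold into primitive recursion on the length, reading the list by index. The fallback
value in `getD` is never reached, since the index stays below the length. -/
theorem foldl_eq_natRec {β σ : Type} (h : σ → β → σ) (s : σ) (l : List β) :
    l.foldl h s = Nat.rec (motive := fun _ => σ) s
      (fun n r => ((l[n]?).map (h r)).getD r) l.length := by
  suffices H : ∀ n, n ≤ l.length → (l.take n).foldl h s = Nat.rec (motive := fun _ => σ) s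
      (fun n r => ((l[n]?).map (h r)).getD r) n by simpa using H l.length le_rfl
  intro n
  induction n with
  | zero => simp
  | succ n ih =>
    intro hn
    have hn' : n < l.length := hn
    rw [List.take_add_one, List.foldl_append, ih hn'.le]
    simp [hn']

@[fun_prop] theorem computable_option_map {f : α → Option β} {g : α → β → σ} (hf : Computable f)
    (hg : Computable fun p : α × β => g p.1 p.2) : Computable fun a => (f a).map (g a) :=
  Computable.option_map hf hg

@[fun_prop] theorem computable_foldl {f : α → List β} {g : α → σ} {h : α → σ → β → σ}
    (hf : Computable f) (hg : Computable g)
    (hh : Computable fun p : α × σ × β => h p.1 p.2.1 p.2.2) :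
    Computable fun a => (f a).foldl (h a) (g a) := by
  have : Computable fun a => Nat.rec (motive := fun _ => σ) (g a)
      (fun n r => (((f a)[n]?).map (h a r)).getD r) (f a).length := by
    refine computable_natRec (h := fun a n r => (((f a)[n]?).map (h a r)).getD r) (by fun_prop) hg ?_
    refine computable_option_getD (computable_option_map (g := fun (p : α × ℕ × σ) b => h p.1 p.2.2 b)
      (by fun_prop) ?_) (by fun_prop)
    exact hh.comp (g := fun p : (α × ℕ × σ) × β => (p.1.1, p.1.2.2, p.2)) (by fun_prop)
  exact this.of_eq fun a => (foldl_eq_natRec _ _ _).symm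

@[fun_prop] theorem computable_flatMap {f : α → List β} {g : α → β → List σ} (hf : Computable f)
    (hg : Computable fun p : α × β => g p.1 p.2) : Computable fun a => (f a).flatMap (g a) := by
  have : Computable fun a => (f a).foldl (fun s b => s ++ g a b) [] := by
    refine computable_foldl (h := fun a s b => s ++ g a b) hf (by fun_prop) ?_
    exact computable_append (by fun_prop)
      (hg.comp (g := fun p : α × List σ × β => (p.1, p.2.2)) (by fun_prop))
  exact this.of_eq fun a => by
    have : ∀ l s, List.foldl (fun s b => s ++ g a b) s l = s ++ l.flatMap (g a) := by
      intro l
      induction l <;> simp_all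
    simp [this]

@[fun_prop] theorem computable_map {f : α → List β} {g : α → β → σ} (hf : Computable f)
    (hg : Computable fun p : α × β => g p.1 p.2) : Computable fun a => (f a).map (g a) := by
  have : Computable fun a => (f a).flatMap (fun b => [g a b]) :=
    computable_flatMap (g := fun a b => [g a b]) hf (by fun_prop)
  exact this.of_eq fun a => by induction f a <;> simp_all

@[fun_prop] theorem computable_filter {f : α → List β} {g : α → β → Bool} (hf : Computable f)
    (hg : Computable fun p : α × β => g p.1 p.2) : Computable fun a => (f a).filter (g a) := by
  have : Computable fun a => (f a).flatMap (fun b => bif g a b then [b] else []) :=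
    computable_flatMap (g := fun a b => bif g a b then [b] else []) hf (by fun_prop)
  exact this.of_eq fun a => by
    induction f a with
    | nil => rfl
    | cons b l ih => cases h : g a b <;> simp_all

@[fun_prop] theorem computable_all {f : α → List β} {g : α → β → Bool} (hf : Computable f)
    (hg : Computable fun p : α × β => g p.1 p.2) : Computable fun a => (f a).all (g a) := by
  have : Computable fun a => ((f a).filter (fun b => !g a b)).length == 0 :=
    computable_beq (computable_length (computable_filter (g := fun a b => !g a b) hf (by fun_prop)))
      (by fun_prop)
  exact this.of_eq fun a => by
    rw [Bool.eq_iff_iff]; simp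

@[fun_prop] theorem computable_any {f : α → List β} {g : α → β → Bool} (hf : Computable f)
    (hg : Computable fun p : α × β => g p.1 p.2) : Computable fun a => (f a).any (g a) := by
  have : Computable fun a => !(f a).all (fun b => !g a b) :=
    computable_not (computable_all (g := fun a b => !g a b) hf (by fun_prop))
  exact this.of_eq fun a => by
    rw [Bool.eq_iff_iff]; simp

@[fun_prop] theorem computable_range {f : α → ℕ} (hf : Computable f) :
    Computable fun a => List.range (f a) := Primrec.list_range.to_comp.comp hf

@[fun_prop] theorem computable_replicate {f : α → ℕ} {g : α → β} (hf : Computable f)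
    (hg : Computable g) : Computable fun a => List.replicate (f a) (g a) := by
  have : Computable fun a => (List.range (f a)).map fun _ => g a :=
    computable_map (g := fun a _ => g a) (computable_range hf) (by fun_prop)
  exact this.of_eq fun a => by simp

@[fun_prop] theorem computable_take {f : α → ℕ} {g : α → List β} (hf : Computable f)
    (hg : Computable g) : Computable fun a => (g a).take (f a) :=
  Primrec.list_take.to_comp.comp hf hg

@[fun_prop] theorem computable_drop {f : α → ℕ} {g : α → List β} (hf : Computable f)
    (hg : Computable g) : Computable fun a => (g a).drop (f a) :=
  Primrec.list_drop.to_comp.comp hf hg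

@[fun_prop] theorem computable_reverse {f : α → List β} (hf : Computable f) :
    Computable fun a => (f a).reverse := Computable.list_reverse.comp hf

@[fun_prop] theorem computable_sublists' {f : α → List β} (hf : Computable f) :
    Computable fun a => (f a).sublists' := by
  have : Computable fun a => (f a).reverse.foldl (fun s b => s ++ s.map (fun l => b :: l)) [[]] := by
    fun_prop
  exact this.of_eq fun a => by
    rw [List.foldl_reverse]
    induction f a <;> simp_all

end Toolbox

/-- A decidable relation that is total has a computable choice function. -/
theorem exists_computable_choice {α β : Type} [Primcodable α] [Primcodable β] [Inhabited β]
    (R : α → β → Bool) (hR : Computable fun p : α × β => R p.1 p.2) (h : ∀ a, ∃ b, R a b = true) :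
    ∃ F : α → β, Computable F ∧ ∀ a, R a (F a) = true := by
  let P : α → ℕ → Prop := fun a n => ((Encodable.decode n : Option β).map (R a)).getD false = true
  have hP : ∀ a, ∃ n, P a n := fun a => by
    obtain ⟨b, hb⟩ := h a
    exact ⟨Encodable.encode b, by simp [P, hb]⟩
  -- Unbounded search over the codes of elements of `β`; numbers that decode to nothing are rejected
  -- by the value `false`.
  have hc : ComputablePred fun p : α × ℕ => P p.1 p.2 := by
    refine ⟨inferInstance, ?_⟩
    have : Computable fun p : α × ℕ =>
        ((Encodable.decode p.2 : Option β).map (R p.1)).getD false := by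
      refine computable_option_getD (computable_option_map (g := fun (p : α × ℕ) b => R p.1 b)
        (by fun_prop) ?_) (by fun_prop)
      exact hR.comp (g := fun p : (α × ℕ) × β => (p.1.1, p.2)) (by fun_prop)
    exact this.of_eq fun p => by simp [P]
  classical
  have hf := Computable.find (P := P) hc hP
  refine ⟨fun a => (Encodable.decode (Nat.find (hP a)) : Option β).getD default, by fun_prop, ?_⟩
  intro a
  have key : ∀ n, P a n → R a ((Encodable.decode n : Option β).getD default) = true := by
    intro n hn
    simp only [P] at hn
    cases hd : (Encodable.decode n : Option β) with
    | none => simp [hd] at hn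
    | some b => simpa [hd] using hn
  exact key _ (Nat.find_spec (hP a))

/-! ### Branching recursion of bounded depth -/

section FuelRec

variable {α σ : Type}

/-- Recursion along `calls`, up to a given depth. -/
def fuelRec (calls : α → List α) (comb : α → List σ → σ) (s : σ) : ℕ → α → σ
  | 0, _ => s
  | d + 1, a => comb a ((calls a).map (fuelRec calls comb s d))

/-- The values on a list of arguments, from the concatenated values on their calls. -/
def regroup (calls : α → List α) (comb : α → List σ → σ) (l : List α) (r : List σ) : List σ :=
  (l.foldl (fun s a => (s.1.drop (calls a).length,
    s.2 ++ [comb a (s.1.take (calls a).length)])) (r, [])).2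

/-- Each argument consumes from the front of the concatenated results as many entries as it has
calls. The induction needs an arbitrary accumulator. -/
theorem regroup_flatMap (calls : α → List α) (comb : α → List σ → σ) (f : α → σ) (l : List α) :
    regroup calls comb l ((l.flatMap calls).map f) = l.map fun a => comb a ((calls a).map f) := by
  suffices H : ∀ acc, (l.foldl (fun s a => (s.1.drop (calls a).length,
      s.2 ++ [comb a (s.1.take (calls a).length)])) ((l.flatMap calls).map f, acc)).2 =
      acc ++ l.map fun a => comb a ((calls a).map f) by simpa [regroup] using H []
  induction l with
  | nil => simp
  | cons a l ih =>
    intro acc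
    simp only [List.flatMap_cons, List.map_append, List.foldl_cons, List.map_cons]
    rw [List.drop_left' (by simp), List.take_left' (by simp), ih]
    simp

/-- The call tree is evaluated by levels, which replaces branching recursion by two primitive
recursions: `lev a n` lists all arguments at depth `n`, and `val a d n` computes the results on
level `d - n` from those one level deeper, starting at the bottom level `d`. -/
theorem computable_fuelRec [Primcodable α] [Primcodable σ] {calls : α → List α}
    {comb : α → List σ → σ} (s : σ) (hcalls : Computable calls)
    (hcomb : Computable fun p : α × List σ => comb p.1 p.2) :
    Computable fun p : ℕ × α => fuelRec calls comb s p.1 p.2 := by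
  let lev : α → ℕ → List α := fun a n =>
    Nat.rec (motive := fun _ => List α) [a] (fun _ l => l.flatMap calls) n
  let val : α → ℕ → ℕ → List σ := fun a d n => Nat.rec (motive := fun _ => List σ)
    ((lev a d).map fun _ => s) (fun n r => regroup calls comb (lev a (d - n - 1)) r) n
  have hlev : Computable fun p : α × ℕ => lev p.1 p.2 :=
    computable_natRec (f := fun p : α × ℕ => p.2) (g := fun p => [p.1])
      (h := fun _ _ (l : List α) => l.flatMap calls) (by fun_prop) (by fun_prop) (by fun_prop)
  have hre : Computable fun p : List α × List σ => regroup calls comb p.1 p.2 := by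
    unfold regroup
    have : Computable fun p : (List α × List σ) × (List σ × List σ) × α =>
        comb p.2.2 (p.2.1.1.take (calls p.2.2).length) :=
      hcomb.comp (g := fun p : (List α × List σ) × (List σ × List σ) × α =>
        (p.2.2, p.2.1.1.take (calls p.2.2).length)) (by fun_prop)
    fun_prop
  have hval : Computable fun p : (α × ℕ) × ℕ => val p.1.1 p.1.2 p.2 := by
    refine computable_natRec (h := fun (p : (α × ℕ) × ℕ) n r =>
      regroup calls comb (lev p.1.1 (p.1.2 - n - 1)) r) (by fun_prop) ?_ ?_
    · exact computable_map (hlev.comp (g := fun p : (α × ℕ) × ℕ => p.1) (by fun_prop)) (by fun_prop)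
    · refine hre.comp (g := fun p : ((α × ℕ) × ℕ) × ℕ × List σ =>
        (lev p.1.1.1 (p.1.1.2 - p.2.1 - 1), p.2.2)) (computable_pair ?_ (by fun_prop))
      exact hlev.comp (g := fun p : ((α × ℕ) × ℕ) × ℕ × List σ =>
        (p.1.1.1, p.1.1.2 - p.2.1 - 1)) (by fun_prop)
  have key : ∀ a d n, n ≤ d → val a d n = (lev a (d - n)).map (fuelRec calls comb s n) := by
    intro a d n
    induction n with
    | zero => exact fun _ => List.map_congr_left fun _ _ => rfl
    | succ n ih =>
      intro hn
      have e : d - n = (d - n - 1) + 1 := by omega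
      change regroup calls comb (lev a (d - n - 1)) (val a d n) = _
      rw [ih (by omega), e]
      change regroup calls comb (lev a (d - n - 1))
        (((lev a (d - n - 1)).flatMap calls).map _) = _
      rw [regroup_flatMap]
      rfl
  have : Computable fun p : ℕ × α => (val p.2 p.1 p.1).getD 0 s :=
    computable_getD (hval.comp (g := fun p : ℕ × α => ((p.2, p.1), p.1)) (by fun_prop))
      (by fun_prop) (by fun_prop)
  exact this.of_eq fun p => by
    rw [key _ _ _ le_rfl, Nat.sub_self]
    simp [lev]

end FuelRec

end AtomSets

/-! ### Action of automorphisms on sets with atoms -/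

namespace AtomSets

open FirstOrder

variable {A : Type u}

/-- Replacement of the atoms of a name. -/
def PreASet.map (g : A → A) : PreASet A → PreASet A
  | .atom a => .atom (g a)
  | .family ι f => .family ι fun i => PreASet.map g (f i)

theorem PreASet.Equiv.map (g : A → A) {x y : PreASet A} (h : PreASet.Equiv x y) :
    PreASet.Equiv (x.map g) (y.map g) := by
  induction x generalizing y with
  | atom a =>
    cases y with
    | atom b => simp only [PreASet.Equiv] at h; subst h; exact PreASet.Equiv.refl _
    | family κ k => simp [PreASet.Equiv] at h
  | family ι f ih =>
    cases y with
    | atom b => simp [PreASet.Equiv] at h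
    | family κ k =>
      simp only [PreASet.Equiv, PreASet.map] at h ⊢
      exact ⟨fun i => (h.1 i).imp fun j hj => ih i hj, fun j => (h.2 j).imp fun i hi => ih i hi⟩

theorem PreASet.map_map (g h : A → A) (x : PreASet A) : (x.map h).map g = x.map (g ∘ h) := by
  induction x with
  | atom a => rfl
  | family ι f ih => simp [PreASet.map, ih]

theorem PreASet.map_id (x : PreASet A) : x.map id = x := by
  induction x with
  | atom a => rfl
  | family ι f ih => simp [PreASet.map, ih]

namespace ASet

/-- Replacement of the atoms of an object. -/
def map (g : A → A) : ASet A → ASet A :=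
  Quotient.map (PreASet.map g) fun _ _ h => PreASet.Equiv.map g h

@[simp] theorem map_map (g h : A → A) (x : ASet A) : map g (map h x) = map (g ∘ h) x := by
  induction x using Quotient.inductionOn with
  | h x => exact congrArg _ (PreASet.map_map g h x)

@[simp] theorem map_id (x : ASet A) : map id x = x := by
  induction x using Quotient.inductionOn with
  | h x => exact congrArg _ (PreASet.map_id x)

@[simp] theorem map_ofFamily (g : A → A) (ι : Type u) (f : ι → ASet A) :
    map g (ofFamily ι f) = ofFamily ι fun i => map g (f i) := by
  refine Quotient.sound (s := PreASet.setoid A) ?_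
  have key : ∀ i, PreASet.Equiv (PreASet.map g (Quotient.out (f i)))
      (Quotient.out (map g (f i))) := by
    intro i
    refine Quotient.exact (s := PreASet.setoid A) ?_
    have h1 : (Quotient.mk (PreASet.setoid A) (Quotient.out (map g (f i)))) = map g (f i) :=
      Quotient.out_eq _
    have h2 : map g (Quotient.mk (PreASet.setoid A) (Quotient.out (f i))) = map g (f i) :=
      congrArg (map g) (Quotient.out_eq (f i))
    exact h2.trans h1.symm
  exact ⟨fun i => ⟨i, key i⟩, fun i => ⟨i, key i⟩⟩

theorem mem_map {g : A → A} {x y : ASet A} (h : x ∈ y) : map g x ∈ map g y := by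
  obtain ⟨ι, f, rfl, i, rfl⟩ := h
  exact ⟨ι, _, map_ofFamily _ _ _, i, rfl⟩

theorem atom_ne_ofFamily (a : A) (ι : Type u) (f : ι → ASet A) : atom a ≠ ofFamily ι f := by
  intro h
  have := Quotient.exact (s := PreASet.setoid A) h
  exact this

theorem not_mem_atom (a : A) (x : ASet A) : x ∉ atom a := by
  rintro ⟨ι, f, h, -⟩
  exact atom_ne_ofFamily a ι f h

theorem not_isSet_atom (a : A) : ¬ (atom a).IsSet := by
  rintro ⟨ι, f, h⟩
  exact atom_ne_ofFamily a ι f h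

theorem atom_injective : Function.Injective (atom : A → ASet A) := fun _ _ h =>
  Quotient.exact (s := PreASet.setoid A) h

theorem isSet_ofFamily (ι : Type u) (f : ι → ASet A) : (ofFamily ι f).IsSet := ⟨ι, f, rfl⟩

theorem IsSet.ext {x y : ASet A} (hx : x.IsSet) (hy : y.IsSet) (h : ∀ z, z ∈ x ↔ z ∈ y) :
    x = y := by
  obtain ⟨ι, f, rfl⟩ := hx
  obtain ⟨κ, k, rfl⟩ := hy
  simp only [mem_ofFamily] at h
  refine ofFamily_eq_iff.2 ⟨fun i => (h _).1 ⟨i, rfl⟩, fun j => ?_⟩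
  obtain ⟨i, hi⟩ := (h (k j)).2 ⟨j, rfl⟩
  exact ⟨i, hi.symm⟩

@[simp] theorem mem_upair {x y z : ASet A} : z ∈ upair x y ↔ z = x ∨ z = y := by
  rw [upair, mem_ofFamily]
  constructor
  · rintro ⟨⟨_ | _⟩, rfl⟩ <;> simp
  · rintro (rfl | rfl)
    · exact ⟨⟨true⟩, rfl⟩
    · exact ⟨⟨false⟩, rfl⟩

theorem isSet_upair (x y : ASet A) : (upair x y).IsSet := isSet_ofFamily _ _

@[simp] theorem map_upair (g : A → A) (x y : ASet A) :
    map g (upair x y) = upair (map g x) (map g y) := by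
  rw [upair, map_ofFamily, upair]
  congr 1
  funext b
  split_ifs <;> rfl

@[simp] theorem map_pair (g : A → A) (x y : ASet A) :
    map g (pair x y) = pair (map g x) (map g y) := by
  simp [pair]

theorem upair_eq_upair {x y x' y' : ASet A} (h : upair x y = upair x' y') :
    (x = x' ∧ y = y') ∨ (x = y' ∧ y = x') := by
  have h1 : ∀ z, (z = x ∨ z = y) ↔ (z = x' ∨ z = y') := fun z => by
    rw [← mem_upair, h, mem_upair]
  have hx := (h1 x).1 (.inl rfl)
  have hy := (h1 y).1 (.inr rfl)
  have hx' := (h1 x').2 (.inl rfl)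
  have hy' := (h1 y').2 (.inr rfl)
  grind

theorem pair_injective {x y x' y' : ASet A} (h : pair x y = pair x' y') : x = x' ∧ y = y' := by
  rcases upair_eq_upair h with ⟨h1, h2⟩ | ⟨h1, h2⟩
  · rcases upair_eq_upair h1 with h | h <;> rcases upair_eq_upair h2 with h' | h' <;> grind
  · rcases upair_eq_upair h1 with h | h <;> rcases upair_eq_upair h2 with h' | h' <;> grind

theorem map_foldl_pair (g : A → A) (l : List (ASet A)) (x : ASet A) :
    map g (l.foldl pair x) = (l.map (map g)).foldl pair (map g x) := by
  induction l generalizing x with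
  | nil => rfl
  | cons y l ih => simp [ih]

end ASet

variable {L : FirstOrder.Language.{v, w}} [L.Structure A]

theorem realize_congr_freeVar {n : ℕ} (φ : L.BoundedFormula ℕ n) {v v' : ℕ → A} {xs : Fin n → A}
    (h : ∀ i ∈ φ.freeVarFinset, v i = v' i) : φ.Realize v xs ↔ φ.Realize v' xs := by
  rw [← Language.BoundedFormula.realize_restrictFreeVar' (Set.Subset.refl _) (φ := φ) (v := v),
    ← Language.BoundedFormula.realize_restrictFreeVar' (Set.Subset.refl _) (φ := φ) (v := v')]
  have : (v ∘ fun i : (φ.freeVarFinset : Set ℕ) => (i : ℕ)) = v' ∘ fun i : (φ.freeVarFinset : Set ℕ) => (i : ℕ) :=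
    funext fun i => h i i.2
  rw [this]

namespace SetExpr

theorem mem_eval_union {k : ℕ} {body : Fin k → SetExpr L} {bound : Fin k → List ℕ}
    {guard : Fin k → L.Formula ℕ} {val : ℕ → A} {x : ASet A} :
    x ∈ (union k body bound guard).eval val ↔ ∃ i, ∃ p : ℕ → A,
      (∀ j, j ∉ bound i → p j = val j) ∧ (guard i).Realize p ∧ x = (body i).eval p := by
  rw [eval, ASet.mem_ofFamily]
  constructor
  · rintro ⟨⟨⟨i, p⟩, h1, h2⟩, rfl⟩
    exact ⟨i, p, h1, h2, rfl⟩
  · rintro ⟨i, p, h1, h2, rfl⟩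
    exact ⟨⟨⟨i, p⟩, h1, h2⟩, rfl⟩

theorem isSet_eval_union {k : ℕ} (body : Fin k → SetExpr L) (bound : Fin k → List ℕ)
    (guard : Fin k → L.Formula ℕ) (val : ℕ → A) :
    ((union k body bound guard).eval val).IsSet := ⟨_, _, rfl⟩

/-- Automorphisms preserve the guards, so they permute the valuations that index a set-builder
expression. This equivariance is the source of every invariance statement below. -/
theorem eval_comp_equiv (g : A ≃[L] A) (e : SetExpr L) (val : ℕ → A) :
    e.eval (g ∘ val) = ASet.map g (e.eval val) := by
  have key : ∀ (g : A ≃[L] A) (e : SetExpr L), (∀ val : ℕ → A,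
      e.eval (g ∘ val) = ASet.map g (e.eval val)) := by
    intro g e
    induction e with
    | var i => intro val; rfl
    | union k body bound guard ih =>
      intro val
      rw [eval, eval, ASet.map_ofFamily, ASet.ofFamily_eq_iff]
      constructor
      · rintro ⟨⟨i, p⟩, h1, h2⟩
        have hp : g ∘ (g.symm ∘ p) = p := by funext j; simp
        refine ⟨⟨⟨i, g.symm ∘ p⟩, fun j hj => ?_, ?_⟩, ?_⟩
        · have := h1 j hj
          simp only [Function.comp_apply] at this ⊢
          simp [this]
        · have := Language.StrongHomClass.realize_formula g (guard i) (v := g.symm ∘ p)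
          rw [hp] at this
          exact this.1 h2
        · simp only
          rw [← ih, hp]
      · rintro ⟨⟨i, p⟩, h1, h2⟩
        refine ⟨⟨⟨i, g ∘ p⟩, fun j hj => ?_, ?_⟩, ?_⟩
        · have := h1 j hj
          simp only [Function.comp_apply] at this ⊢
          simp [this]
        · exact (Language.StrongHomClass.realize_formula g (guard i)).2 h2
        · exact ih i p
  exact key g e val

theorem eval_congr (e : SetExpr L) {val val' : ℕ → A} (h : ∀ i ∈ e.free, val i = val' i) :
    e.eval val = e.eval val' := by
  induction e generalizing val val' with
  | var i => simp [eval, h i (by simp [free])]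
  | union k body bound guard ih =>
    refine (isSet_eval_union _ _ _ _).ext (isSet_eval_union _ _ _ _) fun x => ?_
    have key : ∀ {val val' : ℕ → A}, (∀ i ∈ (union k body bound guard).free, val i = val' i) →
        x ∈ (union k body bound guard).eval val → x ∈ (union k body bound guard).eval val' := by
      intro val val' h hx
      obtain ⟨i, p, h1, h2, rfl⟩ := mem_eval_union.1 hx
      -- The valuation `p` extends `val`, not `val'`, so it is overwritten by `val'` outside the
      -- bound variables. This changes nothing at the free variables of the body and the guard.
      have hp : ∀ j, j ∈ (body i).free ∨ j ∈ (guard i).freeVarFinset →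
          p j = if j ∈ bound i then p j else val' j := by
        intro j hj
        split_ifs with hb
        · rfl
        · rw [h1 j hb]
          exact h j ⟨i, hj, hb⟩
      refine mem_eval_union.2 ⟨i, fun j => if j ∈ bound i then p j else val' j,
        fun j hj => if_neg hj, ?_, ?_⟩
      · exact (realize_congr_freeVar _ fun j hj => hp j (.inr hj)).1 h2
      · exact ih i fun j hj => hp j (.inl hj)
    exact ⟨key h, key fun i hi => (h i hi).symm⟩

end SetExpr

theorem ASet.map_equiv_injective (g : A ≃[L] A) : Function.Injective (ASet.map g) := by
  intro x y h
  have := congrArg (ASet.map g.symm) h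
  have e : (g.symm : A → A) ∘ g = id := by funext a; simp
  simpa [e] using this

theorem ASet.map_symm_map (g : A ≃[L] A) (x : ASet A) : ASet.map g.symm (ASet.map g x) = x := by
  have e : (g.symm : A → A) ∘ g = id := by funext a; simp
  simp [e]

theorem ASet.map_map_symm (g : A ≃[L] A) (x : ASet A) : ASet.map g (ASet.map g.symm x) = x := by
  have e : (g : A → A) ∘ g.symm = id := by funext a; simp
  simp [e]

theorem ASet.map_mem_map_iff (g : A ≃[L] A) {x y : ASet A} :
    ASet.map g x ∈ ASet.map g y ↔ x ∈ y := by
  refine ⟨fun h => ?_, ASet.mem_map⟩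
  have := ASet.mem_map (g := g.symm) h
  rwa [ASet.map_symm_map, ASet.map_symm_map] at this

theorem ASet.map_comp_equiv (g h : A ≃[L] A) (x : ASet A) :
    ASet.map (g.comp h) x = ASet.map g (ASet.map h x) := by
  rw [ASet.map_map]
  rfl

end AtomSets

/-! ### Orbits of tuples are definable -/

namespace AtomSets

open FirstOrder Language

section Orbits

variable {A : Type u} {L : FirstOrder.Language.{v, w}} [L.Structure A]

/-- Two tuples satisfy the same formulas. -/
def TypeEq (L : FirstOrder.Language.{v, w}) [L.Structure A] {n : ℕ} (a b : Fin n → A) : Prop :=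
  ∀ φ : L.Formula (Fin n), φ.Realize a ↔ φ.Realize b

theorem TypeEq.of_equiv {n : ℕ} {a b : Fin n → A} (g : A ≃[L] A) (h : ∀ i, g (a i) = b i) :
    TypeEq L a b := by
  intro φ
  have : b = g ∘ a := funext fun i => (h i).symm
  rw [this]
  exact (StrongHomClass.realize_formula g φ).symm

theorem TypeEq.symm {n : ℕ} {a b : Fin n → A} (h : TypeEq L a b) : TypeEq L b a :=
  fun φ => (h φ).symm

/-- For each of the finitely many orbits, choose a formula that holds at `a` and fails at the
representative, unless that has the type of `a`. The conjunction isolates the type, because types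
are constant on orbits. -/
theorem exists_isolating_formula (hfin : ∀ n, Finite (Quotient (orbitSetoid L A n))) {n : ℕ}
    (a : Fin n → A) : ∃ φ : L.Formula (Fin n), φ.Realize a ∧ ∀ b, φ.Realize b → TypeEq L a b := by
  have hψ : ∀ c : Fin n → A, ∃ ψ : L.Formula (Fin n), ψ.Realize a ∧ (ψ.Realize c → TypeEq L a c) := by
    intro c
    by_cases h : TypeEq L a c
    · exact ⟨⊤, by simp, fun _ => h⟩
    · simp only [TypeEq, not_forall] at h
      obtain ⟨φ, hφ⟩ := h
      by_cases ha : φ.Realize a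
      · exact ⟨φ, ha, fun hc => absurd (iff_of_true ha hc) hφ⟩
      · exact ⟨φ.not, by simpa using ha, fun hc => absurd (iff_of_false ha (by simpa using hc)) hφ⟩
  choose ψ h1 h2 using hψ
  have := hfin n
  refine ⟨BoundedFormula.iInf fun q : Quotient (orbitSetoid L A n) => ψ q.out, ?_, ?_⟩
  · rw [Formula.Realize, BoundedFormula.realize_iInf]
    exact fun q => h1 _
  · intro b hb
    rw [Formula.Realize, BoundedFormula.realize_iInf] at hb
    obtain ⟨g, hg⟩ : (orbitSetoid L A n) (Quotient.mk (orbitSetoid L A n) b).out b :=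
      Quotient.exact (Quotient.out_eq _)
    have h3 := TypeEq.of_equiv g hg
    have h4 := h2 _ ((h3 _).2 (hb (Quotient.mk _ b)))
    exact fun φ => (h4 φ).trans (h3 φ)

/-- The one-point extension step of back-and-forth: the formula isolating the type of the extended
tuple, quantified existentially in its last variable, belongs to the common type of `a` and `b`. -/
theorem TypeEq.exists_snoc (hfin : ∀ n, Finite (Quotient (orbitSetoid L A n))) {n : ℕ}
    {a b : Fin n → A} (h : TypeEq L a b) (x : A) :
    ∃ y : A, TypeEq L (Fin.snoc a x : Fin (n + 1) → A) (Fin.snoc b y : Fin (n + 1) → A) := by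
  obtain ⟨φ, h1, h2⟩ := exists_isolating_formula hfin (Fin.snoc a x : Fin (n + 1) → A)
  let r : Fin (n + 1) → Fin n ⊕ Fin 1 := Fin.lastCases (.inr 0) .inl
  have hr : ∀ (c : Fin n → A) (i : Fin 1 → A),
      Sum.elim c i ∘ r = (Fin.snoc c (i 0) : Fin (n + 1) → A) := by
    intro c i
    funext j
    refine Fin.lastCases ?_ (fun j => ?_) j <;> simp [r]
  have key : ∀ c : Fin n → A, (Formula.iExs (Fin 1) (φ.relabel r)).Realize c ↔
      ∃ y, φ.Realize (Fin.snoc c y : Fin (n + 1) → A) := by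
    intro c
    rw [Formula.realize_iExs]
    simp only [Formula.realize_relabel, hr]
    exact ⟨fun ⟨i, hi⟩ => ⟨_, hi⟩, fun ⟨y, hy⟩ => ⟨fun _ => y, hy⟩⟩
  obtain ⟨y, hy⟩ := (key b).1 ((h _).1 ((key a).2 ⟨x, h1⟩))
  exact ⟨y, h2 _ hy⟩

/-- A finite partial map of atoms that preserves types, given as a list of pairs. -/
structure PartialAut (L : FirstOrder.Language.{v, w}) (A : Type u) [L.Structure A] where
  n : ℕ
  dom : Fin n → A
  img : Fin n → A
  typeEq : TypeEq L dom img

/-- The graph of a finite partial map. -/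
def PartialAut.graph (p : PartialAut L A) (x y : A) : Prop := ∃ i, p.dom i = x ∧ p.img i = y

theorem PartialAut.exists_extend (hfin : ∀ n, Finite (Quotient (orbitSetoid L A n)))
    (p : PartialAut L A) (x : A) : ∃ q : PartialAut L A, p.graph ≤ q.graph ∧
      (∃ y, q.graph x y) ∧ (∃ y, q.graph y x) := by
  obtain ⟨y, hy⟩ := p.typeEq.exists_snoc hfin x
  obtain ⟨z, hz⟩ := hy.symm.exists_snoc hfin x
  refine ⟨⟨_, _, _, hz.symm⟩, ?_, ⟨y, (Fin.last _).castSucc, ?_⟩, ⟨z, Fin.last _, ?_⟩⟩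
  · rintro _ _ ⟨i, rfl, rfl⟩
    exact ⟨i.castSucc.castSucc, by simp, by simp⟩
  all_goals simp

theorem TypeEq.eq_iff {n : ℕ} {a b : Fin n → A} (h : TypeEq L a b) (i j : Fin n) :
    a i = a j ↔ b i = b j := by
  simpa using h (Term.equal (Term.var i) (Term.var j))

theorem TypeEq.rel_iff {n k : ℕ} {a b : Fin n → A} (h : TypeEq L a b) (R : L.Relations k)
    (i : Fin k → Fin n) : Structure.RelMap R (fun j => a (i j)) ↔
      Structure.RelMap R (fun j => b (i j)) := by
  simpa [Formula.realize_rel] using h (R.formula fun j => Term.var (i j))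

/-- Back-and-forth along an enumeration of `A`: each stage puts the next atom into both the domain
and the image, and the union of the chain of finite partial maps is an automorphism. -/
theorem TypeEq.exists_equiv [L.IsRelational] [Countable A]
    (hfin : ∀ n, Finite (Quotient (orbitSetoid L A n))) {n : ℕ} {a b : Fin n → A}
    (h : TypeEq L a b) : ∃ g : A ≃[L] A, ∀ i, g (a i) = b i := by
  classical
  rcases isEmpty_or_nonempty A with hA | hA
  · exact ⟨Language.Equiv.refl L A, fun i => hA.elim (a i)⟩
  obtain ⟨enum, henum⟩ := exists_surjective_nat A
  choose ext h1 h2 h3 using PartialAut.exists_extend hfin (L := L) (A := A)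
  let s : ℕ → PartialAut L A := fun m =>
    Nat.rec (motive := fun _ => PartialAut L A) ⟨n, a, b, h⟩ (fun k p => ext p (enum k)) m
  have hs : Monotone fun m => (s m).graph := monotone_nat_of_le_succ fun m => h1 _ _
  let G : A → A → Prop := fun x y => ∃ m, (s m).graph x y
  have hfun : ∀ x, ∃ y, G x y := fun x => by
    obtain ⟨m, rfl⟩ := henum x
    obtain ⟨y, hy⟩ := h2 (s m) (enum m)
    exact ⟨y, m + 1, hy⟩
  have hsurj : ∀ x, ∃ y, G y x := fun x => by
    obtain ⟨m, rfl⟩ := henum x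
    obtain ⟨y, hy⟩ := h3 (s m) (enum m)
    exact ⟨y, m + 1, hy⟩
  -- Both pairs already occur at the later of the two stages, and equality of coordinates is part of
  -- the type.
  have huniq : ∀ {x y x' y'}, G x y → G x' y' → (x = x' ↔ y = y') := by
    rintro x y x' y' ⟨m, hm⟩ ⟨m', hm'⟩
    obtain ⟨i, rfl, rfl⟩ := hs (le_max_left m m') _ _ hm
    obtain ⟨j, rfl, rfl⟩ := hs (le_max_right m m') _ _ hm'
    exact (s (max m m')).typeEq.eq_iff i j
  choose f hf using hfun
  choose f' hf' using hsurj
  have hrel : ∀ {k : ℕ} (R : L.Relations k) (x : Fin k → A),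
      Structure.RelMap R (f ∘ x) ↔ Structure.RelMap R x := by
    intro k R x
    choose m hm using fun i => hf (x i)
    have : ∀ i, (s (Finset.univ.sup m)).graph (x i) (f (x i)) := fun i =>
      hs (Finset.le_sup (Finset.mem_univ i)) _ _ (hm i)
    choose j hj1 hj2 using this
    have := (s (Finset.univ.sup m)).typeEq.rel_iff R j
    simp only [hj1, hj2] at this
    exact this.symm
  refine ⟨⟨⟨f, f', fun x => (huniq (hf' _) (hf x)).2 rfl, fun y => (huniq (hf _) (hf' y)).1 rfl⟩,
    fun F => isEmptyElim F, hrel⟩, fun i => ?_⟩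
  exact (huniq (hf _) ⟨0, i, rfl, rfl⟩).1 rfl

/-- If there are finitely many orbits of tuples, then they are definable. -/
theorem exists_orbit_formula [L.IsRelational] [Countable A]
    (hfin : ∀ n, Finite (Quotient (orbitSetoid L A n))) {n : ℕ} (a : Fin n → A) :
    ∃ φ : L.Formula (Fin n), ∀ b, φ.Realize b ↔ ∃ g : A ≃[L] A, ∀ i, g (a i) = b i := by
  obtain ⟨φ, h1, h2⟩ := exists_isolating_formula hfin a
  refine ⟨φ, fun b => ⟨fun hb => (h2 b hb).exists_equiv hfin, ?_⟩⟩
  rintro ⟨g, hg⟩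
  exact (TypeEq.of_equiv g hg φ).1 h1

end Orbits

end AtomSets

/-! ### Recognizing codes of formulas -/

namespace AtomSets

open FirstOrder Language

section FormulaCodes

/-- The number is the code of a term in `N` free and `n` bound variables. -/
def termOk (N n t : ℕ) : Bool := bif t % 2 == 0 then (t / 2 + 1).ble N else (t / 2 + 1).ble n

@[fun_prop] theorem computable_termOk {α : Type} [Primcodable α] {f g h : α → ℕ}
    (hf : Computable f) (hg : Computable g) (hh : Computable h) :
    Computable fun a => termOk (f a) (g a) (h a) := by
  unfold termOk; fun_prop

/-- The immediate subformulas, for a code `p.2.2` of a formula in `p.1` free and `p.2.1` bound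
variables. -/
def formulaCalls (p : ℕ × ℕ × ℕ) : List (ℕ × ℕ × ℕ) :=
  bif p.2.2 % 4 == 3 then
    [(p.1, p.2.1, (p.2.2 / 4).unpair.1), (p.1, p.2.1, (p.2.2 / 4).unpair.2)]
  else bif p.2.2 == 0 then [] else bif p.2.2 % 4 == 0 then [(p.1, p.2.1 + 1, p.2.2 / 4 - 1)]
  else []

/-- The list that is encoded by a number. -/
def decodeList (c : ℕ) : List ℕ := (Encodable.decode c : Option (List ℕ)).getD []

@[fun_prop] theorem computable_decodeList {α : Type} [Primcodable α] {f : α → ℕ}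
    (hf : Computable f) : Computable fun a => decodeList (f a) := by
  unfold decodeList; fun_prop

/-- The pair of numbers consists of the codes of a relation symbol and of a list of terms. The list
`symb` contains the codes of the relation symbols with their arities. -/
def relOk (symb : List (ℕ × ℕ)) (N n : ℕ) (c : ℕ × ℕ) : Bool :=
  symb.any (fun s => s.1 == c.1 && s.2 == (decodeList c.2).length) &&
    (Encodable.encode (decodeList c.2) == c.2 && (decodeList c.2).all fun t => termOk N n t)

/-- Correctness of a code of a formula, apart from its subformulas. -/
def formulaLocal (symb : List (ℕ × ℕ)) (p : ℕ × ℕ × ℕ) : Bool :=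
  bif p.2.2 % 4 == 1 then
    termOk p.1 p.2.1 (p.2.2 / 4).unpair.1 && termOk p.1 p.2.1 (p.2.2 / 4).unpair.2
  else bif p.2.2 % 4 == 2 then relOk symb p.1 p.2.1 (p.2.2 / 4).unpair else true

/-- The number `p.2.2` is the code of a formula in `p.1` free and `p.2.1` bound variables. The
first argument bounds the depth of the formula. -/
def formulaOk (symb : List (ℕ × ℕ)) : ℕ → ℕ × ℕ × ℕ → Bool :=
  fuelRec formulaCalls (fun p r => r.all id && formulaLocal symb p) false

theorem computable_relOk (symb : List (ℕ × ℕ)) :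
    Computable fun p : ℕ × ℕ × ℕ × ℕ => relOk symb p.1 p.2.1 p.2.2 := by
  have h1 : Computable fun p : ℕ × ℕ × ℕ × ℕ =>
      symb.any (fun s => s.1 == p.2.2.1 && s.2 == (decodeList p.2.2.2).length) := by fun_prop
  have h2 : Computable fun p : ℕ × ℕ × ℕ × ℕ =>
      (Encodable.encode (decodeList p.2.2.2) == p.2.2.2) := by fun_prop
  have h3 : Computable fun p : ℕ × ℕ × ℕ × ℕ =>
      (decodeList p.2.2.2).all fun t => termOk p.1 p.2.1 t := by fun_prop
  exact computable_and h1 (computable_and h2 h3)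

theorem computable_formulaLocal (symb : List (ℕ × ℕ)) : Computable (formulaLocal symb) := by
  have h1 : Computable fun p : ℕ × ℕ × ℕ => relOk symb p.1 p.2.1 (p.2.2 / 4).unpair :=
    (computable_relOk symb).comp (g := fun p : ℕ × ℕ × ℕ => (p.1, p.2.1, (p.2.2 / 4).unpair))
      (by fun_prop)
  have h2 : Computable fun p : ℕ × ℕ × ℕ =>
      termOk p.1 p.2.1 (p.2.2 / 4).unpair.1 && termOk p.1 p.2.1 (p.2.2 / 4).unpair.2 := by fun_prop
  exact computable_cond (by fun_prop) h2 (computable_cond (by fun_prop) h1 (by fun_prop))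

theorem computable_formulaCalls : Computable formulaCalls := by
  unfold formulaCalls; fun_prop

theorem computable_formulaOk (symb : List (ℕ × ℕ)) :
    Computable fun p : ℕ × ℕ × ℕ × ℕ => formulaOk symb p.1 p.2 := by
  have := computable_formulaLocal symb
  exact computable_fuelRec _ computable_formulaCalls (by fun_prop)

theorem formulaOk_succ (symb : List (ℕ × ℕ)) (d : ℕ) (p : ℕ × ℕ × ℕ) :
    formulaOk symb (d + 1) p = true ↔
      (∀ q ∈ formulaCalls p, formulaOk symb d q = true) ∧ formulaLocal symb p = true := by
  simp [formulaOk, fuelRec]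

/-- The residue modulo 4 reveals the outermost constructor. Residue 0 is shared by falsity, with
code 0, and the universal quantifier, whose codes are positive. -/
theorem formula_cases_equal (symb : List (ℕ × ℕ)) (N n c : ℕ) :
    formulaCalls (N, n, 4 * c + 1) = [] ∧
    formulaLocal symb (N, n, 4 * c + 1) = (termOk N n c.unpair.1 && termOk N n c.unpair.2) := by
  have h1 : (4 * c + 1) % 4 = 1 := by omega
  have h2 : (4 * c + 1) / 4 = c := by omega
  simp only [formulaCalls, formulaLocal, h1, h2]
  exact ⟨rfl, rfl⟩

theorem formula_cases_rel (symb : List (ℕ × ℕ)) (N n c : ℕ) :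
    formulaCalls (N, n, 4 * c + 2) = [] ∧
    formulaLocal symb (N, n, 4 * c + 2) = relOk symb N n c.unpair := by
  have h1 : (4 * c + 2) % 4 = 2 := by omega
  have h2 : (4 * c + 2) / 4 = c := by omega
  simp only [formulaCalls, formulaLocal, h1, h2]
  exact ⟨rfl, rfl⟩

theorem formula_cases_imp (symb : List (ℕ × ℕ)) (N n c : ℕ) :
    formulaCalls (N, n, 4 * c + 3) = [(N, n, c.unpair.1), (N, n, c.unpair.2)] ∧
    formulaLocal symb (N, n, 4 * c + 3) = true := by
  have h1 : (4 * c + 3) % 4 = 3 := by omega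
  have h2 : (4 * c + 3) / 4 = c := by omega
  simp only [formulaCalls, formulaLocal, h1, h2]
  exact ⟨rfl, rfl⟩

theorem formula_cases_all (symb : List (ℕ × ℕ)) (N n c : ℕ) :
    formulaCalls (N, n, 4 * c + 4) = [(N, n + 1, c)] ∧
    formulaLocal symb (N, n, 4 * c + 4) = true := by
  have h1 : (4 * c + 4) % 4 = 0 := by omega
  have h2 : (4 * c + 4) / 4 - 1 = c := by omega
  simp only [formulaCalls, formulaLocal, h1, h2]
  exact ⟨rfl, rfl⟩

variable {L : FirstOrder.Language.{v, w}} [L.IsRelational] {A : Type u}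

theorem exists_term_of_termOk [L.Structure A] {N n t : ℕ} (h : termOk N n t = true) :
    ∃ s : L.Term (ℕ ⊕ Fin n), termCode s = t ∧ ∀ (v v' : ℕ → A) (xs : Fin n → A),
      (∀ i < N, v i = v' i) → s.realize (Sum.elim v xs) = s.realize (Sum.elim v' xs) := by
  unfold termOk at h
  cases ht : (t % 2 == 0)
  · simp only [ht, cond_false, Nat.ble_eq] at h
    simp at ht
    refine ⟨.var (.inr ⟨t / 2, h⟩), ?_, fun v v' xs _ => rfl⟩
    simp only [termCode]; omega
  · simp only [ht, cond_true, Nat.ble_eq] at h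
    simp at ht
    refine ⟨.var (.inl (t / 2)), ?_, fun v v' xs hv => hv _ h⟩
    simp only [termCode]; omega

variable (E : Encoding L A)

/-- Soundness of the syntax check. It is needed since the satisfaction procedure is specified only
on codes of formulas, and the search for formulas runs over numbers. Dependence on the first `N`
variables only matters because valuations given by lists are padded by a default atom, which an
automorphism need not fix. -/
theorem exists_formula_of_formulaOk [L.Structure A] {symb : List (ℕ × ℕ)}
    (hsymb : ∀ s ∈ symb, ∃ R : Σ n, L.Relations n, s = (Encodable.encode (E.symb R), R.1))
    {d N n c : ℕ} (h : formulaOk symb d (N, n, c) = true) :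
    ∃ φ : L.BoundedFormula ℕ n, E.formulaCode φ = c ∧ ∀ (v v' : ℕ → A) (xs : Fin n → A),
      (∀ i < N, v i = v' i) → (φ.Realize v xs ↔ φ.Realize v' xs) := by
  induction d generalizing n c with
  | zero => simp [formulaOk, fuelRec] at h
  | succ d ih =>
    obtain ⟨h1, h2⟩ := (formulaOk_succ _ _ _).1 h
    obtain rfl | ⟨c, rfl | rfl | rfl | rfl⟩ : c = 0 ∨ ∃ c', c = 4 * c' + 1 ∨ c = 4 * c' + 2 ∨
        c = 4 * c' + 3 ∨ c = 4 * c' + 4 := by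
      by_cases c = 0
      · omega
      · exact .inr ⟨(c - 1) / 4, by omega⟩
    · exact ⟨.falsum, by simp [Encoding.formulaCode], fun v v' xs _ => Iff.rfl⟩
    · rw [(formula_cases_equal symb N n c).2, Bool.and_eq_true] at h2
      obtain ⟨s, h3, h4⟩ := exists_term_of_termOk (L := L) (A := A) h2.1
      obtain ⟨t, h5, h6⟩ := exists_term_of_termOk (L := L) (A := A) h2.2
      refine ⟨.equal s t, ?_, fun v v' xs hv => ?_⟩
      · simp only [Encoding.formulaCode, h3, h5, Nat.pair_unpair]
      · simp only [BoundedFormula.Realize]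
        rw [h4 v v' xs hv, h6 v v' xs hv]
    · simp only [(formula_cases_rel symb N n c).2, relOk, Bool.and_eq_true, List.any_eq_true,
        List.all_eq_true, beq_iff_eq] at h2
      obtain ⟨⟨s, hs, hR1, hR2⟩, h4, h5⟩ := h2
      obtain ⟨⟨k, R⟩, rfl⟩ := hsymb s hs
      simp only at hR1 hR2
      generalize hl : decodeList c.unpair.2 = l at *
      subst hR2
      choose t ht1 ht2 using fun i : Fin l.length =>
        exists_term_of_termOk (L := L) (A := A) (h5 (l.get i) (l.get_mem i))
      refine ⟨.rel R t, ?_, fun v v' xs hv => ?_⟩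
      -- The re-encoding test `h4` identifies the code of the decoded argument list with the
      -- original number.
      · simp only [Encoding.formulaCode, ht1, List.ofFn_get, h4, hR1, Nat.pair_unpair]
      · simp only [BoundedFormula.Realize]
        rw [funext fun i => ht2 i v v' xs hv]
    · rw [(formula_cases_imp symb N n c).1] at h1
      obtain ⟨φ, h3, h4⟩ := ih (h1 (N, n, c.unpair.1) (by simp))
      obtain ⟨ψ, h5, h6⟩ := ih (h1 (N, n, c.unpair.2) (by simp))
      refine ⟨.imp φ ψ, ?_, fun v v' xs hv => ?_⟩
      · simp only [Encoding.formulaCode, h3, h5, Nat.pair_unpair]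
      · simp only [BoundedFormula.realize_imp]
        rw [h4 v v' xs hv, h6 v v' xs hv]
    · rw [(formula_cases_all symb N n c).1] at h1
      obtain ⟨φ, h3, h4⟩ := ih (h1 (N, n + 1, c) (by simp))
      refine ⟨.all φ, by simp only [Encoding.formulaCode, h3], fun v v' xs hv => ?_⟩
      simp only [BoundedFormula.realize_all]
      exact forall_congr' fun x => h4 v v' _ hv

/-- A formula in `N` free variables, as a formula in the variables `i < N`. -/
def ofFinVars {N n : ℕ} (φ : L.BoundedFormula (Fin N) n) : L.BoundedFormula ℕ n :=
  φ.mapTermRel (fun _ t => t.relabel (Sum.map Fin.val id)) (fun _ => id) fun _ => id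

omit [L.IsRelational] in
theorem realize_ofFinVars [L.Structure A] {N n : ℕ} (φ : L.BoundedFormula (Fin N) n) (v : ℕ → A)
    (xs : Fin n → A) : (ofFinVars φ).Realize v xs ↔ φ.Realize (fun i => v i) xs := by
  refine BoundedFormula.realize_mapTermRel_id (fun n t xs => ?_) fun _ _ _ => rfl
  rw [Term.realize_relabel]
  congr 1
  funext i
  cases i <;> rfl

theorem termOk_relabel {N n : ℕ} (t : L.Term (Fin N ⊕ Fin n)) :
    termOk N n (termCode (t.relabel (Sum.map Fin.val id))) = true := by
  rcases t with (i | i) | ⟨f, _⟩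
  · simp only [Term.relabel, Sum.map_inl, termCode, termOk, Nat.mul_mod_right]
    simp
  · have h1 : (2 * (i : ℕ) + 1) % 2 = 1 := by omega
    have h2 : (2 * (i : ℕ) + 1) / 2 = i := by omega
    simp only [Term.relabel, Sum.map_inr, id, termCode, termOk, h1, h2]
    simp
  · exact isEmptyElim f

/-- Completeness of the syntax check: subformulas have strictly smaller codes, so any depth above
the code suffices. It guarantees that the search for separating formulas finds something. -/
theorem formulaOk_ofFinVars {symb : List (ℕ × ℕ)}
    (hsymb : ∀ R : Σ n, L.Relations n, (Encodable.encode (E.symb R), R.1) ∈ symb)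
    {N n : ℕ} (φ : L.BoundedFormula (Fin N) n) {d : ℕ} (hd : E.formulaCode (ofFinVars φ) < d) :
    formulaOk symb d (N, n, E.formulaCode (ofFinVars φ)) = true := by
  induction φ generalizing d with
  | falsum =>
    cases d with
    | zero => simp at hd
    | succ d => exact (formulaOk_succ _ _ _).2 ⟨by simp [ofFinVars, BoundedFormula.mapTermRel,
        Encoding.formulaCode, formulaCalls], rfl⟩
  | @equal n s t =>
    cases d with
    | zero => simp at hd
    | succ d =>
      have h := formula_cases_equal symb N n (Nat.pair
        (termCode (s.relabel (Sum.map Fin.val id))) (termCode (t.relabel (Sum.map Fin.val id))))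
      refine (formulaOk_succ _ _ _).2 ⟨fun q hq => absurd (h.1 ▸ hq) (by simp), h.2.trans ?_⟩
      simp [termOk_relabel]
  | @rel n k R ts =>
    cases d with
    | zero => simp at hd
    | succ d =>
      have h := formula_cases_rel symb N n (Nat.pair (Encodable.encode (E.symb ⟨k, R⟩))
        (Encodable.encode (List.ofFn fun i => termCode ((ts i).relabel (Sum.map Fin.val id)))))
      refine (formulaOk_succ _ _ _).2 ⟨fun q hq => absurd (h.1 ▸ hq) (by simp), h.2.trans ?_⟩
      simp only [relOk, Nat.unpair_pair, decodeList, Encodable.encodek, Option.getD_some,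
        List.length_ofFn, beq_self_eq_true, Bool.and_eq_true, List.any_eq_true, List.all_eq_true,
        List.mem_ofFn, beq_iff_eq]
      refine ⟨⟨_, hsymb ⟨k, R⟩, rfl, rfl⟩, trivial, ?_⟩
      rintro _ ⟨i, rfl⟩
      exact termOk_relabel _
  | @imp n φ ψ ih1 ih2 =>
    cases d with
    | zero => simp at hd
    | succ d =>
      have hl := Nat.left_le_pair (E.formulaCode (ofFinVars φ)) (E.formulaCode (ofFinVars ψ))
      have hr := Nat.right_le_pair (E.formulaCode (ofFinVars φ)) (E.formulaCode (ofFinVars ψ))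
      have hcode : E.formulaCode (ofFinVars (φ.imp ψ)) =
        4 * Nat.pair (E.formulaCode (ofFinVars φ)) (E.formulaCode (ofFinVars ψ)) + 3 := rfl
      have h := formula_cases_imp symb N n
        (Nat.pair (E.formulaCode (ofFinVars φ)) (E.formulaCode (ofFinVars ψ)))
      rw [hcode] at hd ⊢
      refine (formulaOk_succ _ _ _).2 ⟨?_, h.2⟩
      rw [h.1, Nat.unpair_pair]
      simpa using ⟨ih1 (d := d) (by omega), ih2 (d := d) (by omega)⟩
  | @all n φ ih =>
    cases d with
    | zero => simp at hd
    | succ d =>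
      have hcode : E.formulaCode (ofFinVars φ.all) = 4 * E.formulaCode (ofFinVars φ) + 4 := rfl
      have h := formula_cases_all symb N n (E.formulaCode (ofFinVars φ))
      rw [hcode] at hd ⊢
      refine (formulaOk_succ _ _ _).2 ⟨?_, h.2⟩
      rw [h.1]
      simpa using ih (d := d) (by omega)

end FormulaCodes

end AtomSets

/-! ### Computing with orbits of tuples -/

namespace AtomSets

open FirstOrder Language

/-- Lists of strings, which denote tuples of atoms. -/
abbrev Strings : Type := List (List Bool)

section Toolkit

variable {L : FirstOrder.Language.{v, w}} {A : Type u} [L.Structure A] (E : Encoding L A)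

/-- The automorphism maps the tuple denoted by `v` to the tuple denoted by `w`. -/
def Maps (g : A ≃[L] A) (v w : Strings) : Prop :=
  v.map (fun s => g (E.atom s)) = w.map E.atom

variable {E} {g h : A ≃[L] A} {v w v' w' t : Strings}

theorem Maps.length_eq (H : Maps E g v w) : v.length = w.length := by
  simpa using congrArg List.length H

theorem Maps.append (H : Maps E g v w) (H' : Maps E g v' w') : Maps E g (v ++ v') (w ++ w') := by
  unfold Maps at *
  rw [List.map_append, List.map_append, H, H']

theorem Maps.of_append (H : Maps E g (v ++ v') (w ++ w')) (hl : v.length = w.length) :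
    Maps E g v w ∧ Maps E g v' w' := by
  unfold Maps at *
  rw [List.map_append, List.map_append] at H
  exact List.append_inj H (by simpa using hl)

theorem Maps.comp (H : Maps E g v w) (H' : Maps E h w t) : Maps E (h.comp g) v t := by
  unfold Maps at *
  rw [← H', ← Function.comp_def h E.atom, ← List.map_map, ← H, List.map_map]
  rfl

theorem Maps.symm (H : Maps E g v w) : Maps E g.symm w v := by
  unfold Maps at *
  rw [← Function.comp_def g.symm E.atom, ← List.map_map, ← H, List.map_map]
  exact List.map_congr_left fun s _ => g.symm_apply_apply _

theorem maps_self_iff : Maps E g v v ↔ ∀ s ∈ v, g (E.atom s) = E.atom s := by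
  unfold Maps
  simp

theorem exists_maps (E : Encoding L A) (g : A ≃[L] A) (v : Strings) : ∃ w, Maps E g v w := by
  choose S hS using E.atom_surjective
  exact ⟨v.map fun s => S (g (E.atom s)), by simp [Maps, hS]⟩

theorem maps_iff : Maps E g v w ↔ v.length = w.length ∧
    ∀ i < v.length, g (E.val v i) = E.val w i := by
  constructor
  · intro H
    refine ⟨H.length_eq, fun i hi => ?_⟩
    have hi' : i < w.length := H.length_eq ▸ hi
    have := congrArg (fun l => l[i]?) H
    simpa [Encoding.val, hi, hi'] using this
  · rintro ⟨hl, H⟩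
    refine List.ext_getElem (by simpa using hl) fun i h1 h2 => ?_
    simp only [List.length_map] at h1 h2
    simpa [Encoding.val, h1, h2] using H i h1

/-- Beyond the end of the lists both valuations take the value `E.atom []`, which must therefore be
fixed. For this reason every context below contains the empty string. -/
theorem Maps.val_comp (H : Maps E g v w) (h0 : g (E.atom []) = E.atom []) :
    g ∘ E.val v = E.val w := by
  obtain ⟨hl, H⟩ := maps_iff.1 H
  funext i
  by_cases hi : i < v.length
  · exact H i hi
  · rw [Function.comp_apply, Encoding.val, Encoding.val, List.getD_eq_default _ _ (by omega),
      List.getD_eq_default _ _ (by omega), h0]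

theorem Maps.mono (H : Maps E g v v) (hs : w ⊆ v) : Maps E g w w :=
  maps_self_iff.2 fun s hw => maps_self_iff.1 H s (hs hw)

theorem eval_of_maps {g : A ≃[L] A} {v w : Strings} (H : Maps E g v w)
    (h0 : g (E.atom []) = E.atom []) (e : SetExpr L) :
    e.eval (E.val w) = ASet.map g (e.eval (E.val v)) := by
  rw [← SetExpr.eval_comp_equiv, H.val_comp h0]

theorem Maps.fix_nil {g : A ≃[L] A} {ctx : Strings} (H : Maps E g ctx ctx) (h0 : [] ∈ ctx) :
    g (E.atom []) = E.atom [] := maps_self_iff.1 H _ h0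

theorem Maps.map_take (H : Maps E g v w) (n : ℕ) : Maps E g (v.take n) (w.take n) := by
  unfold Maps at *
  rw [List.map_take, H, List.map_take]

variable (E) in
/-- Decision procedures for the satisfaction of formulas and for the orbits of tuples, and a list
of representatives of the orbits of `k`-tuples relative to a given tuple. -/
structure Toolkit [L.IsRelational] where
  sat : ℕ → Strings → Bool
  computable_sat : Computable fun p : ℕ × Strings => sat p.1 p.2
  sat_iff : ∀ (φ : L.Formula ℕ) v, sat (E.formulaCode φ) v = true ↔ φ.Realize (E.val v)
  orb : Strings → Strings → Bool
  computable_orb : Computable fun p : Strings × Strings => orb p.1 p.2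
  orb_iff : ∀ v w, orb v w = true ↔ ∃ g : A ≃[L] A, Maps E g v w
  ext : Strings → ℕ → List Strings
  computable_ext : Computable fun p : Strings × ℕ => ext p.1 p.2
  length_ext : ∀ v k, ∀ t ∈ ext v k, t.length = k
  exists_mem_ext : ∀ v s, ∃ t ∈ ext v s.length, ∃ g : A ≃[L] A, Maps E g v v ∧ Maps E g s t

omit [L.Structure A] in
theorem val_ofFn {n : ℕ} (f : Fin n → List Bool) (i : Fin n) :
    E.val (List.ofFn f) i = E.atom (f i) := by
  simp [Encoding.val]

/-- Some lists of representatives of the orbits and of formulas that separate the orbits. -/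
theorem exists_separation [L.IsRelational] {symb : List (ℕ × ℕ)}
    (hsymb : ∀ R : Σ n, L.Relations n, (Encodable.encode (E.symb R), R.1) ∈ symb)
    {sat : ℕ → Strings → Bool}
    (hsat : ∀ (φ : L.Formula ℕ) v, sat (E.formulaCode φ) v = true ↔ φ.Realize (E.val v))
    [Countable A] {f : ℕ → ℕ} (hf : ∀ n, ENat.card (Quotient (orbitSetoid L A n)) = (f n : ℕ∞))
    (n : ℕ) : ∃ (reps : List Strings) (forms : List ℕ), reps.length = f n ∧
      (∀ v ∈ reps, v.length = n) ∧ (∀ c ∈ forms, formulaOk symb (c + 1) (n, 0, c) = true) ∧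
      ∀ i < f n, ∀ j < f n, i = j ∨ ∃ c ∈ forms, sat c (reps.getD i []) ≠ sat c (reps.getD j []) := by
  have hfin : ∀ n, Finite (Quotient (orbitSetoid L A n)) := fun n => by
    rw [← ENat.card_lt_top, hf]
    exact ENat.natCast_lt_top _
  have hcard : Nat.card (Quotient (orbitSetoid L A n)) = f n := by
    have := hf n
    rw [ENat.card_eq_coe_natCard] at this
    exact_mod_cast this
  have := hfin n
  let e : Quotient (orbitSetoid L A n) ≃ Fin (f n) := Finite.equivFinOfCardEq hcard
  choose S hS using E.atom_surjective
  choose φ hφ using fun q : Quotient (orbitSetoid L A n) => exists_orbit_formula hfin q.out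
  let rep : Fin (f n) → Strings := fun i => List.ofFn fun k => S ((e.symm i).out k)
  have hrep : ∀ i (k : Fin n), E.val (rep i) k = (e.symm i).out k := fun i k => by
    simp only [rep, val_ofFn, hS]
  -- The formulas defining the orbits separate the representatives, each one singling out its own
  -- orbit.
  have hreal : ∀ i j, sat (E.formulaCode (ofFinVars (φ (e.symm i)))) (rep j) = true ↔ i = j := by
    intro i j
    rw [hsat, Formula.Realize, realize_ofFinVars]
    have : (fun k : Fin n => E.val (rep j) k) = (e.symm j).out := funext (hrep j)
    rw [this]
    refine (hφ _ _).trans ⟨fun hg => ?_, ?_⟩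
    · have : Quotient.mk (orbitSetoid L A n) (e.symm i).out = Quotient.mk _ (e.symm j).out :=
        Quotient.sound hg
      simpa using this
    · rintro rfl
      exact ⟨Language.Equiv.refl L A, fun _ => rfl⟩
  refine ⟨List.ofFn rep, List.ofFn fun i => E.formulaCode (ofFinVars (φ (e.symm i))),
    by simp, ?_, ?_, ?_⟩
  · intro v hv
    obtain ⟨i, rfl⟩ := (List.mem_ofFn' _ _).1 hv
    simp [rep]
  · intro c hc
    obtain ⟨i, rfl⟩ := (List.mem_ofFn' _ _).1 hc
    exact formulaOk_ofFinVars E hsymb _ (Nat.lt_succ_self _)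
  · intro i hi j hj
    by_cases hij : i = j
    · exact .inl hij
    · refine .inr ⟨_, (List.mem_ofFn' _ _).2 ⟨⟨i, hi⟩, rfl⟩, ?_⟩
      have h1 := hreal ⟨i, hi⟩ ⟨i, hi⟩
      have h2 := hreal ⟨i, hi⟩ ⟨j, hj⟩
      simp only [Fin.mk.injEq, hij, iff_false, iff_true] at h1 h2
      simp only [List.getD_eq_getElem?_getD, List.getElem?_ofFn, hi, hj, dif_pos,
        Option.getD_some, h1]
      exact Ne.symm h2

/-- The properties of the lists in `exists_separation`. -/
theorem separation_spec [L.IsRelational] {symb : List (ℕ × ℕ)}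
    (hsymb : ∀ s ∈ symb, ∃ R : Σ n, L.Relations n, s = (Encodable.encode (E.symb R), R.1))
    {sat : ℕ → Strings → Bool}
    (hsat : ∀ (φ : L.Formula ℕ) v, sat (E.formulaCode φ) v = true ↔ φ.Realize (E.val v))
    {f : ℕ → ℕ} (hf : ∀ n, ENat.card (Quotient (orbitSetoid L A n)) = (f n : ℕ∞))
    {n : ℕ} {reps : List Strings} {forms : List ℕ} (h1 : reps.length = f n)
    (h2 : ∀ v ∈ reps, v.length = n) (h3 : ∀ c ∈ forms, formulaOk symb (c + 1) (n, 0, c) = true)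
    (h4 : ∀ i < f n, ∀ j < f n,
      i = j ∨ ∃ c ∈ forms, sat c (reps.getD i []) ≠ sat c (reps.getD j [])) :
    (∀ v : Strings, v.length = n → ∃ u ∈ reps, ∃ g : A ≃[L] A, Maps E g v u) ∧
    ∀ v w : Strings, v.length = n → w.length = n →
      ((∀ c ∈ forms, sat c v = sat c w) ↔ ∃ g : A ≃[L] A, Maps E g v w) := by
  -- Accepted codes are formulas in the first `n` variables, hence constant on orbits of `n`-tuples.
  -- Nothing else about the formulas is used; they need not isolate single orbits.
  have hinv : ∀ c ∈ forms, ∀ v w : Strings, v.length = n → (∃ g : A ≃[L] A, Maps E g v w) →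
      sat c v = sat c w := by
    rintro c hc v w hv ⟨g, hg⟩
    obtain ⟨φ, rfl, hφ⟩ := exists_formula_of_formulaOk E hsymb (h3 c hc)
    rw [Bool.eq_iff_iff]
    refine (hsat φ v).trans (Iff.trans ?_ (hsat φ w).symm)
    rw [← StrongHomClass.realize_formula g φ]
    refine hφ _ _ _ fun i hi => ?_
    exact (maps_iff.1 hg).2 i (hv ▸ hi)
  have hcard : Nat.card (Quotient (orbitSetoid L A n)) = f n := by
    have := hf n
    have hfin : Finite (Quotient (orbitSetoid L A n)) := by
      rw [← ENat.card_lt_top, hf]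
      exact ENat.natCast_lt_top _
    rw [ENat.card_eq_coe_natCard] at this
    exact_mod_cast this
  have hlen : ∀ i : Fin (f n), (reps.getD i []) ∈ reps ∧ (reps.getD i []).length = n := by
    intro i
    have : (i : ℕ) < reps.length := by rw [h1]; exact i.2
    have hm : reps.getD i [] ∈ reps := by
      rw [List.getD_eq_getElem _ _ this]
      exact List.getElem_mem _
    exact ⟨hm, h2 _ hm⟩
  let F : Fin (f n) → Quotient (orbitSetoid L A n) := fun i =>
    Quotient.mk _ fun k => E.val (reps.getD i []) k
  have hF : ∀ (v w : Strings), v.length = n → w.length = n →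
      (Quotient.mk (orbitSetoid L A n) (fun k => E.val v k) =
        Quotient.mk (orbitSetoid L A n) fun k => E.val w k) →
      ∃ g : A ≃[L] A, Maps E g v w := by
    intro v w hv hw hq
    obtain ⟨g, hg⟩ := Quotient.exact hq
    exact ⟨g, maps_iff.2 ⟨hv.trans hw.symm, fun i hi => hg ⟨i, hv ▸ hi⟩⟩⟩
  -- Separated tuples lie in different orbits, and there are as many tuples as orbits, so every
  -- orbit is met.
  have hinj : Function.Injective F := by
    intro i j hij
    rcases h4 i i.2 j j.2 with h | ⟨c, hc, hne⟩
    · exact Fin.ext h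
    · exact absurd (hinv c hc _ _ (hlen i).2 (hF _ _ (hlen i).2 (hlen j).2 hij)) hne
  have hsurj : Function.Surjective F := by
    have hfin : Finite (Quotient (orbitSetoid L A n)) := by
      rw [← ENat.card_lt_top, hf]
      exact ENat.natCast_lt_top _
    exact ((Nat.bijective_iff_injective_and_card F).2 ⟨hinj, by simp [hcard]⟩).2
  have hrep : ∀ v : Strings, v.length = n → ∃ i : Fin (f n), ∃ g : A ≃[L] A,
      Maps E g v (reps.getD i []) := by
    intro v hv
    obtain ⟨i, hi⟩ := hsurj (Quotient.mk _ fun k => E.val v k)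
    exact ⟨i, hF _ _ hv (hlen i).2 hi.symm⟩
  refine ⟨fun v hv => ?_, fun v w hv hw => ⟨fun hvw => ?_, fun hg c hc => hinv c hc v w hv hg⟩⟩
  · obtain ⟨i, hi⟩ := hrep v hv
    exact ⟨_, (hlen i).1, hi⟩
  · obtain ⟨i, g, hg⟩ := hrep v hv
    obtain ⟨j, g', hg'⟩ := hrep w hw
    -- Tuples agreeing on all the formulas have representatives agreeing on them, and different
    -- representatives are separated.
    obtain rfl : i = j := by
      rcases h4 i i.2 j j.2 with h | ⟨c, hc, hne⟩
      · exact Fin.ext h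
      · exact absurd (by rw [← hinv c hc _ _ hv ⟨g, hg⟩, hvw c hc, hinv c hc _ _ hw ⟨g', hg'⟩]) hne
    exact ⟨_, hg.comp hg'.symm⟩

/-- Every condition on the two lists is a finite check with `sat` and the syntax test, so the lists
can be found by unbounded search. -/
theorem exists_computable_separation {symb : List (ℕ × ℕ)} {sat : ℕ → Strings → Bool}
    (hsat : Computable fun p : ℕ × Strings => sat p.1 p.2) {f : ℕ → ℕ} (hf : Computable f)
    (h : ∀ n, ∃ (reps : List Strings) (forms : List ℕ), reps.length = f n ∧
      (∀ v ∈ reps, v.length = n) ∧ (∀ c ∈ forms, formulaOk symb (c + 1) (n, 0, c) = true) ∧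
      ∀ i < f n, ∀ j < f n, i = j ∨
        ∃ c ∈ forms, sat c (reps.getD i []) ≠ sat c (reps.getD j [])) :
    ∃ F : ℕ → List Strings × List ℕ, Computable F ∧ ∀ n, (F n).1.length = f n ∧
      (∀ v ∈ (F n).1, v.length = n) ∧ (∀ c ∈ (F n).2, formulaOk symb (c + 1) (n, 0, c) = true) ∧
      ∀ i < f n, ∀ j < f n, i = j ∨
        ∃ c ∈ (F n).2, sat c ((F n).1.getD i []) ≠ sat c ((F n).1.getD j []) := by
  refine Exists.imp (fun F hF => ?_) (exists_computable_choice (fun n (z : List Strings × List ℕ) =>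
      (z.1.length == f n) && ((z.1.all fun v => v.length == n) &&
      ((z.2.all fun c => formulaOk symb (c + 1) (n, 0, c)) &&
      (List.range (f n)).all fun i => (List.range (f n)).all fun j => i == j ||
        z.2.any fun c => sat c (z.1.getD i []) ^^ sat c (z.1.getD j [])))) ?_ ?_)
  · refine ⟨hF.1, fun n => ?_⟩
    have := hF.2 n
    simp only [Bool.and_eq_true, beq_iff_eq, List.all_eq_true, List.mem_range, Bool.or_eq_true,
      List.any_eq_true, bne_iff_ne] at this
    exact this
  · have h1 : Computable fun p : (ℕ × List Strings × List ℕ) × ℕ =>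
        formulaOk symb (p.2 + 1) (p.1.1, 0, p.2) :=
      (computable_formulaOk symb).comp
        (g := fun p : (ℕ × List Strings × List ℕ) × ℕ => (p.2 + 1, p.1.1, 0, p.2)) (by fun_prop)
    have h2 : Computable fun p : (((ℕ × List Strings × List ℕ) × ℕ) × ℕ) × ℕ =>
        sat p.2 (p.1.1.1.2.1.getD p.1.1.2 []) :=
      hsat.comp (g := fun p : (((ℕ × List Strings × List ℕ) × ℕ) × ℕ) × ℕ =>
        (p.2, p.1.1.1.2.1.getD p.1.1.2 [])) (by fun_prop)
    have h3 : Computable fun p : (((ℕ × List Strings × List ℕ) × ℕ) × ℕ) × ℕ =>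
        sat p.2 (p.1.1.1.2.1.getD p.1.2 []) :=
      hsat.comp (g := fun p : (((ℕ × List Strings × List ℕ) × ℕ) × ℕ) × ℕ =>
        (p.2, p.1.1.1.2.1.getD p.1.2 [])) (by fun_prop)
    have h4 : Computable fun p : ((ℕ × List Strings × List ℕ) × ℕ) × ℕ =>
        p.1.1.2.2.any fun c => sat c (p.1.1.2.1.getD p.1.2 []) ^^ sat c (p.1.1.2.1.getD p.2 []) :=
      computable_any (g := fun (p : ((ℕ × List Strings × List ℕ) × ℕ) × ℕ) c =>
        sat c (p.1.1.2.1.getD p.1.2 []) ^^ sat c (p.1.1.2.1.getD p.2 [])) (by fun_prop)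
        (computable_xor h2 h3)
    have h5 : Computable fun p : ℕ × List Strings × List ℕ =>
        (List.range (f p.1)).all fun i => (List.range (f p.1)).all fun j => i == j ||
        p.2.2.any fun c => sat c (p.2.1.getD i []) ^^ sat c (p.2.1.getD j []) := by
      refine computable_all (g := fun (p : ℕ × List Strings × List ℕ) i =>
        (List.range (f p.1)).all fun j => i == j ||
        p.2.2.any fun c => sat c (p.2.1.getD i []) ^^ sat c (p.2.1.getD j [])) (by fun_prop) ?_
      refine computable_all (g := fun (p : (ℕ × List Strings × List ℕ) × ℕ) j => p.2 == j ||
        p.1.2.2.any fun c => sat c (p.1.2.1.getD p.2 []) ^^ sat c (p.1.2.1.getD j [])) (by fun_prop)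
        (computable_or (by fun_prop) h4)
    have h6 : Computable fun p : ℕ × List Strings × List ℕ =>
        p.2.2.all fun c => formulaOk symb (c + 1) (p.1, 0, c) :=
      computable_all (g := fun (p : ℕ × List Strings × List ℕ) c =>
        formulaOk symb (c + 1) (p.1, 0, c)) (by fun_prop) h1
    exact computable_and (by fun_prop) (computable_and (by fun_prop) (computable_and h6 h5))
  · intro n
    obtain ⟨reps, forms, H⟩ := h n
    refine ⟨(reps, forms), ?_⟩
    simp only [Bool.and_eq_true, beq_iff_eq, List.all_eq_true, List.mem_range, Bool.or_eq_true,
      List.any_eq_true, bne_iff_ne]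
    exact H

/-- Tuples are compared by their lengths and their values on the separating formulas for that
length. -/
theorem exists_computable_orb {sat : ℕ → Strings → Bool}
    (hsat : Computable fun p : ℕ × Strings => sat p.1 p.2) {F : ℕ → List Strings × List ℕ}
    (hF : Computable F) (spec : ∀ n, ∀ v w : Strings, v.length = n → w.length = n →
      ((∀ c ∈ (F n).2, sat c v = sat c w) ↔ ∃ g : A ≃[L] A, Maps E g v w)) :
    ∃ orb : Strings → Strings → Bool, Computable (fun p : Strings × Strings => orb p.1 p.2) ∧
      ∀ v w, orb v w = true ↔ ∃ g : A ≃[L] A, Maps E g v w := by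
  refine ⟨fun v w => (v.length == w.length) && (F v.length).2.all fun c => !(sat c v ^^ sat c w),
    ?_, fun v w => ?_⟩
  · have h1 : Computable fun p : (Strings × Strings) × ℕ => sat p.2 p.1.1 :=
      hsat.comp (g := fun p : (Strings × Strings) × ℕ => (p.2, p.1.1)) (by fun_prop)
    have h2 : Computable fun p : (Strings × Strings) × ℕ => sat p.2 p.1.2 :=
      hsat.comp (g := fun p : (Strings × Strings) × ℕ => (p.2, p.1.2)) (by fun_prop)
    have h3 : Computable fun p : Strings × Strings =>
        (F p.1.length).2.all fun c => !(sat c p.1 ^^ sat c p.2) :=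
      computable_all (g := fun (p : Strings × Strings) c => !(sat c p.1 ^^ sat c p.2))
        (by fun_prop) (computable_not (computable_xor h1 h2))
    exact computable_and (by fun_prop) h3
  · simp only [Bool.and_eq_true, beq_iff_eq, List.all_eq_true, Bool.not_eq_true', bne_eq_false_iff_eq]
    constructor
    · rintro ⟨hl, h⟩
      exact (spec v.length v w rfl hl.symm).1 h
    · rintro ⟨g, hg⟩
      exact ⟨hg.length_eq, (spec v.length v w rfl hg.length_eq.symm).2 ⟨g, hg⟩⟩

/-- Search for a list `X` of `k`-tuples such that each representative `u` of an orbit of tuples of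
length `v.length + k`, if its initial part lies in the orbit of `v`, is in the orbit of `v ++ t` for
some `t` in `X`. Given `s`, an automorphism taking `v ++ s` to its representative `u`, followed by
one from `u` to `v ++ t`, fixes `v` and takes `s` to `t`. -/
theorem exists_computable_ext {orb : Strings → Strings → Bool}
    (horbc : Computable fun p : Strings × Strings => orb p.1 p.2)
    (horb : ∀ v w, orb v w = true ↔ ∃ g : A ≃[L] A, Maps E g v w)
    {F : ℕ → List Strings} (hF : Computable F) (hlen : ∀ n, ∀ v ∈ F n, v.length = n)
    (spec : ∀ v : Strings, ∃ u ∈ F v.length, ∃ g : A ≃[L] A, Maps E g v u) :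
    ∃ X : Strings × ℕ → List Strings, Computable X ∧ (∀ p, ∀ t ∈ X p, t.length = p.2) ∧
      ∀ v s, ∃ t ∈ X (v, s.length), ∃ g : A ≃[L] A, Maps E g v v ∧ Maps E g s t := by
  refine Exists.imp (fun X hX => ?_) (exists_computable_choice (fun (p : Strings × ℕ) (X : List Strings) =>
      ((X.all fun t => t.length == p.2) && (F (p.1.length + p.2)).all fun u =>
        !orb p.1 (u.take p.1.length) || X.any fun t => orb (p.1 ++ t) u)) ?_ ?_)
  · refine ⟨hX.1, ?_, ?_⟩
    · intro p t ht
      have := hX.2 p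
      simp only [Bool.and_eq_true, List.all_eq_true, beq_iff_eq] at this
      exact this.1 t ht
    · intro v s
      have := hX.2 (v, s.length)
      simp only [Bool.and_eq_true, List.all_eq_true, Bool.or_eq_true, Bool.not_eq_true',
        List.any_eq_true] at this
      obtain ⟨u, hu, g, hg⟩ := spec (v ++ s)
      rw [List.length_append] at hu
      have h1 : orb v (u.take v.length) = true :=
        (horb _ _).2 ⟨g, by simpa using hg.map_take v.length⟩
      rcases this.2 u hu with h2 | ⟨t, ht, h2⟩
      · rw [h1] at h2; cases h2
      · obtain ⟨k, hk⟩ := (horb _ _).1 h2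
        have := (hg.comp hk.symm).of_append rfl
        exact ⟨t, ht, _, this.1, this.2⟩
  · have h1 : Computable fun p : ((Strings × ℕ) × List Strings) × Strings =>
        orb p.1.1.1 (p.2.take p.1.1.1.length) :=
      horbc.comp (g := fun p : ((Strings × ℕ) × List Strings) × Strings =>
        (p.1.1.1, p.2.take p.1.1.1.length)) (by fun_prop)
    have h2 : Computable fun p : (((Strings × ℕ) × List Strings) × Strings) × Strings =>
        orb (p.1.1.1.1 ++ p.2) p.1.2 :=
      horbc.comp (g := fun p : (((Strings × ℕ) × List Strings) × Strings) × Strings =>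
        (p.1.1.1.1 ++ p.2, p.1.2)) (by fun_prop)
    have h3 : Computable fun p : ((Strings × ℕ) × List Strings) × Strings =>
        p.1.2.any fun t => orb (p.1.1.1 ++ t) p.2 :=
      computable_any (g := fun (p : ((Strings × ℕ) × List Strings) × Strings) t =>
        orb (p.1.1.1 ++ t) p.2) (by fun_prop) h2
    have h5 : Computable fun p : (Strings × ℕ) × List Strings => F (p.1.1.length + p.1.2) :=
      hF.comp (g := fun p : (Strings × ℕ) × List Strings => p.1.1.length + p.1.2) (by fun_prop)
    have h6 := computable_or (computable_not h1) h3
    have h4 : Computable fun p : (Strings × ℕ) × List Strings =>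
        (F (p.1.1.length + p.1.2)).all fun u =>
          !orb p.1.1 (u.take p.1.1.length) || p.2.any fun t => orb (p.1.1 ++ t) u :=
      computable_all (g := fun (p : (Strings × ℕ) × List Strings) (u : Strings) =>
        !orb p.1.1 (u.take p.1.1.length) || p.2.any fun t => orb (p.1.1 ++ t) u) h5 h6
    exact computable_and (by fun_prop) h4
  · rintro ⟨v, k⟩
    -- The search succeeds: if `g` takes `v` to the initial part of `u`, the rest of `u` is pulled
    -- back along `g`. The conditions on `u` stand after the quantifier so that `choose` gives a
    -- function of `u` alone.
    have hu : ∀ u : Strings, ∃ t : Strings, u ∈ F (v.length + k) →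
        orb v (u.take v.length) = true → t.length = k ∧ orb (v ++ t) u = true := by
      intro u
      by_cases h : u ∈ F (v.length + k) ∧ orb v (u.take v.length) = true
      · obtain ⟨g, hg⟩ := (horb _ _).1 h.2
        obtain ⟨t, ht⟩ := exists_maps E g.symm (u.drop v.length)
        refine ⟨t, fun _ _ => ⟨?_, (horb _ _).2 ⟨g, ?_⟩⟩⟩
        · rw [← ht.length_eq]; simp [hlen _ u h.1]
        · have := hg.append ht.symm
          rwa [List.take_append_drop] at this
      · exact ⟨[], fun h1 h2 => absurd ⟨h1, h2⟩ h⟩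
    choose T hT using hu
    refine ⟨((F (v.length + k)).filter fun u => orb v (u.take v.length)).map T, ?_⟩
    simp only [Bool.and_eq_true, List.all_eq_true, List.mem_map, List.mem_filter, beq_iff_eq,
      Bool.or_eq_true, Bool.not_eq_true', List.any_eq_true]
    refine ⟨?_, fun u hu => ?_⟩
    · rintro _ ⟨u, ⟨h1, h2⟩, rfl⟩
      exact (hT u h1 h2).1
    · cases h : orb v (u.take v.length)
      · exact .inl rfl
      · exact .inr ⟨_, ⟨u, ⟨hu, h⟩, rfl⟩, (hT u hu h).2⟩

theorem exists_toolkit [L.IsRelational] [Finite (Σ n, L.Relations n)]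
    (hcat : E.EffectivelyOmegaCategorical) : Nonempty (Toolkit E) := by
  classical
  obtain ⟨⟨hcount, -⟩, ⟨q, hq, hq3⟩, f, hf1, hf2⟩ := hcat
  let sat : ℕ → Strings → Bool := fun c v => decide (q (c, v))
  have hsatc : Computable fun p : ℕ × Strings => sat p.1 p.2 := hq.decide
  have hsat : ∀ (φ : L.Formula ℕ) v, sat (E.formulaCode φ) v = true ↔ φ.Realize (E.val v) :=
    fun φ v => decide_eq_true_iff.trans (hq3 (φ, v)).symm
  let symb : List (ℕ × ℕ) := (@Finset.univ _ (Fintype.ofFinite (Σ n, L.Relations n))).toList.map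
    fun R => (Encodable.encode (E.symb R), R.1)
  have hsymb1 : ∀ R : Σ n, L.Relations n, (Encodable.encode (E.symb R), R.1) ∈ symb := fun R =>
    List.mem_map.2 ⟨R, by simp, rfl⟩
  have hsymb2 : ∀ s ∈ symb, ∃ R : Σ n, L.Relations n, s = (Encodable.encode (E.symb R), R.1) := by
    intro s hs
    obtain ⟨R, -, rfl⟩ := List.mem_map.1 hs
    exact ⟨R, rfl⟩
  obtain ⟨F, hF, h⟩ := exists_computable_separation hsatc hf1 (exists_separation hsymb1 hsat hf2)
  have spec := fun n =>
    separation_spec hsymb2 hsat hf2 (h n).1 (h n).2.1 (h n).2.2.1 (h n).2.2.2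
  obtain ⟨orb, horbc, horb⟩ := exists_computable_orb hsatc hF fun n => (spec n).2
  obtain ⟨X, hXc, hX1, hX2⟩ := exists_computable_ext horbc horb (computable_fst hF)
    (fun n => (h n).2.1) fun v => (spec _).1 v rfl
  exact ⟨⟨sat, hsatc, hsat, orb, horbc, horb, fun v k => X (v, k), hXc, fun v k => hX1 (v, k), hX2⟩⟩

end Toolkit

end AtomSets

/-! ### Computing with presentations of sets -/

namespace AtomSets

open FirstOrder Language

section Objects

/-- The code of the object that is given by an expression with code `c` and the valuation `v`. -/
def clos (c : ℕ) (v : Strings) : ℕ := 2 * Encodable.encode (c, v)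

/-- The code of the unordered pair of two objects that are given by codes. -/
def upairCode (o o' : ℕ) : ℕ := 2 * Nat.pair o o' + 1

/-- The components of the code of an expression with a valuation. -/
def unclos (o : ℕ) : ℕ × Strings := (Encodable.decode (o / 2) : Option (ℕ × Strings)).getD (0, [])

@[simp] theorem unclos_clos (c : ℕ) (v : Strings) : unclos (clos c v) = (c, v) := by
  simp only [unclos, clos, Nat.mul_div_cancel_left _ (Nat.succ_pos 1), Encodable.encodek,
    Option.getD_some]

/-- The set-builder expressions in the expression with code `c`. -/
def decodeUnion (c : ℕ) : List (ℕ × List ℕ × ℕ) :=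
  (Encodable.decode (c / 2) : Option (List (ℕ × List ℕ × ℕ))).getD []

/-- The number of variables to be considered in an update of `v` at the variables in `b`. -/
def updLength (v : Strings) (b : List ℕ) : ℕ := v.length + b.foldl (fun s i => max s (i + 1)) 0

/-- The update of `v` at the variables in `b`, with the values given by `t`. -/
def upd (v : Strings) (b : List ℕ) (t : Strings) : Strings :=
  (List.range t.length).map fun i => bif b.any (fun j => j == i) then t.getD i [] else v.getD i []

/-- The code denotes a set, not an atom. -/
def setCode (o : ℕ) : Bool := o % 2 == 1 || (unclos o).1 % 2 == 1

/-- The string for the atom denoted by a code. -/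
def atomString (o : ℕ) : List Bool := (unclos o).2.getD ((unclos o).1 / 2) []

section Computability

variable {α : Type} [Primcodable α]

@[fun_prop] theorem computable_clos {f : α → ℕ} {g : α → Strings} (hf : Computable f)
    (hg : Computable g) : Computable fun a => clos (f a) (g a) := by
  unfold clos; fun_prop

@[fun_prop] theorem computable_upairCode {f g : α → ℕ} (hf : Computable f)
    (hg : Computable g) : Computable fun a => upairCode (f a) (g a) := by
  unfold upairCode; fun_prop

@[fun_prop] theorem computable_unclos {f : α → ℕ} (hf : Computable f) :
    Computable fun a => unclos (f a) := by
  unfold unclos; fun_prop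

@[fun_prop] theorem computable_decodeUnion {f : α → ℕ} (hf : Computable f) :
    Computable fun a => decodeUnion (f a) := by
  unfold decodeUnion; fun_prop

@[fun_prop] theorem computable_updLength {f : α → Strings} {g : α → List ℕ} (hf : Computable f)
    (hg : Computable g) : Computable fun a => updLength (f a) (g a) := by
  unfold updLength; fun_prop

@[fun_prop] theorem computable_upd {f h : α → Strings} {g : α → List ℕ} (hf : Computable f)
    (hg : Computable g) (hh : Computable h) : Computable fun a => upd (f a) (g a) (h a) := by
  unfold upd; fun_prop

@[fun_prop] theorem computable_setCode {f : α → ℕ} (hf : Computable f) :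
    Computable fun a => setCode (f a) := by
  unfold setCode; fun_prop

@[fun_prop] theorem computable_atomString {f : α → ℕ} (hf : Computable f) :
    Computable fun a => atomString (f a) := by
  unfold atomString; fun_prop

end Computability

theorem lt_updLength {v : Strings} {b : List ℕ} {i : ℕ} (h : i ∈ b) : i < updLength v b := by
  have : ∀ (b : List ℕ) (s : ℕ), s ≤ b.foldl (fun s i => max s (i + 1)) s ∧
      ∀ i ∈ b, i < b.foldl (fun s i => max s (i + 1)) s := by
    intro b
    induction b with
    | nil => simp
    | cons j b ih =>
      intro s
      simp only [List.foldl_cons, List.mem_cons, forall_eq_or_imp]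
      obtain ⟨h1, h2⟩ := ih (max s (j + 1))
      exact ⟨by omega, by omega, h2⟩
  have := (this b 0).2 i h
  unfold updLength
  omega

theorem encode_le_encode_of_mem {α : Type*} [Encodable α] {a : α} {l : List α} (h : a ∈ l) :
    Encodable.encode a < Encodable.encode l := by
  induction l with
  | nil => simp at h
  | cons b l ih =>
    rw [Encodable.encode_list_cons, Nat.lt_succ_iff]
    rcases List.mem_cons.1 h with rfl | h
    · exact Nat.left_le_pair _ _
    · exact (ih h).le.trans (Nat.right_le_pair _ _)

variable {L : FirstOrder.Language.{v, w}} {A : Type u} (E : Encoding L A)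

/-- The length `updLength v b` exceeds every bound variable and is at least `v.length`, so cutting
off there loses no bound variable and no entry of `v`; later positions take the default atom on both
sides. -/
theorem val_upd {v : Strings} {b : List ℕ} {t : Strings} (ht : t.length = updLength v b) (i : ℕ) :
    E.val (upd v b t) i = if i ∈ b then E.val t i else E.val v i := by
  unfold Encoding.val
  by_cases hi : i < t.length
  · have : (upd v b t).getD i [] = if i ∈ b then t.getD i [] else v.getD i [] := by
      unfold upd
      rw [List.getD_eq_getElem _ _ (by simpa using hi)]
      simp only [List.getElem_map, List.getElem_range]
      by_cases h : i ∈ b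
      · have : b.any (fun j => j == i) = true := List.any_eq_true.2 ⟨i, h, beq_self_eq_true i⟩
        rw [this, if_pos h, cond_true]
      · have : b.any (fun j => j == i) = false := by
          rw [List.any_eq_false]
          intro j hj hji
          rw [beq_iff_eq] at hji
          exact h (hji ▸ hj)
        rw [this, if_neg h, cond_false]
    rw [this]
    split_ifs <;> rfl
  · have h1 : i ∉ b := fun h => hi (ht ▸ lt_updLength h)
    have h2 : v.length ≤ i := by unfold updLength at ht; omega
    rw [if_neg h1, List.getD_eq_default _ _ h2, List.getD_eq_default _ _ (by simp [upd]; omega)]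

variable [L.IsRelational]

/-- Makes the code of an expression usable as a rank: elements of its value are presented by
expressions with smaller codes. -/
theorem exprCode_body_lt {k : ℕ} (body : Fin k → SetExpr L) (bound : Fin k → List ℕ)
    (guard : Fin k → L.Formula ℕ) (i : Fin k) :
    E.exprCode (body i) < E.exprCode (.union k body bound guard) := by
  have h := encode_le_encode_of_mem ((List.mem_ofFn' (fun i => (E.exprCode (body i), bound i,
    E.formulaCode (guard i))) _).2 ⟨i, rfl⟩)
  have h1 := Nat.left_le_pair (E.exprCode (body i))
    (Encodable.encode (bound i, E.formulaCode (guard i)))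
  have h2 : Encodable.encode (E.exprCode (body i), bound i, E.formulaCode (guard i)) =
    Nat.pair (E.exprCode (body i)) (Encodable.encode (bound i, E.formulaCode (guard i))) := rfl
  rw [h2] at h
  simp only [Encoding.exprCode]
  omega

theorem decodeUnion_exprCode {k : ℕ} (body : Fin k → SetExpr L) (bound : Fin k → List ℕ)
    (guard : Fin k → L.Formula ℕ) :
    decodeUnion (E.exprCode (.union k body bound guard)) =
      List.ofFn fun i => (E.exprCode (body i), bound i, E.formulaCode (guard i)) := by
  unfold decodeUnion
  simp only [Encoding.exprCode]
  generalize List.ofFn (fun i => (E.exprCode (body i), bound i, E.formulaCode (guard i))) = l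
  have : (2 * Encodable.encode l + 1) / 2 = Encodable.encode l := by omega
  rw [this, Encodable.encodek]
  rfl

/-- The code `o` denotes the object `x`, the strings in `o` belong to `ctx`, and `d` bounds the
rank of `o`. -/
inductive Rep [L.Structure A] : Strings → ℕ → ℕ → ASet A → Prop
  | clos {ctx : Strings} {d : ℕ} (e : SetExpr L) {v : Strings} (hv : v ⊆ ctx)
      (hd : E.exprCode e ≤ d) : Rep ctx d (clos (E.exprCode e) v) (e.eval (E.val v))
  | upair {ctx : Strings} {d d' o o' : ℕ} {x x' : ASet A} (h : Rep ctx d o x)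
      (h' : Rep ctx d o' x') (hd : d < d') : Rep ctx d' (upairCode o o') (ASet.upair x x')

variable [L.Structure A] {E}

theorem Rep.mono {ctx ctx' : Strings} {d d' o : ℕ} {x : ASet A} (h : Rep E ctx d o x)
    (hc : ctx ⊆ ctx') (hd : d ≤ d') : Rep E ctx' d' o x := by
  induction h generalizing d' with
  | clos e hv h => exact .clos e (List.Subset.trans hv hc) (h.trans hd)
  | upair h h' hd' ih ih' => exact .upair (ih le_rfl) (ih' le_rfl) (hd'.trans_le hd)

/-- An automorphism fixing the context fixes all parameters of the code, including the default atom
used as padding. -/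
theorem Rep.map_eq {ctx : Strings} {d o : ℕ} {x : ASet A} (h : Rep E ctx d o x) (h0 : [] ∈ ctx)
    {g : A ≃[L] A} (hg : Maps E g ctx ctx) : ASet.map g x = x := by
  induction h with
  | clos e hv h => exact (eval_of_maps (hg.mono hv) (hg.fix_nil h0) e).symm
  | upair h h' hd' ih ih' => rw [ASet.map_upair, ih, ih']

namespace Toolkit

variable (K : Toolkit E)

@[fun_prop] theorem computable_sat' {α : Type} [Primcodable α] {f : α → ℕ} {g : α → Strings}
    (hf : Computable f) (hg : Computable g) : Computable fun a => K.sat (f a) (g a) :=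
  K.computable_sat.comp (hf.pair hg)

@[fun_prop] theorem computable_orb' {α : Type} [Primcodable α] {f g : α → Strings}
    (hf : Computable f) (hg : Computable g) : Computable fun a => K.orb (f a) (g a) :=
  K.computable_orb.comp (hf.pair hg)

@[fun_prop] theorem computable_ext' {α : Type} [Primcodable α] {f : α → Strings} {g : α → ℕ}
    (hf : Computable f) (hg : Computable g) : Computable fun a => K.ext (f a) (g a) :=
  K.computable_ext.comp (hf.pair hg)

/-- Representatives of the elements of the set that is given by the expression with code `c` and
the valuation `v`, up to automorphisms that fix `ctx`. -/
def closMems (ctx : Strings) (c : ℕ) (v : Strings) : List (ℕ × Strings) :=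
  bif c % 2 == 0 then [] else (decodeUnion c).flatMap fun d =>
    (((K.ext ctx (updLength v d.2.1)).map fun t => upd v d.2.1 t).filter
      fun v' => K.sat d.2.2 v').map fun v' => (d.1, v')

@[fun_prop] theorem computable_closMems {α : Type} [Primcodable α] {f h : α → Strings} {g : α → ℕ}
    (hf : Computable f) (hg : Computable g) (hh : Computable h) :
    Computable fun a => K.closMems (f a) (g a) (h a) := by
  unfold closMems; fun_prop

theorem exists_of_mem_closMems {ctx v v' : Strings} {c' : ℕ} {e : SetExpr L}
    (h : (c', v') ∈ K.closMems ctx (E.exprCode e) v) : ∃ e' : SetExpr L, c' = E.exprCode e' ∧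
      E.exprCode e' < E.exprCode e ∧ e'.eval (E.val v') ∈ e.eval (E.val v) := by
  cases e with
  | var i => simp [closMems, Encoding.exprCode] at h
  | union k body bound guard =>
    have h1 : (E.exprCode (.union k body bound guard) % 2 == 0) = false := by
      simp [Encoding.exprCode]
    unfold closMems at h
    rw [h1, cond_false, decodeUnion_exprCode] at h
    simp only [List.mem_flatMap, List.mem_ofFn, List.mem_map, List.mem_filter] at h
    obtain ⟨_, ⟨i, rfl⟩, _, ⟨⟨t, ht, rfl⟩, h2⟩, h3⟩ := h
    simp only [Prod.mk.injEq] at h3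
    obtain ⟨rfl, rfl⟩ := h3
    refine ⟨body i, rfl, exprCode_body_lt E _ _ _ _, SetExpr.mem_eval_union.2
      ⟨i, _, fun j hj => ?_, (K.sat_iff _ _).1 h2, rfl⟩⟩
    rw [val_upd E (K.length_ext _ _ _ ht), if_neg hj]

/-- An element is the value of a body under a valuation `p` that differs from `v` only at bound
variables. Some automorphism fixing `ctx` moves the relevant initial segment of `p` to one of the
listed tuples, and it maps the element to the value computed from that tuple. -/
theorem exists_mem_closMems {ctx v : Strings} (h0 : [] ∈ ctx) (hv : v ⊆ ctx) {e : SetExpr L}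
    {y : ASet A} (hy : y ∈ e.eval (E.val v)) : ∃ (e' : SetExpr L) (v' : Strings),
      (E.exprCode e', v') ∈ K.closMems ctx (E.exprCode e) v ∧ E.exprCode e' < E.exprCode e ∧
      ∃ g : A ≃[L] A, Maps E g ctx ctx ∧ e'.eval (E.val v') = ASet.map g y := by
  cases e with
  | var i => exact absurd hy (ASet.not_mem_atom _ _)
  | union k body bound guard =>
    obtain ⟨i, p, h1, h2, rfl⟩ := SetExpr.mem_eval_union.1 hy
    choose S hS using E.atom_surjective
    let s : Strings := List.ofFn fun j : Fin (updLength v (bound i)) => S (p j)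
    have hs : ∀ j < updLength v (bound i), E.val s j = p j := by
      intro j hj
      have := val_ofFn (E := E) (fun j : Fin (updLength v (bound i)) => S (p j)) ⟨j, hj⟩
      rw [hS] at this
      exact this
    obtain ⟨t, ht, g, hg, hst⟩ := K.exists_mem_ext ctx s
    have hlen : s.length = updLength v (bound i) := by simp [s]
    rw [hlen] at ht
    -- At bound variables this is the choice of `g`; at all others `p` agrees with `v`, whose atoms
    -- and padding are fixed by `g`.
    have hval : E.val (upd v (bound i) t) = g ∘ p := by
      funext j
      rw [val_upd E (K.length_ext _ _ _ ht), Function.comp_apply]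
      split_ifs with hj
      · rw [← hs j (lt_updLength hj)]
        exact ((maps_iff.1 hst).2 j (hlen ▸ lt_updLength hj)).symm
      · rw [h1 j hj]
        exact (congrFun ((hg.mono hv).val_comp (hg.fix_nil h0)) j).symm
    have h3 : (E.exprCode (.union k body bound guard) % 2 == 0) = false := by
      simp [Encoding.exprCode]
    refine ⟨body i, upd v (bound i) t, ?_, exprCode_body_lt E _ _ _ _, g, hg, ?_⟩
    · unfold closMems
      rw [h3, cond_false, decodeUnion_exprCode]
      simp only [List.mem_flatMap, List.mem_ofFn, List.mem_map, List.mem_filter]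
      refine ⟨_, ⟨i, rfl⟩, _, ⟨⟨t, ht, rfl⟩, ?_⟩, rfl⟩
      rw [K.sat_iff, hval]
      exact (StrongHomClass.realize_formula g (guard i)).2 h2
    · rw [hval, SetExpr.eval_comp_equiv]

/-- Representatives of the elements of an object, up to automorphisms that fix `ctx`. Each of them
comes with a list of strings that contains its own strings and those in `ctx`. -/
def mems (ctx : Strings) (o : ℕ) : List (Strings × ℕ) :=
  bif o % 2 == 1 then [(ctx, (o / 2).unpair.1), (ctx, (o / 2).unpair.2)]
  else (K.closMems ctx (unclos o).1 (unclos o).2).map fun q => (ctx ++ q.2, clos q.1 q.2)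

@[fun_prop] theorem computable_mems {α : Type} [Primcodable α] {f : α → Strings} {g : α → ℕ}
    (hf : Computable f) (hg : Computable g) : Computable fun a => K.mems (f a) (g a) := by
  unfold mems; fun_prop

theorem mems_clos (ctx : Strings) (c : ℕ) (v : Strings) :
    K.mems ctx (clos c v) = (K.closMems ctx c v).map fun q => (ctx ++ q.2, clos q.1 q.2) := by
  have : (clos c v % 2 == 1) = false := by simp [clos]
  rw [mems, this, cond_false, unclos_clos]

theorem mems_upairCode (ctx : Strings) (o o' : ℕ) :
    K.mems ctx (upairCode o o') = [(ctx, o), (ctx, o')] := by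
  have h1 : (upairCode o o' % 2 == 1) = true := by simp [upairCode]
  have h2 : upairCode o o' / 2 = Nat.pair o o' := by
    simp only [upairCode]; omega
  rw [mems, h1, cond_true, h2, Nat.unpair_pair]

theorem exists_of_mem_mems {ctx : Strings} {d o : ℕ} {x : ASet A} (h : Rep E ctx d o x)
    {q : Strings × ℕ} (hq : q ∈ K.mems ctx o) :
    ctx ⊆ q.1 ∧ ∃ y ∈ x, ∃ d' < d, Rep E q.1 d' q.2 y := by
  cases h with
  | clos e hv hd =>
    rw [mems_clos] at hq
    obtain ⟨⟨c', v'⟩, h1, rfl⟩ := List.mem_map.1 hq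
    obtain ⟨e', rfl, h2, h3⟩ := K.exists_of_mem_closMems h1
    exact ⟨List.subset_append_left _ _, _, h3, _, h2.trans_le hd,
      .clos e' (List.subset_append_right _ _) le_rfl⟩
  | upair h h' hd =>
    rw [mems_upairCode] at hq
    simp only [List.mem_cons, List.not_mem_nil, or_false] at hq
    rcases hq with rfl | rfl
    · exact ⟨List.Subset.refl _, _, by simp, _, hd, h⟩
    · exact ⟨List.Subset.refl _, _, by simp, _, hd, h'⟩

theorem exists_mem_mems {ctx : Strings} (h0 : [] ∈ ctx) {d o : ℕ} {x : ASet A}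
    (h : Rep E ctx d o x) {y : ASet A} (hy : y ∈ x) : ∃ q ∈ K.mems ctx o, ctx ⊆ q.1 ∧
      ∃ g : A ≃[L] A, Maps E g ctx ctx ∧ ∃ d' < d, Rep E q.1 d' q.2 (ASet.map g y) := by
  cases h with
  | clos e hv hd =>
    obtain ⟨e', v', h1, h2, g, hg, h3⟩ := K.exists_mem_closMems h0 hv hy
    rw [mems_clos]
    refine ⟨_, List.mem_map.2 ⟨_, h1, rfl⟩, List.subset_append_left _ _, g, hg, _, h2.trans_le hd, ?_⟩
    rw [← h3]
    exact .clos e' (List.subset_append_right _ _) le_rfl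
  | upair h h' hd =>
    have hid : Maps E (Language.Equiv.refl L A) ctx ctx := rfl
    have hid' : ∀ z : ASet A, ASet.map (Language.Equiv.refl L A) z = z := ASet.map_id
    rw [mems_upairCode]
    rcases ASet.mem_upair.1 hy with rfl | rfl
    · exact ⟨_, List.mem_cons_self, List.Subset.refl _, _, hid, _, hd, by rwa [hid']⟩
    · exact ⟨_, List.mem_cons_of_mem _ List.mem_cons_self, List.Subset.refl _, _, hid, _, hd,
        by rwa [hid']⟩

/-- The reduction of quantifiers to finite checks. Each element is moved to a listed representative
by an automorphism fixing `ctx`, and `P` does not notice. The test `Q` has to be correct only on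
codes of smaller rank in a larger context, which is what an induction on rank supplies. -/
theorem forall_mems_iff {ctx : Strings} (h0 : [] ∈ ctx) {d o : ℕ} {x : ASet A}
    (h : Rep E ctx d o x) {P : ASet A → Prop} {Q : Strings × ℕ → Prop}
    (hP : ∀ g : A ≃[L] A, Maps E g ctx ctx → ∀ y, P (ASet.map g y) ↔ P y)
    (hQ : ∀ q d' y, ctx ⊆ q.1 → d' < d → Rep E q.1 d' q.2 y → (Q q ↔ P y)) :
    (∀ q ∈ K.mems ctx o, Q q) ↔ ∀ y ∈ x, P y := by
  constructor
  · intro H y hy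
    obtain ⟨q, hq, hc, g, hg, d', hd, hr⟩ := K.exists_mem_mems h0 h hy
    exact (hP g hg y).1 ((hQ q d' _ hc hd hr).1 (H q hq))
  · intro H q hq
    obtain ⟨hc, y, hy, d', hd, hr⟩ := K.exists_of_mem_mems h hq
    exact (hQ q d' y hc hd hr).2 (H y hy)

theorem exists_mems_iff {ctx : Strings} (h0 : [] ∈ ctx) {d o : ℕ} {x : ASet A}
    (h : Rep E ctx d o x) {P : ASet A → Prop} {Q : Strings × ℕ → Prop}
    (hP : ∀ g : A ≃[L] A, Maps E g ctx ctx → ∀ y, P (ASet.map g y) ↔ P y)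
    (hQ : ∀ q d' y, ctx ⊆ q.1 → d' < d → Rep E q.1 d' q.2 y → (Q q ↔ P y)) :
    (∃ q ∈ K.mems ctx o, Q q) ↔ ∃ y ∈ x, P y := by
  have := K.forall_mems_iff h0 h (P := fun y => ¬ P y) (Q := fun q => ¬ Q q)
    (fun g hg y => not_congr (hP g hg y)) fun q d' y h1 h2 h3 => not_congr (hQ q d' y h1 h2 h3)
  simpa using not_congr this

omit [L.Structure A] in
theorem setCode_upairCode (o o' : ℕ) : setCode (upairCode o o') = true := by
  have h1 : (upairCode o o' % 2 == 1) = true := by simp [upairCode]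
  rw [setCode, h1, Bool.true_or]

theorem setCode_iff {ctx : Strings} {d o : ℕ} {x : ASet A} (h : Rep E ctx d o x) :
    setCode o = true ↔ x.IsSet := by
  cases h with
  | clos e hv hd =>
    have : (clos (E.exprCode e) ‹Strings› % 2 == 1) = false := by simp [clos]
    rw [setCode, this, Bool.false_or, unclos_clos]
    cases e with
    | var i =>
      refine iff_of_false (by simp [Encoding.exprCode]) (ASet.not_isSet_atom _)
    | union k body bound guard =>
      refine iff_of_true ?_ (SetExpr.isSet_eval_union _ _ _ _)
      simp [Encoding.exprCode]
  | upair h h' hd => exact iff_of_true (setCode_upairCode _ _) (ASet.isSet_upair _ _)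

theorem eq_atom_of_not_setCode {ctx : Strings} {d o : ℕ} {x : ASet A} (h : Rep E ctx d o x)
    (hs : setCode o = false) : x = ASet.atom (E.atom (atomString o)) := by
  cases h with
  | clos e hv hd =>
    cases e with
    | var i =>
      simp [atomString, SetExpr.eval, Encoding.exprCode, Encoding.val]
    | union k body bound guard =>
      exfalso
      have := (setCode_iff (.clos _ hv hd)).2 (SetExpr.isSet_eval_union body bound guard _)
      rw [hs] at this
      cases this
  | upair h h' hd => simp [setCode_upairCode] at hs

/-- Equality of the atoms denoted by two strings. -/
def atomEq (s t : List Bool) : Bool :=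
  K.sat (E.formulaCode (Term.equal (L := L) (Term.var 0) (Term.var 1))) [s, t]

@[fun_prop] theorem computable_atomEq {α : Type} [Primcodable α] {f g : α → List Bool}
    (hf : Computable f) (hg : Computable g) : Computable fun a => K.atomEq (f a) (g a) := by
  unfold atomEq; fun_prop

theorem atomEq_iff (s t : List Bool) : K.atomEq s t = true ↔ E.atom s = E.atom t := by
  rw [atomEq, K.sat_iff]
  simp [Encoding.val]

/-- The recursive calls for `isEqOrMem`. -/
def eqCalls (p : Bool × Strings × ℕ × ℕ) : List (Bool × Strings × ℕ × ℕ) :=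
  bif p.1 then (K.mems p.2.1 p.2.2.2).map fun q => (false, q.1, p.2.2.1, q.2)
  else ((K.mems p.2.1 p.2.2.1).map fun q => (true, q.1, q.2, p.2.2.2)) ++
    (K.mems p.2.1 p.2.2.2).map fun q => (true, q.1, q.2, p.2.2.1)

/-- The value of `isEqOrMem`, from the values of the recursive calls. -/
def eqComb (p : Bool × Strings × ℕ × ℕ) (r : List Bool) : Bool :=
  bif p.1 then r.any id
  else bif setCode p.2.2.1 && setCode p.2.2.2 then r.all id
  else bif setCode p.2.2.1 || setCode p.2.2.2 then false
  else K.atomEq (atomString p.2.2.1) (atomString p.2.2.2)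

/-- For `p = (b, ctx, o, o')`, the objects `o` and `o'` are equal (if `b` is false), or `o` is an
element of `o'` (if `b` is true). The first argument bounds the rank of the objects. -/
def isEqOrMem : ℕ → Bool × Strings × ℕ × ℕ → Bool := fuelRec K.eqCalls K.eqComb false

theorem computable_eqCalls : Computable K.eqCalls := by
  unfold eqCalls; fun_prop

theorem computable_eqComb :
    Computable fun p : (Bool × Strings × ℕ × ℕ) × List Bool => K.eqComb p.1 p.2 := by
  unfold eqComb; fun_prop

theorem computable_isEqOrMem :
    Computable fun p : ℕ × Bool × Strings × ℕ × ℕ => K.isEqOrMem p.1 p.2 :=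
  computable_fuelRec _ K.computable_eqCalls K.computable_eqComb

/-- Membership reduces to equality with some element of the second object, and equality of sets
reduces to two inclusions, that is, to membership. Every call replaces one object by an element, so
the sum of the ranks drops and bounds the depth. -/
theorem isEqOrMem_iff {n : ℕ} {ctx : Strings} (h0 : [] ∈ ctx) {d d' o o' : ℕ} {x x' : ASet A}
    (h : Rep E ctx d o x) (h' : Rep E ctx d' o' x') (hn : d + d' < n) :
    (K.isEqOrMem n (true, ctx, o, o') = true ↔ x ∈ x') ∧
    (K.isEqOrMem n (false, ctx, o, o') = true ↔ x = x') := by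
  induction n generalizing ctx d d' o o' x x' with
  | zero => omega
  | succ n ih =>
    -- Stated for arbitrary objects so that it yields both inclusions. The tested property is
    -- invariant since `x'` itself is fixed by the automorphisms that fix the context.
    have hsub : ∀ {ctx : Strings} (_ : [] ∈ ctx) {d d' o o' : ℕ} {x x' : ASet A}
        (_ : Rep E ctx d o x) (_ : Rep E ctx d' o' x') (_ : d + d' < n + 1),
        (∀ q ∈ K.mems ctx o, K.isEqOrMem n (true, q.1, q.2, o') = true) ↔ ∀ y ∈ x, y ∈ x' := by
      intro ctx h0 d d' o o' x x' h h' hn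
      refine K.forall_mems_iff h0 h (fun g hg y => ?_) fun q d'' y hc hd hr =>
        (ih (hc h0) hr (h'.mono hc le_rfl) (by omega)).1
      conv_lhs => rw [← h'.map_eq h0 hg]
      exact ASet.map_mem_map_iff g
    constructor
    · have : K.isEqOrMem (n + 1) (true, ctx, o, o') = true ↔
          ∃ q ∈ K.mems ctx o', K.isEqOrMem n (false, q.1, o, q.2) = true := by
        simp [isEqOrMem, fuelRec, eqCalls, eqComb]
      rw [this, K.exists_mems_iff h0 h' (P := fun y => x = y) (fun g hg y => ?_) fun q d'' y hc hd hr =>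
        (ih (hc h0) (h.mono hc le_rfl) hr (by omega)).2]
      · simp
      · conv_lhs => rw [← h.map_eq h0 hg]
        exact (ASet.map_equiv_injective g).eq_iff
    · have e : K.isEqOrMem (n + 1) (false, ctx, o, o') = K.eqComb (false, ctx, o, o')
        ((K.eqCalls (false, ctx, o, o')).map (K.isEqOrMem n)) := rfl
      rw [e]
      have s1 := setCode_iff h
      have s2 := setCode_iff h'
      cases hs : setCode o <;> cases hs' : setCode o'
      · simp only [eqComb, hs, hs', cond_false, Bool.and_self, Bool.or_self]
        rw [atomEq_iff, eq_atom_of_not_setCode h hs, eq_atom_of_not_setCode h' hs']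
        exact ASet.atom_injective.eq_iff.symm
      · simp only [hs, hs', eqComb] at s1 s2 ⊢
        refine iff_of_false (by simp) ?_
        rintro rfl
        simp_all
      · simp only [hs, hs', eqComb] at s1 s2 ⊢
        refine iff_of_false (by simp) ?_
        rintro rfl
        simp_all
      · have s1' := s1.1 hs
        have s2' := s2.1 hs'
        simp only [eqComb, hs, hs', eqCalls, cond_false, cond_true, Bool.and_self, List.map_append,
          List.all_append, List.map_map, List.all_map, Bool.and_eq_true, List.all_eq_true,
          Function.comp_apply, id]
        rw [hsub h0 h h' hn, hsub h0 h' h (by omega)]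
        refine ⟨fun H => s1'.ext s2' fun z => ⟨H.1 z, H.2 z⟩, ?_⟩
        rintro rfl
        exact ⟨fun _ => id, fun _ => id⟩

end Toolkit

end Objects

end AtomSets

/-! ### Tuples and invariant relations -/

namespace AtomSets

open FirstOrder Language

section Tuples

variable {L : FirstOrder.Language.{v, w}} {A : Type u} {E : Encoding L A}

/-- The code of the pair of two objects that are given by codes. -/
def pairCode (o o' : ℕ) : ℕ := upairCode (upairCode o o') (upairCode o o)

@[fun_prop] theorem computable_pairCode {α : Type} [Primcodable α] {f g : α → ℕ}
    (hf : Computable f) (hg : Computable g) : Computable fun a => pairCode (f a) (g a) := by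
  unfold pairCode; fun_prop

variable [L.IsRelational] [L.Structure A]

theorem Rep.pair {ctx : Strings} {d o o' : ℕ} {x x' : ASet A} (h : Rep E ctx d o x)
    (h' : Rep E ctx d o' x') : Rep E ctx (d + 2) (pairCode o o') (ASet.pair x x') :=
  .upair (d := d + 1) (.upair h h' (Nat.lt_succ_self _)) (.upair h h (Nat.lt_succ_self _))
    (Nat.lt_succ_self _)

/-- A Kuratowski pair is two nested unordered pairs, so every further component raises the rank by
2. The rank of the accumulator has to vary in the induction. -/
theorem Rep.foldl_pair {ctx : Strings} {d o : ℕ} {x : ASet A} (h : Rep E ctx d o x)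
    {os : List ℕ} {xs : List (ASet A)} (hs : List.Forall₂ (Rep E ctx d) os xs) :
    Rep E ctx (d + 2 * os.length) (os.foldl pairCode o) (xs.foldl ASet.pair x) := by
  suffices H : ∀ {d'} {o x}, d ≤ d' → Rep E ctx d' o x →
      Rep E ctx (d' + 2 * os.length) (os.foldl pairCode o) (xs.foldl ASet.pair x) from H le_rfl h
  clear h
  induction hs with
  | nil => intro d' o x _ h; simpa using h
  | cons h' hs ih =>
    intro d' o x hd h
    have := ih (by omega) (h.pair (h'.mono (List.Subset.refl _) hd))
    rw [List.length_cons]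
    exact this.mono (List.Subset.refl _) (by omega)

theorem Rep.forall₂_mono {ctx ctx' : Strings} {d d' : ℕ} {os : List ℕ} {xs : List (ASet A)}
    (h : List.Forall₂ (Rep E ctx d) os xs) (hc : ctx ⊆ ctx') (hd : d ≤ d') :
    List.Forall₂ (Rep E ctx' d') os xs :=
  h.imp fun _ _ h => h.mono hc hd

theorem Rep.forall₂_map_eq {ctx : Strings} {d : ℕ} {os : List ℕ} {xs : List (ASet A)}
    (h : List.Forall₂ (Rep E ctx d) os xs) (h0 : [] ∈ ctx) {g : A ≃[L] A} (hg : Maps E g ctx ctx) :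
    xs.map (ASet.map g) = xs := by
  induction h with
  | nil => rfl
  | cons h hs ih => rw [List.map_cons, ih, h.map_eq h0 hg]

namespace Toolkit

variable (K : Toolkit E)

/-- Representatives of the lists that consist of one element of each of the given objects. -/
def seqs (ctx : Strings) (os : List ℕ) : List (Strings × List ℕ) :=
  os.reverse.foldl (fun r o => r.flatMap fun p => (K.mems p.1 o).map fun q => (q.1, q.2 :: p.2))
    [(ctx, [])]

@[fun_prop] theorem computable_seqs {α : Type} [Primcodable α] {f : α → Strings} {g : α → List ℕ}
    (hf : Computable f) (hg : Computable g) : Computable fun a => K.seqs (f a) (g a) := by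
  unfold seqs; fun_prop

/-- The tail is chosen first, and the head is then chosen relative to the context enlarged by the
tail; the induction in `forall_seqs_iff` follows this order. -/
theorem seqs_cons (ctx : Strings) (o : ℕ) (os : List ℕ) : K.seqs ctx (o :: os) =
    (K.seqs ctx os).flatMap fun p => (K.mems p.1 o).map fun q => (q.1, q.2 :: p.2) := by
  simp [seqs]

theorem forall_seqs_iff {ctx : Strings} (h0 : [] ∈ ctx) {d : ℕ} {os : List ℕ} {xs : List (ASet A)}
    (h : List.Forall₂ (Rep E ctx d) os xs) {P : List (ASet A) → Prop}
    {Q : Strings × List ℕ → Prop}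
    (hP : ∀ g : A ≃[L] A, Maps E g ctx ctx → ∀ ys, P (ys.map (ASet.map g)) ↔ P ys)
    (hQ : ∀ q ys, ctx ⊆ q.1 → q.2.length = os.length → List.Forall₂ (Rep E q.1 d) q.2 ys →
      (Q q ↔ P ys)) :
    (∀ q ∈ K.seqs ctx os, Q q) ↔ ∀ ys, List.Forall₂ (· ∈ ·) ys xs → P ys := by
  induction h generalizing P Q with
  | nil =>
    have : K.seqs ctx [] = [(ctx, [])] := rfl
    simp only [this, List.mem_singleton, forall_eq, List.forall₂_nil_right_iff]
    exact hQ _ _ (List.Subset.refl _) rfl .nil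
  | @cons o x os xs h hs ih =>
    have e : (∀ q ∈ K.seqs ctx (o :: os), Q q) ↔
        ∀ p ∈ K.seqs ctx os, ∀ q ∈ K.mems p.1 o, Q (q.1, q.2 :: p.2) := by
      rw [seqs_cons]
      simp only [List.mem_flatMap, List.mem_map]
      constructor
      · intro H p hp q hq
        exact H _ ⟨p, hp, q, hq, rfl⟩
      · rintro H _ ⟨p, hp, q, hq, rfl⟩
        exact H p hp q hq
    -- The quantifier over the head becomes part of the property of the tail. That property is still
    -- invariant, because automorphisms fixing the context permute the elements of `x`.
    rw [e, ih (P := fun ys => ∀ y ∈ x, P (y :: ys))]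
    · constructor
      · intro H ys hys
        obtain ⟨y, ys', hy, hys', rfl⟩ := List.forall₂_cons_right_iff.1 hys
        exact H ys' hys' y hy
      · intro H ys hys y hy
        exact H _ (.cons hy hys)
    · intro g hg ys
      constructor
      · intro H y hy
        have := H (ASet.map g y) (by rw [← h.map_eq h0 hg]; exact ASet.mem_map hy)
        exact (hP g hg (y :: ys)).1 this
      · intro H y hy
        have := H (ASet.map g.symm y) (by rw [← h.map_eq h0 hg.symm]; exact ASet.mem_map hy)
        have := (hP g hg _).2 this
        rwa [List.map_cons, ASet.map_map_symm] at this
    · intro p ys hc hl hr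
      refine K.forall_mems_iff (hc h0) (h.mono hc le_rfl) (fun g hg y => ?_) fun q d' y hc' hd' hr' => ?_
      · rw [← hP g (hg.mono hc) (y :: ys), List.map_cons, Rep.forall₂_map_eq hr (hc h0) hg]
      · exact hQ _ _ (List.Subset.trans hc hc') (by simp [hl])
          (.cons (hr'.mono (List.Subset.refl _) hd'.le) (Rep.forall₂_mono hr hc' le_rfl))

theorem exists_seqs_iff {ctx : Strings} (h0 : [] ∈ ctx) {d : ℕ} {os : List ℕ} {xs : List (ASet A)}
    (h : List.Forall₂ (Rep E ctx d) os xs) {P : List (ASet A) → Prop}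
    {Q : Strings × List ℕ → Prop}
    (hP : ∀ g : A ≃[L] A, Maps E g ctx ctx → ∀ ys, P (ys.map (ASet.map g)) ↔ P ys)
    (hQ : ∀ q ys, ctx ⊆ q.1 → q.2.length = os.length → List.Forall₂ (Rep E q.1 d) q.2 ys →
      (Q q ↔ P ys)) :
    (∃ q ∈ K.seqs ctx os, Q q) ↔ ∃ ys, List.Forall₂ (· ∈ ·) ys xs ∧ P ys := by
  have := K.forall_seqs_iff h0 h (P := fun ys => ¬ P ys) (Q := fun q => ¬ Q q)
    (fun g hg ys => not_congr (hP g hg ys)) fun q ys h1 h2 h3 => not_congr (hQ q ys h1 h2 h3)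
  simpa using not_congr this

end Toolkit

/-- Pairs of closures: a finite presentation of a relation. -/
abbrev ClosPairs : Type := List ((ℕ × Strings) × (ℕ × Strings))

variable (E) in
/-- The least relation that contains the given pairs and is invariant under the automorphisms that
fix `ctx`. -/
def Grel (ctx : Strings) (R : ClosPairs) (x y : ASet A) : Prop :=
  ∃ r ∈ R, ∃ e₁ e₂ : SetExpr L, E.exprCode e₁ = r.1.1 ∧ E.exprCode e₂ = r.2.1 ∧
    ∃ g : A ≃[L] A, Maps E g ctx ctx ∧ x = ASet.map g (e₁.eval (E.val r.1.2)) ∧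
      y = ASet.map g (e₂.eval (E.val r.2.2))

theorem Grel.map {ctx : Strings} {R : ClosPairs} {x y : ASet A} (H : Grel E ctx R x y)
    {g : A ≃[L] A} (hg : Maps E g ctx ctx) : Grel E ctx R (ASet.map g x) (ASet.map g y) := by
  obtain ⟨r, hr, e₁, e₂, h1, h2, h, hh, rfl, rfl⟩ := H
  refine ⟨r, hr, e₁, e₂, h1, h2, g.comp h, hh.comp hg, ?_, ?_⟩ <;> rw [ASet.map_comp_equiv]

theorem grel_map_iff {ctx : Strings} {R : ClosPairs} {x y : ASet A} {g : A ≃[L] A}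
    (hg : Maps E g ctx ctx) : Grel E ctx R (ASet.map g x) (ASet.map g y) ↔ Grel E ctx R x y := by
  refine ⟨fun H => ?_, fun H => H.map hg⟩
  have := H.map hg.symm
  rwa [ASet.map_symm_map, ASet.map_symm_map] at this

namespace Toolkit

variable (K : Toolkit E)

/-- Membership of a pair of objects in the relation `Grel E ctx₀ R`. -/
def inG (F : ℕ) (ctx₀ : Strings) (R : ClosPairs) (ctx : Strings) (o o' : ℕ) : Bool :=
  R.any fun r => (K.ext ctx r.1.2.length).any fun w₁ => (K.ext (ctx ++ w₁) r.2.2.length).any fun w₂ =>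
    K.orb (ctx₀ ++ (r.1.2 ++ r.2.2)) (ctx₀ ++ (w₁ ++ w₂)) &&
      (K.isEqOrMem F (false, ctx ++ (w₁ ++ w₂), clos r.1.1 w₁, o) &&
        K.isEqOrMem F (false, ctx ++ (w₁ ++ w₂), clos r.2.1 w₂, o'))

@[fun_prop] theorem computable_isEqOrMem' {α : Type} [Primcodable α] {f : α → ℕ}
    {g : α → Bool × Strings × ℕ × ℕ} (hf : Computable f) (hg : Computable g) :
    Computable fun a => K.isEqOrMem (f a) (g a) := K.computable_isEqOrMem.comp (hf.pair hg)

theorem computable_inG : Computable fun p : ℕ × Strings × ClosPairs × Strings × ℕ × ℕ =>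
    K.inG p.1 p.2.1 p.2.2.1 p.2.2.2.1 p.2.2.2.2.1 p.2.2.2.2.2 := by
  unfold inG
  fun_prop

@[fun_prop] theorem computable_inG' {α : Type} [Primcodable α] {f₁ f₅ f₆ : α → ℕ}
    {f₂ f₄ : α → Strings} {f₃ : α → ClosPairs} (h₁ : Computable f₁) (h₂ : Computable f₂)
    (h₃ : Computable f₃) (h₄ : Computable f₄) (h₅ : Computable f₅) (h₆ : Computable f₆) :
    Computable fun a => K.inG (f₁ a) (f₂ a) (f₃ a) (f₄ a) (f₅ a) (f₆ a) :=
  K.computable_inG.comp (h₁.pair (h₂.pair (h₃.pair (h₄.pair (h₅.pair h₆)))))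

/-- A pair is in the relation iff it is given by the two expressions of some entry of `R`, under
valuations `w₁`, `w₂` that are jointly in the orbit of the entry's own valuations over `ctx₀`. Since
`x` and `y` are fixed by automorphisms fixing `ctx`, it suffices to try `w₁` up to such
automorphisms, and then `w₂` up to those that also fix `w₁`. -/
theorem inG_iff {F : ℕ} {ctx₀ ctx : Strings} (h0 : [] ∈ ctx₀) (hc : ctx₀ ⊆ ctx) {R : ClosPairs}
    {d : ℕ} (hR : ∀ r ∈ R, ∃ e₁ e₂ : SetExpr L, r.1.1 = E.exprCode e₁ ∧ r.2.1 = E.exprCode e₂ ∧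
      E.exprCode e₁ ≤ d ∧ E.exprCode e₂ ≤ d) (hF : 2 * d < F) {o o' : ℕ} {x y : ASet A}
    (hx : Rep E ctx d o x) (hy : Rep E ctx d o' y) :
    K.inG F ctx₀ R ctx o o' = true ↔ Grel E ctx₀ R x y := by
  have key : ∀ (e : SetExpr L) {w₁ w₂ w : Strings} {o : ℕ} {x : ASet A}, w ⊆ w₁ ++ w₂ →
      E.exprCode e ≤ d → Rep E ctx d o x → (K.isEqOrMem F (false, ctx ++ (w₁ ++ w₂),
        clos (E.exprCode e) w, o) = true ↔ e.eval (E.val w) = x) := by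
    intro e w₁ w₂ w o x hw he hx
    exact (K.isEqOrMem_iff (List.mem_append_left _ (hc h0))
      (.clos e (List.Subset.trans hw (List.subset_append_right _ _)) he)
      (hx.mono (List.subset_append_left _ _) le_rfl) (by omega)).2
  simp only [inG, List.any_eq_true, Bool.and_eq_true, orb_iff]
  constructor
  · rintro ⟨r, hr, w₁, hw₁, w₂, hw₂, ⟨g, hg⟩, h1, h2⟩
    obtain ⟨e₁, e₂, he₁, he₂, hd₁, hd₂⟩ := hR r hr
    rw [he₁, key e₁ (List.subset_append_left _ _) hd₁ hx] at h1
    rw [he₂, key e₂ (List.subset_append_right _ _) hd₂ hy] at h2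
    obtain ⟨hg0, hg⟩ := hg.of_append rfl
    obtain ⟨hg1, hg2⟩ := hg.of_append (K.length_ext _ _ _ hw₁).symm
    refine ⟨r, hr, e₁, e₂, he₁.symm, he₂.symm, g, hg0, ?_, ?_⟩
    · rw [← h1, eval_of_maps hg1 (hg0.fix_nil h0)]
    · rw [← h2, eval_of_maps hg2 (hg0.fix_nil h0)]
  · rintro ⟨r, hr, e₁, e₂, he₁, he₂, g, hg, rfl, rfl⟩
    obtain ⟨e₁', e₂', he₁', he₂', hd₁, hd₂⟩ := hR r hr
    rw [← he₁', ← he₁] at hd₁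
    rw [← he₂', ← he₂] at hd₂
    -- The image of the first valuation under `g` is corrected to a listed tuple by `k`; then the
    -- image of the second under `k.comp g` is corrected by `k'`, which fixes `w₁` and so preserves
    -- the first correction.
    obtain ⟨s₁, hs₁⟩ := exists_maps E g r.1.2
    obtain ⟨w₁, hw₁, k, hk, hk₁⟩ := K.exists_mem_ext ctx s₁
    obtain ⟨s₂, hs₂⟩ := exists_maps E (k.comp g) r.2.2
    obtain ⟨w₂, hw₂, k', hk', hk₂⟩ := K.exists_mem_ext (ctx ++ w₁) s₂
    rw [← hs₁.length_eq] at hw₁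
    rw [← hs₂.length_eq] at hw₂
    have hf : Maps E (k'.comp (k.comp g)) ctx₀ ctx₀ :=
      (hg.comp (hk.mono hc)).comp (hk'.mono (List.Subset.trans hc (List.subset_append_left _ _)))
    have hf₁ : Maps E (k'.comp (k.comp g)) r.1.2 w₁ :=
      (hs₁.comp hk₁).comp (hk'.mono (List.subset_append_right _ _))
    have hf₂ : Maps E (k'.comp (k.comp g)) r.2.2 w₂ := hs₂.comp hk₂
    have hfix : Maps E (k'.comp k) ctx ctx := hk.comp (hk'.mono (List.subset_append_left _ _))
    refine ⟨r, hr, w₁, hw₁, w₂, hw₂, ⟨_, hf.append (hf₁.append hf₂)⟩, ?_, ?_⟩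
    · rw [← he₁, key e₁ (List.subset_append_left _ _) hd₁ hx, eval_of_maps hf₁ (hf.fix_nil h0)]
      rw [← hx.map_eq (hc h0) hfix, ← ASet.map_comp_equiv]
      rfl
    · rw [← he₂, key e₂ (List.subset_append_right _ _) hd₂ hy, eval_of_maps hf₂ (hf.fix_nil h0)]
      rw [← hy.map_eq (hc h0) hfix, ← ASet.map_comp_equiv]
      rfl

end Toolkit

end Tuples

end AtomSets

/-! ### Checking signatures, structures and isomorphisms -/

namespace AtomSets

open FirstOrder Language

section Checks

variable {L : FirstOrder.Language.{v, w}} {A : Type u} {E : Encoding L A}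

/-- The default is the empty set, which the action on atoms leaves unchanged; thus reading a list
with a default value commutes with the action. -/
noncomputable instance : Inhabited (ASet A) := ⟨ASet.ofFamily PEmpty fun x => x.elim⟩

@[simp] theorem ASet.map_default (g : A → A) : ASet.map g (default : ASet A) = default := by
  refine (ASet.map_ofFamily _ _ _).trans ?_
  exact congrArg _ (funext fun x => x.elim)

theorem getD_map_default (g : A → A) (ys : List (ASet A)) (n : ℕ) :
    (ys.map (ASet.map g)).getD n default = ASet.map g (ys.getD n default) := by
  conv_lhs => rw [← ASet.map_default g]
  exact List.getD_map _ _ _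

theorem forall₂_mem_replicate {ys : List (ASet A)} {n : ℕ} {x : ASet A} :
    List.Forall₂ (· ∈ ·) ys (List.replicate n x) ↔ ys.length = n ∧ ∀ y ∈ ys, y ∈ x := by
  induction n generalizing ys with
  | zero => cases ys <;> simp
  | succ n ih =>
    cases ys with
    | nil => simp
    | cons y ys => simp [List.replicate_succ, ih]; tauto

variable [L.Structure A]

/-- The automorphisms fixing `ctx` are closed under inverses, so one implication is enough for
invariance. -/
theorem map_iff_of_imp {ctx : Strings} {P : ASet A → Prop}
    (h : ∀ g : A ≃[L] A, Maps E g ctx ctx → ∀ y, P y → P (ASet.map g y)) :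
    ∀ g : A ≃[L] A, Maps E g ctx ctx → ∀ y, P (ASet.map g y) ↔ P y := by
  refine fun g hg y => ⟨fun H => ?_, h g hg y⟩
  have := h _ hg.symm _ H
  rwa [ASet.map_symm_map] at this

variable {l : ℕ}

/-- The relation `G`, restricted to the universes of the structures, is an isomorphism. -/
def IsoRel (G : ASet A → ASet A → Prop) (Sg : Signature A l) (M N : RelStructure A l) : Prop :=
  (∀ x ∈ M.univ, ∃ y ∈ N.univ, G x y) ∧ (∀ y ∈ N.univ, ∃ x ∈ M.univ, G x y) ∧
  (∀ x ∈ M.univ, ∀ x' ∈ M.univ, ∀ y ∈ N.univ, ∀ y' ∈ N.univ, G x y → G x' y' →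
    (x = x' ↔ y = y')) ∧
  ∀ i : Fin l, ∀ σ ∈ Sg.sym i, ∀ a b : Fin (i + 1) → ASet A, (∀ j, a j ∈ M.univ) →
    (∀ j, b j ∈ N.univ) → (∀ j, G (a j) (b j)) →
    (ASet.tuple σ a ∈ M.interp i ↔ ASet.tuple σ b ∈ N.interp i)

variable [L.IsRelational]

theorem Rep.getD {ctx : Strings} {d : ℕ} {os : List ℕ} {ys : List (ASet A)}
    (h : List.Forall₂ (Rep E ctx d) os ys) {n : ℕ} (hn : n < os.length) :
    Rep E ctx d (os.getD n 0) (ys.getD n default) := by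
  have hn' : n < ys.length := h.length_eq ▸ hn
  rw [List.getD_eq_getElem _ _ hn, List.getD_eq_getElem _ _ hn']
  exact (List.forall₂_iff_get.1 h).2 n hn hn'

namespace Toolkit

variable (K : Toolkit E)

/-- The objects given by the list are the sets of symbols of a signature. -/
def sigCheck (F : ℕ) (ctx : Strings) (sg : List ℕ) : Bool :=
  (List.range sg.length).all fun i => setCode (sg.getD i 0) && (List.range sg.length).all fun j =>
    i == j || (K.mems ctx (sg.getD i 0)).all fun q =>
      !K.isEqOrMem F (true, q.1, q.2, sg.getD j 0)

/-- The object `u` and the objects in the list `I` form a structure over the signature `sg`. -/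
def strCheck (F : ℕ) (ctx : Strings) (sg : List ℕ) (u : ℕ) (I : List ℕ) : Bool :=
  setCode u && (List.range sg.length).all fun i => setCode (I.getD i 0) &&
    (K.mems ctx (I.getD i 0)).all fun t =>
      (K.seqs t.1 (sg.getD i 0 :: List.replicate (i + 1) u)).any fun a =>
        K.isEqOrMem F (false, a.1, t.2, (a.2.drop 1).foldl pairCode (a.2.getD 0 0))

/-- The relation given by `R` is total on the object `u` if `b` is true, and surjective onto it
if `b` is false. -/
def totalCheck (F : ℕ) (ctx : Strings) (R : ClosPairs) (b : Bool) (u u' : ℕ) : Bool :=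
  (K.mems ctx u).all fun x => (K.mems x.1 u').any fun y =>
    bif b then K.inG F ctx R y.1 x.2 y.2 else K.inG F ctx R y.1 y.2 x.2

/-- The relation given by `R` is functional and injective between the objects `u₁` and `u₂`. -/
def injCheck (F : ℕ) (ctx : Strings) (R : ClosPairs) (u₁ u₂ : ℕ) : Bool :=
  (K.seqs ctx [u₁, u₁, u₂, u₂]).all fun q =>
    !(K.inG F ctx R q.1 (q.2.getD 0 0) (q.2.getD 2 0) &&
      K.inG F ctx R q.1 (q.2.getD 1 0) (q.2.getD 3 0)) ||
    !(K.isEqOrMem F (false, q.1, q.2.getD 0 0, q.2.getD 1 0) ^^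
      K.isEqOrMem F (false, q.1, q.2.getD 2 0, q.2.getD 3 0))

/-- The relation given by `R` preserves and reflects the relations in `I₁` and `I₂` for the
symbols of arity `i + 1`. -/
def relCheck (F : ℕ) (ctx : Strings) (R : ClosPairs) (i s u₁ u₂ I₁ I₂ : ℕ) : Bool :=
  (K.seqs ctx (s :: (List.replicate (i + 1) u₁ ++ List.replicate (i + 1) u₂))).all fun q =>
    !((List.range (i + 1)).all fun j =>
      K.inG F ctx R q.1 (q.2.getD (1 + j) 0) (q.2.getD (1 + (i + 1) + j) 0)) ||
    !(K.isEqOrMem F (true, q.1, ((q.2.drop 1).take (i + 1)).foldl pairCode (q.2.getD 0 0), I₁) ^^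
      K.isEqOrMem F (true, q.1, (q.2.drop (1 + (i + 1))).foldl pairCode (q.2.getD 0 0), I₂))

/-- The relation given by `R` is an isomorphism. -/
def isoCheck (F : ℕ) (ctx : Strings) (sg : List ℕ) (M N : ℕ × List ℕ) (R : ClosPairs) : Bool :=
  K.totalCheck F ctx R true M.1 N.1 && (K.totalCheck F ctx R false N.1 M.1 &&
    (K.injCheck F ctx R M.1 N.1 && (List.range sg.length).all fun i =>
      K.relCheck F ctx R i (sg.getD i 0) M.1 N.1 (M.2.getD i 0) (N.2.getD i 0)))

/-- Representatives of the pairs of elements of two sets, up to automorphisms that fix `ctx`. -/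
def cands (ctx : Strings) (u₁ u₂ : ℕ) (p : Strings) : ClosPairs :=
  (K.closMems ctx u₁ p).flatMap fun b => (K.closMems (ctx ++ b.2) u₂ p).map fun c => (b, c)

section Computability

variable {α : Type} [Primcodable α]

@[fun_prop] theorem computable_sigCheck {f : α → ℕ} {g : α → Strings} {h : α → List ℕ}
    (hf : Computable f) (hg : Computable g) (hh : Computable h) :
    Computable fun a => K.sigCheck (f a) (g a) (h a) := by
  unfold sigCheck
  fun_prop

@[fun_prop] theorem computable_strCheck {f k : α → ℕ} {g : α → Strings} {h m : α → List ℕ}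
    (hf : Computable f) (hg : Computable g) (hh : Computable h) (hk : Computable k)
    (hm : Computable m) : Computable fun a => K.strCheck (f a) (g a) (h a) (k a) (m a) := by
  unfold strCheck
  fun_prop

@[fun_prop] theorem computable_totalCheck {f h₁ h₂ : α → ℕ} {g : α → Strings} {k : α → ClosPairs}
    {b : α → Bool} (hf : Computable f) (hg : Computable g) (hk : Computable k) (hb : Computable b)
    (hh₁ : Computable h₁) (hh₂ : Computable h₂) :
    Computable fun a => K.totalCheck (f a) (g a) (k a) (b a) (h₁ a) (h₂ a) := by
  unfold totalCheck
  fun_prop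

@[fun_prop] theorem computable_injCheck {f h₁ h₂ : α → ℕ} {g : α → Strings} {k : α → ClosPairs}
    (hf : Computable f) (hg : Computable g) (hk : Computable k)
    (hh₁ : Computable h₁) (hh₂ : Computable h₂) :
    Computable fun a => K.injCheck (f a) (g a) (k a) (h₁ a) (h₂ a) := by
  unfold injCheck
  fun_prop

@[fun_prop] theorem computable_relCheck {f h₁ h₂ h₃ h₄ h₅ h₆ : α → ℕ} {g : α → Strings}
    {k : α → ClosPairs} (hf : Computable f) (hg : Computable g) (hk : Computable k)
    (hh₁ : Computable h₁) (hh₂ : Computable h₂) (hh₃ : Computable h₃) (hh₄ : Computable h₄)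
    (hh₅ : Computable h₅) (hh₆ : Computable h₆) : Computable fun a =>
      K.relCheck (f a) (g a) (k a) (h₁ a) (h₂ a) (h₃ a) (h₄ a) (h₅ a) (h₆ a) := by
  unfold relCheck
  fun_prop

@[fun_prop] theorem computable_isoCheck {f : α → ℕ} {g : α → Strings} {h : α → List ℕ}
    {m n : α → ℕ × List ℕ} {k : α → ClosPairs} (hf : Computable f) (hg : Computable g)
    (hh : Computable h) (hm : Computable m) (hn : Computable n) (hk : Computable k) :
    Computable fun a => K.isoCheck (f a) (g a) (h a) (m a) (n a) (k a) := by
  unfold isoCheck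
  fun_prop

@[fun_prop] theorem computable_cands {f h : α → Strings} {g k : α → ℕ} (hf : Computable f)
    (hg : Computable g) (hk : Computable k) (hh : Computable h) :
    Computable fun a => K.cands (f a) (g a) (k a) (h a) := by
  unfold cands
  fun_prop

end Computability

/-! ### Correctness of the checks -/

section Correctness

variable {F d : ℕ} {ctx : Strings} {sg : List ℕ} {Sg : Signature A l} {M N : RelStructure A l}

theorem sigCheck_iff (h0 : [] ∈ ctx) (hl : sg.length = l)
    (hsg : ∀ i : Fin l, Rep E ctx d (sg.getD i 0) (Sg.sym i)) (hF : 2 * d < F) :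
    K.sigCheck F ctx sg = true ↔ Sg.IsValid := by
  subst hl
  simp only [sigCheck, List.all_eq_true, List.mem_range, Bool.and_eq_true, Bool.or_eq_true,
    beq_iff_eq]
  have key : ∀ i j : Fin sg.length, (∀ q ∈ K.mems ctx (sg.getD i 0),
      (!K.isEqOrMem F (true, q.1, q.2, sg.getD j 0)) = true) ↔ ∀ σ ∈ Sg.sym i, σ ∉ Sg.sym j := by
    intro i j
    refine K.forall_mems_iff h0 (hsg i) (fun g hg y => ?_) fun q d' y hc hd hr => ?_
    · conv_lhs => rw [← (hsg j).map_eq h0 hg]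
      exact not_congr (ASet.map_mem_map_iff g)
    · rw [Bool.not_eq_true', ← Bool.not_eq_true]
      exact not_congr
        (K.isEqOrMem_iff (hc h0) hr ((hsg j).mono hc le_rfl) (n := F) (by omega)).1
  constructor
  · intro H
    refine ⟨fun i => (setCode_iff (hsg i)).1 (H i i.2).1, fun i j hij => (key i j).1 ?_⟩
    exact ((H i i.2).2 j j.2).resolve_left fun h => hij (Fin.ext h)
  · rintro ⟨h1, h2⟩ i hi
    refine ⟨(setCode_iff (hsg ⟨i, hi⟩)).2 (h1 _), fun j hj => or_iff_not_imp_left.2 fun hij => ?_⟩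
    exact (key ⟨i, hi⟩ ⟨j, hj⟩).2 (h2 _ _ fun h => hij (congrArg Fin.val h))

theorem forall₂_rep_replicate {o : ℕ} {x : ASet A} (h : Rep E ctx d o x) (n : ℕ) :
    List.Forall₂ (Rep E ctx d) (List.replicate n o) (List.replicate n x) := by
  induction n with
  | zero => exact .nil
  | succ n ih => exact .cons h ih

omit [L.Structure A] [L.IsRelational] in
theorem exists_forall₂_replicate {n : ℕ} {x : ASet A} {P : List (ASet A) → Prop} :
    (∃ ys, List.Forall₂ (· ∈ ·) ys (List.replicate n x) ∧ P ys) ↔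
      ∃ a : Fin n → ASet A, (∀ j, a j ∈ x) ∧ P (List.ofFn a) := by
  constructor
  · rintro ⟨ys, h, hP⟩
    obtain ⟨rfl, h'⟩ := forall₂_mem_replicate.1 h
    exact ⟨ys.get, fun j => h' _ (List.get_mem _ _), by rwa [List.ofFn_get]⟩
  · rintro ⟨a, h, hP⟩
    refine ⟨_, forall₂_mem_replicate.2 ⟨List.length_ofFn, fun y hy => ?_⟩, hP⟩
    obtain ⟨j, rfl⟩ := (List.mem_ofFn' _ _).1 hy
    exact h j

theorem strCheck_iff (h0 : [] ∈ ctx) (hl : sg.length = l)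
    (hsg : ∀ i : Fin l, Rep E ctx d (sg.getD i 0) (Sg.sym i)) {u : ℕ} {I : List ℕ}
    (hu : Rep E ctx d u M.univ) (hI : ∀ i : Fin l, Rep E ctx d (I.getD i 0) (M.interp i))
    (hF : 2 * d + 2 * l < F) : K.strCheck F ctx sg u I = true ↔ M.IsStructure Sg := by
  subst hl
  rw [strCheck, Bool.and_eq_true, setCode_iff hu]
  refine and_congr Iff.rfl ?_
  simp only [List.all_eq_true, List.mem_range, Bool.and_eq_true]
  rw [Fin.forall_iff]
  refine forall₂_congr fun i hi => and_congr (setCode_iff (hI ⟨i, hi⟩)) ?_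
  -- Being a tuple of the required shape is invariant, as the set of symbols and the universe are
  -- fixed.
  have hinv : ∀ {ctx' : Strings}, ctx ⊆ ctx' → ∀ g : A ≃[L] A, Maps E g ctx' ctx' →
      ∀ t, (∃ σ ∈ Sg.sym ⟨i, hi⟩, ∃ a : Fin (i + 1) → ASet A, (∀ j, a j ∈ M.univ) ∧
        t = ASet.tuple σ a) → ∃ σ ∈ Sg.sym ⟨i, hi⟩, ∃ a : Fin (i + 1) → ASet A,
        (∀ j, a j ∈ M.univ) ∧ ASet.map g t = ASet.tuple σ a := by
    rintro ctx' hc g hg _ ⟨σ, hσ, a, ha, rfl⟩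
    refine ⟨ASet.map g σ, ?_, fun j => ASet.map g (a j), fun j => ?_, ?_⟩
    · rw [← (hsg ⟨i, hi⟩).map_eq h0 (hg.mono hc)]
      exact ASet.mem_map hσ
    · rw [← hu.map_eq h0 (hg.mono hc)]
      exact ASet.mem_map (ha j)
    · simp only [ASet.tuple, ASet.map_foldl_pair, List.map_ofFn]
      rfl
  refine K.forall_mems_iff h0 (hI ⟨i, hi⟩) (map_iff_of_imp (hinv (List.Subset.refl _)))
    fun q d' t hc hd hr => ?_
  rw [List.any_eq_true, K.exists_seqs_iff (hc h0) (.cons ((hsg ⟨i, hi⟩).mono hc le_rfl)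
    (forall₂_rep_replicate (hu.mono hc le_rfl) (i + 1)))
    (P := fun ys => t = (ys.drop 1).foldl ASet.pair (ys.getD 0 default))]
  · simp only [List.forall₂_cons_right_iff]
    constructor
    · rintro ⟨_, ⟨σ, ys, hσ, hys, rfl⟩, h⟩
      obtain ⟨a, ha, h'⟩ := exists_forall₂_replicate
        (P := fun ys => t = ys.foldl ASet.pair σ).1 ⟨ys, hys, h⟩
      exact ⟨σ, hσ, a, ha, h'⟩
    · rintro ⟨σ, hσ, a, ha, rfl⟩
      obtain ⟨ys, hys, h⟩ := exists_forall₂_replicate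
        (P := fun ys => ASet.tuple σ a = ys.foldl ASet.pair σ).2 ⟨a, ha, rfl⟩
      exact ⟨_, ⟨σ, ys, hσ, hys, rfl⟩, h⟩
  · intro g hg ys
    conv_lhs => rw [← hr.map_eq (hc h0) hg]
    rw [getD_map_default, ← List.map_drop, ← ASet.map_foldl_pair]
    exact (ASet.map_equiv_injective g).eq_iff
  · intro q' ys hc' hlen hys
    have h1 := Rep.getD hys (n := 0) (by simp [hlen])
    have h2 : List.Forall₂ (Rep E q'.1 d) (q'.2.drop 1) (ys.drop 1) := List.forall₂_drop 1 hys
    -- The tuple has `i + 1 ≤ l` components besides the symbol, hence rank at most `d + 2 * l`; this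
    -- accounts for the summand `2 * l` in the bound on `F`.
    refine (K.isEqOrMem_iff (hc' (hc h0)) (hr.mono hc' le_rfl) (h1.foldl_pair h2) ?_).2
    have : (q'.2.drop 1).length = i + 1 := by simp [hlen]
    omega

variable {R : ClosPairs}

theorem totalCheck_iff (h0 : [] ∈ ctx) (hR : ∀ r ∈ R, ∃ e₁ e₂ : SetExpr L, r.1.1 = E.exprCode e₁ ∧
    r.2.1 = E.exprCode e₂ ∧ E.exprCode e₁ ≤ d ∧ E.exprCode e₂ ≤ d) (hF : 2 * d < F) (b : Bool)
    {u u' : ℕ} {x x' : ASet A} (hu : Rep E ctx d u x) (hu' : Rep E ctx d u' x') :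
    K.totalCheck F ctx R b u u' = true ↔
      ∀ y ∈ x, ∃ z ∈ x', bif b then Grel E ctx R y z else Grel E ctx R z y := by
  have hinv : ∀ g : A ≃[L] A, Maps E g ctx ctx → ∀ y z,
      (bif b then Grel E ctx R (ASet.map g y) (ASet.map g z)
        else Grel E ctx R (ASet.map g z) (ASet.map g y)) ↔
      bif b then Grel E ctx R y z else Grel E ctx R z y := by
    intro g hg y z
    cases b <;> exact grel_map_iff hg
  simp only [totalCheck, List.all_eq_true, List.any_eq_true]
  refine K.forall_mems_iff h0 hu (map_iff_of_imp (P := fun y => ∃ z ∈ x',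
    bif b then Grel E ctx R y z else Grel E ctx R z y) fun g hg y => ?_) fun p d' y hc hd hr => ?_
  · rintro ⟨z, hz, h⟩
    refine ⟨ASet.map g z, ?_, (hinv g hg y z).2 h⟩
    rw [← hu'.map_eq h0 hg]
    exact ASet.mem_map hz
  · refine K.exists_mems_iff (hc h0) (hu'.mono hc le_rfl) (fun g hg z => ?_)
      fun q d'' z hc' hd' hr' => ?_
    · conv_lhs => rw [← hr.map_eq (hc h0) hg]
      exact hinv g (hg.mono hc) y z
    · have hr := hr.mono hc' hd.le
      have hr' := hr'.mono (List.Subset.refl _) hd'.le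
      cases b
      · exact K.inG_iff h0 (List.Subset.trans hc hc') hR hF hr' hr
      · exact K.inG_iff h0 (List.Subset.trans hc hc') hR hF hr hr'

theorem injCheck_iff (h0 : [] ∈ ctx) (hR : ∀ r ∈ R, ∃ e₁ e₂ : SetExpr L, r.1.1 = E.exprCode e₁ ∧
    r.2.1 = E.exprCode e₂ ∧ E.exprCode e₁ ≤ d ∧ E.exprCode e₂ ≤ d) (hF : 2 * d < F)
    {u u' : ℕ} {x x' : ASet A} (hu : Rep E ctx d u x) (hu' : Rep E ctx d u' x') :
    K.injCheck F ctx R u u' = true ↔ ∀ y₁ ∈ x, ∀ y₂ ∈ x, ∀ z₁ ∈ x', ∀ z₂ ∈ x',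
      Grel E ctx R y₁ z₁ → Grel E ctx R y₂ z₂ → (y₁ = y₂ ↔ z₁ = z₂) := by
  rw [injCheck, List.all_eq_true, K.forall_seqs_iff h0
    (.cons hu (.cons hu (.cons hu' (.cons hu' .nil))))
    (P := fun ys => Grel E ctx R (ys.getD 0 default) (ys.getD 2 default) →
      Grel E ctx R (ys.getD 1 default) (ys.getD 3 default) →
      (ys.getD 0 default = ys.getD 1 default ↔ ys.getD 2 default = ys.getD 3 default))]
  · simp only [List.forall₂_cons_right_iff, List.forall₂_nil_right_iff]
    constructor
    · intro H y₁ h1 y₂ h2 z₁ h3 z₂ h4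
      exact H [y₁, y₂, z₁, z₂] ⟨_, _, h1, ⟨_, _, h2, ⟨_, _, h3, ⟨_, _, h4, rfl, rfl⟩, rfl⟩, rfl⟩, rfl⟩
    · rintro H _ ⟨y₁, _, h1, ⟨y₂, _, h2, ⟨z₁, _, h3, ⟨z₂, _, h4, rfl, rfl⟩, rfl⟩, rfl⟩, rfl⟩
      exact H y₁ h1 y₂ h2 z₁ h3 z₂ h4
  · intro g hg ys
    simp only [getD_map_default, grel_map_iff hg, (ASet.map_equiv_injective g).eq_iff]
  · intro q ys hc hlen hys
    have h : ∀ n < 4, Rep E q.1 d (q.2.getD n 0) (ys.getD n default) := fun n hn =>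
      Rep.getD hys (by simpa [hlen] using hn)
    have hG : ∀ m < 4, ∀ n < 4, K.inG F ctx R q.1 (q.2.getD m 0) (q.2.getD n 0) = true ↔
        Grel E ctx R (ys.getD m default) (ys.getD n default) := fun m hm n hn =>
      K.inG_iff h0 hc hR hF (h m hm) (h n hn)
    have he : ∀ m < 4, ∀ n < 4, K.isEqOrMem F (false, q.1, q.2.getD m 0, q.2.getD n 0) = true ↔
        ys.getD m default = ys.getD n default := fun m hm n hn =>
      (K.isEqOrMem_iff (hc h0) (h m hm) (h n hn) (by omega)).2
    rw [← hG 0 (by omega) 2 (by omega), ← hG 1 (by omega) 3 (by omega),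
      ← he 0 (by omega) 1 (by omega), ← he 2 (by omega) 3 (by omega)]
    -- What remains is a propositional identity in four Boolean values.
    generalize K.inG F ctx R q.1 (q.2.getD 0 0) (q.2.getD 2 0) = a
    generalize K.inG F ctx R q.1 (q.2.getD 1 0) (q.2.getD 3 0) = b
    generalize K.isEqOrMem F (false, q.1, q.2.getD 0 0, q.2.getD 1 0) = c
    generalize K.isEqOrMem F (false, q.1, q.2.getD 2 0, q.2.getD 3 0) = e
    revert a b c e
    decide

omit [L.Structure A] [L.IsRelational] in
theorem forall_forall₂_cons_replicate {n : ℕ} {s x x' : ASet A} {P : List (ASet A) → Prop} :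
    (∀ ys, List.Forall₂ (· ∈ ·) ys (s :: (List.replicate n x ++ List.replicate n x')) → P ys) ↔
      ∀ σ ∈ s, ∀ a b : Fin n → ASet A, (∀ j, a j ∈ x) → (∀ j, b j ∈ x') →
        P (σ :: (List.ofFn a ++ List.ofFn b)) := by
  have key : ∀ {a : Fin n → ASet A} {x : ASet A}, (∀ j, a j ∈ x) →
      List.Forall₂ (· ∈ ·) (List.ofFn a) (List.replicate n x) := by
    refine fun {a x} h => forall₂_mem_replicate.2 ⟨List.length_ofFn, fun y hy => ?_⟩
    obtain ⟨j, rfl⟩ := (List.mem_ofFn' _ _).1 hy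
    exact h j
  constructor
  · intro H σ hσ a b ha hb
    exact H _ (.cons hσ (List.rel_append (key ha) (key hb)))
  · intro H ys hys
    obtain ⟨σ, zs, hσ, hzs, rfl⟩ := List.forall₂_cons_right_iff.1 hys
    have h1 := List.forall₂_take_append _ _ _ hzs
    have h2 := List.forall₂_drop_append _ _ _ hzs
    rw [List.length_replicate] at h1 h2
    obtain ⟨ha, ha'⟩ := forall₂_mem_replicate.1 h1
    obtain ⟨hb, hb'⟩ := forall₂_mem_replicate.1 h2
    have := H σ hσ (fun j => (zs.take n)[j]) (fun j => (zs.drop n)[j])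
      (fun j => ha' _ (List.getElem_mem _)) fun j => hb' _ (List.getElem_mem _)
    have e : ∀ {ws : List (ASet A)} (h : ws.length = n),
        (List.ofFn fun j : Fin n => ws[j]) = ws := by
      rintro ws rfl
      exact List.ofFn_getElem
    rwa [e ha, e hb, List.take_append_drop] at this

/-- The enumerated lists hold the symbol at position 0, then `i + 1` elements of the first universe
and `i + 1` of the second, which explains the offsets `1` and `1 + (i + 1)`. The condition is
invariant because all sets involved are fixed over `ctx`. -/
theorem relCheck_iff (h0 : [] ∈ ctx) (hR : ∀ r ∈ R, ∃ e₁ e₂ : SetExpr L, r.1.1 = E.exprCode e₁ ∧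
    r.2.1 = E.exprCode e₂ ∧ E.exprCode e₁ ≤ d ∧ E.exprCode e₂ ≤ d) {i : ℕ}
    (hF : 2 * d + 2 * (i + 1) < F) {s u₁ u₂ I₁ I₂ : ℕ} {S U₁ U₂ J₁ J₂ : ASet A}
    (hs : Rep E ctx d s S) (hu₁ : Rep E ctx d u₁ U₁) (hu₂ : Rep E ctx d u₂ U₂)
    (hI₁ : Rep E ctx d I₁ J₁) (hI₂ : Rep E ctx d I₂ J₂) :
    K.relCheck F ctx R i s u₁ u₂ I₁ I₂ = true ↔ ∀ σ ∈ S, ∀ a b : Fin (i + 1) → ASet A,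
      (∀ j, a j ∈ U₁) → (∀ j, b j ∈ U₂) → (∀ j, Grel E ctx R (a j) (b j)) →
      (ASet.tuple σ a ∈ J₁ ↔ ASet.tuple σ b ∈ J₂) := by
  rw [relCheck, List.all_eq_true, K.forall_seqs_iff h0
    (.cons hs (List.rel_append (forall₂_rep_replicate hu₁ (i + 1)) (forall₂_rep_replicate hu₂ (i + 1))))
    (P := fun ys => (∀ j < i + 1,
        Grel E ctx R (ys.getD (1 + j) default) (ys.getD (1 + (i + 1) + j) default)) →
      (((ys.drop 1).take (i + 1)).foldl ASet.pair (ys.getD 0 default) ∈ J₁ ↔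
        (ys.drop (1 + (i + 1))).foldl ASet.pair (ys.getD 0 default) ∈ J₂)),
    forall_forall₂_cons_replicate]
  · refine forall₂_congr fun σ hσ => forall₂_congr fun a b => forall₂_congr fun ha hb => ?_
    have e0 : ∀ (a : Fin (i + 1) → ASet A) (j : Fin (i + 1)),
        (List.ofFn a).getD j default = a j := by
      intro a j
      rw [List.getD_eq_getElem _ _ (by rw [List.length_ofFn]; exact j.2), List.getElem_ofFn]
    have e1 : ∀ j : Fin (i + 1),
        (σ :: (List.ofFn a ++ List.ofFn b)).getD (1 + j) default = a j := by
      intro j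
      rw [Nat.add_comm 1 j, List.getD_cons_succ, List.getD_append _ _ _ _ (by simp; omega),
        e0]
    have e2 : ∀ j : Fin (i + 1),
        (σ :: (List.ofFn a ++ List.ofFn b)).getD (1 + (i + 1) + j) default = b j := by
      intro j
      rw [Nat.add_assoc, Nat.add_comm 1 (_ + _), List.getD_cons_succ, List.getD_append_right _ _ _ _ (by simp),
        List.length_ofFn, Nat.add_sub_cancel_left, e0]
    have e3 : ((σ :: (List.ofFn a ++ List.ofFn b)).drop 1).take (i + 1) = List.ofFn a := by
      rw [List.drop_one, List.tail_cons, List.take_left' (by simp)]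
    have e4 : (σ :: (List.ofFn a ++ List.ofFn b)).drop (1 + (i + 1)) = List.ofFn b := by
      rw [Nat.add_comm 1 (_ + _), List.drop_succ_cons, List.drop_left' (by simp)]
    rw [e3, e4]
    refine imp_congr ?_ Iff.rfl
    rw [Fin.forall_iff]
    refine forall₂_congr fun j hj => ?_
    rw [← e1 ⟨j, hj⟩, ← e2 ⟨j, hj⟩]
  · intro g hg ys
    simp only [getD_map_default, grel_map_iff hg, ← List.map_drop, ← List.map_take,
      ← ASet.map_foldl_pair]
    conv_lhs => rw [← hI₁.map_eq h0 hg, ← hI₂.map_eq h0 hg]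
    simp only [ASet.map_mem_map_iff]
  · intro q ys hc hlen hys
    have hlen' : q.2.length = 1 + (i + 1) + (i + 1) := by
      rw [hlen]; simp; omega
    have h : ∀ n < 1 + (i + 1) + (i + 1), Rep E q.1 d (q.2.getD n 0) (ys.getD n default) :=
      fun n hn => Rep.getD hys (hlen' ▸ hn)
    have hG : (((List.range (i + 1)).all fun j =>
        K.inG F ctx R q.1 (q.2.getD (1 + j) 0) (q.2.getD (1 + (i + 1) + j) 0)) = true) ↔
        ∀ j < i + 1,
          Grel E ctx R (ys.getD (1 + j) default) (ys.getD (1 + (i + 1) + j) default) := by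
      simp only [List.all_eq_true, List.mem_range]
      exact forall₂_congr fun j hj =>
        K.inG_iff h0 hc hR (by omega) (h _ (by omega)) (h _ (by omega))
    have m1 := (K.isEqOrMem_iff (n := F) (hc h0) ((h 0 (by omega)).foldl_pair
      (List.forall₂_take (i + 1) (List.forall₂_drop 1 hys))) (hI₁.mono hc le_rfl)
      (by simp [hlen']; omega)).1
    have m2 := (K.isEqOrMem_iff (n := F) (hc h0) ((h 0 (by omega)).foldl_pair
      (List.forall₂_drop (1 + (i + 1)) hys)) (hI₂.mono hc le_rfl) (by simp [hlen']; omega)).1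
    rw [← hG, ← m1, ← m2]
    generalize ((List.range (i + 1)).all fun j =>
        K.inG F ctx R q.1 (q.2.getD (1 + j) 0) (q.2.getD (1 + (i + 1) + j) 0)) = a
    generalize K.isEqOrMem F _ = b
    generalize K.isEqOrMem F _ = c
    revert a b c
    decide

theorem isoCheck_iff (h0 : [] ∈ ctx) (hR : ∀ r ∈ R, ∃ e₁ e₂ : SetExpr L, r.1.1 = E.exprCode e₁ ∧
    r.2.1 = E.exprCode e₂ ∧ E.exprCode e₁ ≤ d ∧ E.exprCode e₂ ≤ d) (hl : sg.length = l)
    (hsg : ∀ i : Fin l, Rep E ctx d (sg.getD i 0) (Sg.sym i)) {m n : ℕ × List ℕ}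
    (hm : Rep E ctx d m.1 M.univ) (hmI : ∀ i : Fin l, Rep E ctx d (m.2.getD i 0) (M.interp i))
    (hn : Rep E ctx d n.1 N.univ) (hnI : ∀ i : Fin l, Rep E ctx d (n.2.getD i 0) (N.interp i))
    (hF : 2 * d + 2 * l < F) :
    K.isoCheck F ctx sg m n R = true ↔ IsoRel (Grel E ctx R) Sg M N := by
  subst hl
  simp only [isoCheck, Bool.and_eq_true]
  rw [K.totalCheck_iff h0 hR (by omega) true hm hn, K.totalCheck_iff h0 hR (by omega) false hn hm,
    K.injCheck_iff h0 hR (by omega) hm hn]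
  refine and_congr Iff.rfl (and_congr Iff.rfl (and_congr Iff.rfl ?_))
  simp only [List.all_eq_true, List.mem_range]
  rw [Fin.forall_iff]
  exact forall₂_congr fun i hi =>
    K.relCheck_iff h0 hR (by omega) (hsg ⟨i, hi⟩) hm hn (hmI ⟨i, hi⟩) (hnI ⟨i, hi⟩)

end Correctness

end Toolkit
end Checks
end AtomSets

/-! ### Definability of unions of orbits -/

namespace AtomSets

open FirstOrder Language

section Definability

variable {L : FirstOrder.Language.{v, w}}

/-- Renaming of the variables of an expression. -/
def SetExpr.relabel (f : ℕ → ℕ) : SetExpr L → SetExpr L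
  | .var i => .var (f i)
  | .union k body bound guard => .union k (fun i => (body i).relabel f)
      (fun i => (bound i).map f) fun i => (guard i).relabel f

theorem SetExpr.finite_free (e : SetExpr L) : e.free.Finite := by
  induction e with
  | var i => exact Set.finite_singleton i
  | union k body bound guard ih =>
    refine (Set.finite_iUnion fun i => (ih i).union (guard i).freeVarFinset.finite_toSet).subset ?_
    rintro x ⟨i, h, -⟩
    exact Set.mem_iUnion.2 ⟨i, h⟩

variable {A : Type u} [L.Structure A]

theorem SetExpr.eval_relabel {f : ℕ → ℕ} (hf : Function.Injective f) (e : SetExpr L)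
    (val : ℕ → A) : (e.relabel f).eval val = e.eval (val ∘ f) := by
  induction e generalizing val with
  | var i => rfl
  | union k body bound guard ih =>
    refine (SetExpr.isSet_eval_union _ _ _ _).ext (SetExpr.isSet_eval_union _ _ _ _) fun z => ?_
    refine SetExpr.mem_eval_union.trans (Iff.trans ?_ SetExpr.mem_eval_union.symm)
    refine exists_congr fun i => ⟨?_, ?_⟩
    · rintro ⟨p, h1, h2, rfl⟩
      refine ⟨p ∘ f, fun x hx => h1 _ ?_, Formula.realize_relabel.1 h2, ih i p⟩
      simpa [hf.eq_iff] using hx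
    · rintro ⟨p, h1, h2, rfl⟩
      -- Injectivity of the renaming lets `p` be transported along `f`; variables outside the range
      -- of `f` keep their old values.
      have hp : Function.extend f p val ∘ f = p := funext fun x => hf.extend_apply _ _ x
      refine ⟨Function.extend f p val, fun x hx => ?_, Formula.realize_relabel.2 ?_, ?_⟩
      · by_cases h : ∃ y, f y = x
        · obtain ⟨y, rfl⟩ := h
          rw [hf.extend_apply]
          exact h1 y fun hy => hx (List.mem_map_of_mem hy)
        · exact Function.extend_apply' _ _ _ h
      · rwa [hp]
      · rw [ih, hp]

/-- The variables of the two expressions are made disjoint by renaming them to even and odd numbers,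
so that one valuation serves both. The pair is a union of two set-builders that bind nothing. -/
theorem SetExpr.exists_eval_upair (e₁ e₂ : SetExpr L) (v₁ v₂ : ℕ → A) :
    ∃ (e : SetExpr L) (val : ℕ → A), e.eval val = ASet.upair (e₁.eval v₁) (e₂.eval v₂) := by
  let val : ℕ → A := fun i => if i % 2 = 0 then v₁ (i / 2) else v₂ (i / 2)
  have h1 : (e₁.relabel (fun i => 2 * i)).eval val = e₁.eval v₁ := by
    rw [eval_relabel fun i j h => by simpa using h]
    congr 1
    funext i
    simp [val]
  have h2 : (e₂.relabel (fun i => 2 * i + 1)).eval val = e₂.eval v₂ := by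
    rw [eval_relabel fun i j h => by simpa using h]
    congr 1
    funext i
    have : (2 * i + 1) / 2 = i := by omega
    simp [val, this, Nat.add_mod]
  refine ⟨.union 2 ![e₁.relabel (fun i => 2 * i), e₂.relabel (fun i => 2 * i + 1)]
    (fun _ => []) fun _ => ⊤, val, ?_⟩
  refine (SetExpr.isSet_eval_union _ _ _ _).ext (ASet.isSet_upair _ _) fun z => ?_
  refine SetExpr.mem_eval_union.trans ?_
  rw [ASet.mem_upair, Fin.exists_fin_two]
  have hp : ∀ p : ℕ → A, (∀ x, x ∉ ([] : List ℕ) → p x = val x) → p = val := fun p h =>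
    funext fun x => h x List.not_mem_nil
  constructor
  · rintro (⟨p, h, -, rfl⟩ | ⟨p, h, -, rfl⟩)
    · exact .inl (by rw [hp p h, ← h1]; rfl)
    · exact .inr (by rw [hp p h, ← h2]; rfl)
  · rintro (rfl | rfl)
    · exact .inl ⟨val, fun _ _ => rfl, Formula.realize_top.2 trivial, by rw [← h1]; rfl⟩
    · exact .inr ⟨val, fun _ _ => rfl, Formula.realize_top.2 trivial, by rw [← h2]; rfl⟩

theorem SetExpr.exists_eval_pair (e₁ e₂ : SetExpr L) (v₁ v₂ : ℕ → A) :
    ∃ (e : SetExpr L) (val : ℕ → A), e.eval val = ASet.pair (e₁.eval v₁) (e₂.eval v₂) := by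
  obtain ⟨e, v, h⟩ := exists_eval_upair e₁ e₂ v₁ v₂
  obtain ⟨e', v', h'⟩ := exists_eval_upair e₁ e₁ v₁ v₁
  rw [ASet.pair, ← h, ← h']
  exact exists_eval_upair e e' v v'

/-- The witness is a single union whose `i`-th part has body `e i`, binds all variables below `N`,
and is guarded by the formula for the orbit of the tuple consisting of the first `N` values of `v i`
and an enumeration of `T`. The variables from `N` on stay free and carry that enumeration, which
forces the automorphisms in the guard to fix `T`. -/
theorem exists_definableOver_orbits [L.IsRelational] [Countable A]
    (hfin : ∀ n, Finite (Quotient (orbitSetoid L A n))) {T : Finset A} (hT : T.Nonempty) {m : ℕ}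
    (e : Fin m → SetExpr L) (v : Fin m → ℕ → A) :
    ∃ z : ASet A, z.IsSet ∧ DefinableOver L T z ∧ ∀ y, y ∈ z ↔ ∃ i, ∃ g : A ≃[L] A,
      (∀ s ∈ T, g s = s) ∧ y = ASet.map g ((e i).eval (v i)) := by
  obtain ⟨s₀, hs₀⟩ := hT
  obtain ⟨t, ht, k, hk⟩ : ∃ t : ℕ → A, (∀ j, t j ∈ T) ∧ ∃ k, ∀ s ∈ T, ∃ j < k, t j = s := by
    refine ⟨fun j => T.toList.getD j s₀, fun j => ?_, T.toList.length, fun s hs => ?_⟩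
    · show T.toList.getD j s₀ ∈ T
      by_cases h : j < T.toList.length
      · rw [List.getD_eq_getElem _ _ h]
        exact Finset.mem_toList.1 (List.getElem_mem h)
      · rwa [List.getD_eq_default _ _ (by omega)]
    · obtain ⟨j, hj, rfl⟩ := List.getElem_of_mem (Finset.mem_toList.2 hs)
      exact ⟨j, hj, List.getD_eq_getElem _ _ hj⟩
  obtain ⟨N, hN⟩ : ∃ N, ∀ i, ∀ x ∈ (e i).free, x < N := by
    obtain ⟨N, hN⟩ := (Set.finite_iUnion fun i => (e i).finite_free).bddAbove
    exact ⟨N + 1, fun i x hx => Nat.lt_succ_of_le (hN (Set.mem_iUnion.2 ⟨i, hx⟩))⟩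
  choose φ hφ using fun i => exists_orbit_formula hfin
    fun j : Fin (N + k) => if (j : ℕ) < N then v i j else t (j - N)
  let guard : Fin m → L.Formula ℕ := fun i => (φ i).relabel fun j : Fin (N + k) => (j : ℕ)
  have hguard : ∀ i (p : ℕ → A), (guard i).Realize p ↔ ∃ g : A ≃[L] A, ∀ j : Fin (N + k),
      g (if (j : ℕ) < N then v i j else t (j - N)) = p j := fun i p =>
    Formula.realize_relabel.trans (hφ i _)
  -- Truncated subtraction gives the variables below `N` the value `t 0`, so all values of this
  -- valuation lie in `T`.
  refine ⟨(SetExpr.union m e (fun _ => List.range N) guard).eval fun j => t (j - N),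
    SetExpr.isSet_eval_union _ _ _ _, ⟨_, _, fun j _ => ht _, rfl⟩, fun y => ?_⟩
  refine SetExpr.mem_eval_union.trans (exists_congr fun i => ⟨?_, ?_⟩)
  · rintro ⟨p, h1, h2, rfl⟩
    obtain ⟨g, hg⟩ := (hguard i p).1 h2
    refine ⟨g, fun s hs => ?_, ?_⟩
    · obtain ⟨j, hj, rfl⟩ := hk s hs
      have := hg ⟨N + j, by omega⟩
      rw [h1 _ (by simp)] at this
      simpa using this
    · rw [← SetExpr.eval_comp_equiv]
      refine SetExpr.eval_congr _ fun x hx => ?_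
      have := hg ⟨x, by have := hN i x hx; omega⟩
      rw [if_pos (hN i x hx)] at this
      exact this.symm
  · rintro ⟨g, hg, rfl⟩
    refine ⟨fun x => if x < N then g (v i x) else t (x - N), fun x hx => ?_,
      (hguard i _).2 ⟨g, fun j => ?_⟩, ?_⟩
    · exact if_neg (by simpa using hx)
    · by_cases h : (j : ℕ) < N
      · simp [h]
      · simp [h, hg _ (ht _)]
    · rw [← SetExpr.eval_comp_equiv]
      exact SetExpr.eval_congr _ fun x hx => (if_pos (hN i x hx)).symm

theorem DefinableOver.map_eq {T : Finset A} {x : ASet A} (h : DefinableOver L T x) {g : A ≃[L] A}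
    (hg : ∀ s ∈ T, g s = s) : ASet.map g x = x := by
  obtain ⟨e, val, hT, rfl⟩ := h
  rw [← SetExpr.eval_comp_equiv]
  exact SetExpr.eval_congr _ fun i hi => hg _ (hT i hi)

/-- Isomorphisms that are definable over `T` correspond to relations that are unions of finitely
many orbits of the automorphisms that fix `T`. -/
theorem IsoOver.exists_isoRel {l : ℕ} {T : Finset A} {Sg : Signature A l} {M N : RelStructure A l}
    (h : IsoOver L T Sg M N) : ∃ G : ASet A → ASet A → Prop, IsoRel G Sg M N ∧
      ∀ g : A ≃[L] A, (∀ s ∈ T, g s = s) → ∀ x y, G (ASet.map g x) (ASet.map g y) ↔ G x y := by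
  obtain ⟨h, hiso, G, ⟨-, hG⟩, hdef⟩ := h
  have key : ∀ (x : M.univ.Elem) y, ASet.pair x.1 y ∈ G ↔ y = (h x).1 := by
    intro x y
    rw [hG]
    constructor
    · rintro ⟨a, ha⟩
      obtain ⟨h1, rfl⟩ := ASet.pair_injective ha
      rw [Subtype.ext h1]
    · rintro rfl
      exact ⟨x, rfl⟩
  refine ⟨fun x y => ASet.pair x y ∈ G, ⟨fun x hx => ?_, fun y hy => ?_, ?_, ?_⟩, fun g hg x y => ?_⟩
  · exact ⟨_, (h ⟨x, hx⟩).2, (key ⟨x, hx⟩ _).2 rfl⟩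
  · refine ⟨_, (h.symm ⟨y, hy⟩).2, (key _ _).2 ?_⟩
    exact (congrArg Subtype.val (h.apply_symm_apply ⟨y, hy⟩)).symm
  · intro x hx x' hx' y hy y' hy' H H'
    rw [(key ⟨x, hx⟩ y).1 H, (key ⟨x', hx'⟩ y').1 H']
    refine ⟨by rintro rfl; rfl, fun H => ?_⟩
    exact congrArg Subtype.val (h.injective (Subtype.ext H))
  · intro i σ hσ a b ha hb H
    have : b = fun j => (h ⟨a j, ha j⟩).1 := funext fun j => (key ⟨a j, ha j⟩ _).1 (H j)
    rw [this]
    exact hiso i σ hσ fun j => ⟨a j, ha j⟩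
  · show ASet.pair _ _ ∈ G ↔ _
    rw [← ASet.map_pair]
    conv_lhs => rw [← hdef.map_eq hg]
    exact ASet.map_mem_map_iff g

/-- Totality yields a function by choice. The equivalence of equalities in `IsoRel` makes it
injective and the unique one with graph inside `G`, and surjectivity follows, so `z` is its graph.
-/
theorem IsoRel.isoOver {l : ℕ} {T : Finset A} {Sg : Signature A l} {M N : RelStructure A l}
    {G : ASet A → ASet A → Prop} (h : IsoRel G Sg M N) {z : ASet A} (hz : z.IsSet)
    (hdef : DefinableOver L T z)
    (hG : ∀ t, t ∈ z ↔ ∃ x ∈ M.univ, ∃ y ∈ N.univ, G x y ∧ t = ASet.pair x y) :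
    IsoOver L T Sg M N := by
  obtain ⟨h1, h2, h3, h4⟩ := h
  choose f hf hf' using h1
  have hbij : Function.Bijective fun x : M.univ.Elem => (⟨f x.1 x.2, hf x.1 x.2⟩ : N.univ.Elem) := by
    constructor
    · intro x x' hxx
      exact Subtype.ext ((h3 _ x.2 _ x'.2 _ (hf _ x.2) _ (hf _ x'.2) (hf' _ x.2) (hf' _ x'.2)).2
        (congrArg Subtype.val hxx))
    · intro y
      obtain ⟨x, hx, H⟩ := h2 y.1 y.2
      exact ⟨⟨x, hx⟩, Subtype.ext ((h3 _ hx _ hx _ (hf _ hx) _ y.2 (hf' _ hx) H).1 rfl)⟩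
  refine ⟨Equiv.ofBijective _ hbij, fun i σ hσ a => ?_, z, ⟨hz, fun t => ?_⟩, hdef⟩
  · exact h4 i σ hσ _ _ (fun j => (a j).2) (fun j => hf _ (a j).2) fun j => hf' _ (a j).2
  · rw [hG]
    constructor
    · rintro ⟨x, hx, y, hy, H, rfl⟩
      refine ⟨⟨x, hx⟩, ?_⟩
      rw [(h3 _ hx _ hx _ hy _ (hf _ hx) H (hf' _ hx)).1 rfl]
      rfl
    · rintro ⟨a, rfl⟩
      exact ⟨_, a.2, _, hf _ a.2, hf' _ a.2, rfl⟩

theorem IsoRel.congr {l : ℕ} {Sg : Signature A l} {M N : RelStructure A l}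
    {G G' : ASet A → ASet A → Prop} (h : IsoRel G Sg M N)
    (hG : ∀ x ∈ M.univ, ∀ y ∈ N.univ, (G x y ↔ G' x y)) : IsoRel G' Sg M N := by
  obtain ⟨h1, h2, h3, h4⟩ := h
  refine ⟨fun x hx => ?_, fun y hy => ?_, fun x hx x' hx' y hy y' hy' H H' => ?_,
    fun i σ hσ a b ha hb H => ?_⟩
  · obtain ⟨y, hy, H⟩ := h1 x hx
    exact ⟨y, hy, (hG x hx y hy).1 H⟩
  · obtain ⟨x, hx, H⟩ := h2 y hy
    exact ⟨x, hx, (hG x hx y hy).1 H⟩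
  · exact h3 x hx x' hx' y hy y' hy' ((hG _ hx _ hy).2 H) ((hG _ hx' _ hy').2 H')
  · exact h4 i σ hσ a b ha hb fun j => (hG _ (ha j) _ (hb j)).2 (H j)

end Definability
end AtomSets

/-! ### Deciding definable isomorphism -/

namespace AtomSets

open FirstOrder Language

section Decision

variable {L : FirstOrder.Language.{v, w}} [L.IsRelational] {A : Type u} [L.Structure A]
  {E : Encoding L A}

theorem encode_prod_le {α β : Type*} [Encodable α] [Encodable β] (q : α × β) :
    Encodable.encode q.1 ≤ Encodable.encode q ∧ Encodable.encode q.2 ≤ Encodable.encode q :=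
  ⟨Nat.left_le_pair _ _, Nat.right_le_pair _ _⟩

namespace Toolkit

variable (K : Toolkit E)

include K in
-- Avoids a proof that codes are injective: the equality test sees only codes. It accepts a code
-- compared with itself, and by its correctness for the presentations by `e` and `e'` the two values
-- coincide.
theorem eval_eq_of_exprCode_eq {e e' : SetExpr L} (h : E.exprCode e = E.exprCode e')
    (p : Strings) : e.eval (E.val p) = e'.eval (E.val p) := by
  have h1 : Rep E ([] :: p) (E.exprCode e) (clos (E.exprCode e) p) (e.eval (E.val p)) :=
    .clos e (List.subset_cons_self _ _) le_rfl
  have h2 : Rep E ([] :: p) (E.exprCode e') (clos (E.exprCode e') p) (e'.eval (E.val p)) :=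
    .clos e' (List.subset_cons_self _ _) le_rfl
  rw [← h] at h2
  have h3 := (K.isEqOrMem_iff List.mem_cons_self h1 h1 (Nat.lt_succ_self _)).2
  exact (K.isEqOrMem_iff List.mem_cons_self h1 h2 (Nat.lt_succ_self _)).2.1 (h3.2 rfl)

theorem exists_of_mem_cands {ctx p : Strings} {e e' : SetExpr L} {r : (ℕ × Strings) × (ℕ × Strings)}
    (hr : r ∈ K.cands ctx (E.exprCode e) (E.exprCode e') p) : ∃ e₁ e₂ : SetExpr L,
      r.1.1 = E.exprCode e₁ ∧ r.2.1 = E.exprCode e₂ ∧ E.exprCode e₁ < E.exprCode e ∧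
      E.exprCode e₂ < E.exprCode e' ∧ e₁.eval (E.val r.1.2) ∈ e.eval (E.val p) ∧
      e₂.eval (E.val r.2.2) ∈ e'.eval (E.val p) := by
  simp only [cands, List.mem_flatMap, List.mem_map] at hr
  obtain ⟨⟨c, w⟩, h1, ⟨c', w'⟩, h2, rfl⟩ := hr
  obtain ⟨e₁, rfl, h3, h4⟩ := K.exists_of_mem_closMems h1
  obtain ⟨e₂, rfl, h5, h6⟩ := K.exists_of_mem_closMems h2
  exact ⟨e₁, e₂, rfl, rfl, h3, h5, h4, h6⟩

/-- First `g` takes `x` to a representative with parameters `w₁`. Then `k`, which fixes `ctx` and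
`w₁`, takes the image of `y` to a representative without disturbing the first one. -/
theorem exists_mem_cands {ctx p : Strings} (h0 : [] ∈ ctx) (hp : p ⊆ ctx) {e e' : SetExpr L}
    {x y : ASet A} (hx : x ∈ e.eval (E.val p)) (hy : y ∈ e'.eval (E.val p)) :
    ∃ r ∈ K.cands ctx (E.exprCode e) (E.exprCode e') p, ∃ e₁ e₂ : SetExpr L,
      E.exprCode e₁ = r.1.1 ∧ E.exprCode e₂ = r.2.1 ∧ ∃ g : A ≃[L] A, Maps E g ctx ctx ∧
      e₁.eval (E.val r.1.2) = ASet.map g x ∧ e₂.eval (E.val r.2.2) = ASet.map g y := by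
  obtain ⟨e₁, w₁, h1, -, g, hg, h2⟩ := K.exists_mem_closMems h0 hp hx
  have hy' : ASet.map g y ∈ e'.eval (E.val p) := by
    rw [eval_of_maps (hg.mono hp) (hg.fix_nil h0)]
    exact ASet.mem_map hy
  obtain ⟨e₂, w₂, h3, -, k, hk, h4⟩ := K.exists_mem_closMems
    (List.mem_append_left w₁ h0) (List.subset_append_of_subset_left w₁ hp) hy'
  refine ⟨((E.exprCode e₁, w₁), (E.exprCode e₂, w₂)), ?_, e₁, e₂, rfl, rfl, k.comp g,
    hg.comp (hk.mono (List.subset_append_left _ _)), ?_, ?_⟩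
  · simp only [cands, List.mem_flatMap, List.mem_map]
    exact ⟨_, h1, _, h3, rfl⟩
  · rw [ASet.map_comp_equiv, ← h2]
    exact eval_of_maps (hk.mono (List.subset_append_right _ _))
      (hk.fix_nil (List.mem_append_left _ h0)) e₁
  · rw [ASet.map_comp_equiv, h4]

theorem exists_isoRel_iff [Countable A] (hfin : ∀ n, Finite (Quotient (orbitSetoid L A n)))
    {ctx p : Strings} (h0 : [] ∈ ctx) (hp : p ⊆ ctx) {T : Finset A}
    (hT : ∀ g : A ≃[L] A, Maps E g ctx ctx ↔ ∀ s ∈ T, g s = s) (hne : T.Nonempty) {l : ℕ}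
    {Sg : Signature A l} {M N : RelStructure A l} {e e' : SetExpr L}
    (hM : M.univ = e.eval (E.val p)) (hN : N.univ = e'.eval (E.val p)) :
    (∃ R ∈ (K.cands ctx (E.exprCode e) (E.exprCode e') p).sublists',
      IsoRel (Grel E ctx R) Sg M N) ↔ IsoOver L T Sg M N := by
  classical
  constructor
  · rintro ⟨R, hR, h⟩
    have hR := (List.mem_sublists'.1 hR).subset
    choose e₁ e₂ h1 h2 _ _ h3 h4 using fun i : Fin R.length =>
      K.exists_of_mem_cands (hR (List.getElem_mem i.2))
    choose f val hf using fun i : Fin R.length =>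
      SetExpr.exists_eval_pair (e₁ i) (e₂ i) (E.val R[i].1.2) (E.val R[i].2.2)
    -- The orbits over `T` of the chosen pairs together form the graph.
    obtain ⟨z, hz, hdef, H⟩ := exists_definableOver_orbits hfin hne f val
    refine h.isoOver hz hdef fun t => (H t).trans ?_
    constructor
    · rintro ⟨i, g, hg, rfl⟩
      have hg' := (hT g).2 hg
      refine ⟨ASet.map g ((e₁ i).eval (E.val R[i].1.2)), ?_,
        ASet.map g ((e₂ i).eval (E.val R[i].2.2)), ?_,
        ⟨R[i], List.getElem_mem _, e₁ i, e₂ i, (h1 i).symm, (h2 i).symm, g, hg', rfl, rfl⟩, ?_⟩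
      · rw [hM, eval_of_maps (hg'.mono hp) (hg'.fix_nil h0)]
        exact ASet.mem_map (h3 i)
      · rw [hN, eval_of_maps (hg'.mono hp) (hg'.fix_nil h0)]
        exact ASet.mem_map (h4 i)
      · rw [hf, ASet.map_pair]
    · rintro ⟨x, -, y, -, ⟨r, hr, e₁', e₂', h1', h2', g, hg, rfl, rfl⟩, rfl⟩
      obtain ⟨i, hi, rfl⟩ := List.getElem_of_mem hr
      refine ⟨⟨i, hi⟩, g, (hT g).1 hg, ?_⟩
      rw [hf, ASet.map_pair, K.eval_eq_of_exprCode_eq (h1'.trans (h1 ⟨i, hi⟩)),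
        K.eval_eq_of_exprCode_eq (h2'.trans (h2 ⟨i, hi⟩))]
      rfl
  · intro h
    obtain ⟨G, hG, hinv⟩ := h.exists_isoRel
    -- Keep the candidates that lie in the given invariant relation `G`. Every pair of elements is
    -- equivalent to a candidate, so their orbits recover `G` on the universes.
    refine ⟨(K.cands ctx (E.exprCode e) (E.exprCode e') p).filter fun r => ∃ e₁ e₂ : SetExpr L,
      E.exprCode e₁ = r.1.1 ∧ E.exprCode e₂ = r.2.1 ∧
      G (e₁.eval (E.val r.1.2)) (e₂.eval (E.val r.2.2)),
      List.mem_sublists'.2 List.filter_sublist, hG.congr fun x hx y hy => ⟨fun H => ?_, ?_⟩⟩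
    · obtain ⟨r, hr, e₁, e₂, h1, h2, g, hg, h3, h4⟩ :=
        K.exists_mem_cands h0 hp (hM ▸ hx) (hN ▸ hy)
      refine ⟨r, List.mem_filter.2 ⟨hr, decide_eq_true ⟨e₁, e₂, h1, h2, ?_⟩⟩, e₁, e₂, h1, h2,
        g.symm, hg.symm, ?_, ?_⟩
      · rw [h3, h4]
        exact (hinv g ((hT g).1 hg) x y).2 H
      · rw [h3, ASet.map_symm_map]
      · rw [h4, ASet.map_symm_map]
    · rintro ⟨r, hr, e₁, e₂, h1, h2, g, hg, rfl, rfl⟩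
      obtain ⟨e₁', e₂', h1', h2', H⟩ := of_decide_eq_true (List.mem_filter.1 hr).2
      rw [hinv g ((hT g).1 hg), K.eval_eq_of_exprCode_eq (h1.trans h1'.symm),
        K.eval_eq_of_exprCode_eq (h2.trans h2'.symm)]
      exact H

/-- The decision procedure for definable isomorphism. -/
def decideIso (z : Strings × List ℕ × (ℕ × List ℕ) × (ℕ × List ℕ)) : Bool :=
  let F := 2 * Encodable.encode z.2 + 2 * z.2.1.length + 1
  let ctx := [] :: z.1
  let sg := z.2.1.map fun c => clos c z.1
  let m := (clos z.2.2.1.1 z.1, z.2.2.1.2.map fun c => clos c z.1)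
  let n := (clos z.2.2.2.1 z.1, z.2.2.2.2.map fun c => clos c z.1)
  K.sigCheck F ctx sg && (K.strCheck F ctx sg m.1 m.2 && (K.strCheck F ctx sg n.1 n.2 &&
    ((K.cands ctx z.2.2.1.1 z.2.2.2.1 z.1).sublists'.any fun R => K.isoCheck F ctx sg m n R)))

theorem computable_decideIso : Computable K.decideIso := by
  unfold decideIso
  fun_prop

theorem decideIso_iff [Countable A] (hfin : ∀ n, Finite (Quotient (orbitSetoid L A n)))
    (helim : ParameterElimination L A) (x : IsoInput L) : K.decideIso (x.code E) = true ↔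
      x.IsInstance E ∧ DefinablyIso L (x.signature E) (x.structure₁ E) (x.structure₂ E) := by
  classical
  set z := x.code E with hz
  set ctx : Strings := [] :: x.params with hctx
  -- A code dominates the codes of its components, so this number bounds the ranks of all objects in
  -- the input.
  set d := Encodable.encode z.2 with hd
  have h0 : [] ∈ ctx := List.mem_cons_self
  have hp : x.params ⊆ ctx := List.subset_cons_self _ _
  have hle : Encodable.encode z.2.1 ≤ d ∧ (Encodable.encode z.2.2.1.1 ≤ d ∧
      Encodable.encode z.2.2.1.2 ≤ d) ∧ Encodable.encode z.2.2.2.1 ≤ d ∧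
      Encodable.encode z.2.2.2.2 ≤ d := by
    have h1 := encode_prod_le z.2
    have h2 := encode_prod_le z.2.2
    have h3 := encode_prod_le z.2.2.1
    have h4 := encode_prod_le z.2.2.2
    omega
  have hrep : ∀ (e : Fin x.l → SetExpr L),
      Encodable.encode (List.ofFn fun i => E.exprCode (e i)) ≤ d → ∀ i : Fin x.l, Rep E ctx d
        (((List.ofFn fun i => E.exprCode (e i)).map fun c => clos c x.params).getD i 0)
        ((e i).eval (E.val x.params)) := by
    intro e he i
    have : ((List.ofFn fun i => E.exprCode (e i)).map fun c => clos c x.params).getD i 0 =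
        clos (E.exprCode (e i)) x.params := by
      rw [List.getD_eq_getElem _ _ (by simp)]
      simp
    rw [this]
    refine .clos _ hp (le_trans ?_ he)
    exact (encode_le_encode_of_mem (a := E.exprCode (e i)) ((List.mem_ofFn' _ _).2 ⟨i, rfl⟩)).le
  have hsg := hrep x.sig hle.1
  have hM : Rep E ctx d (clos (E.exprCode x.univ₁) x.params) (x.structure₁ E).univ :=
    .clos _ hp hle.2.1.1
  have hMI := hrep x.interp₁ hle.2.1.2
  have hN : Rep E ctx d (clos (E.exprCode x.univ₂) x.params) (x.structure₂ E).univ :=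
    .clos _ hp hle.2.2.1
  have hNI := hrep x.interp₂ hle.2.2.2
  have hl : (z.2.1.map fun c => clos c x.params).length = x.l := by simp [hz, IsoInput.code]
  have hF : 2 * d + 2 * x.l < 2 * d + 2 * z.2.1.length + 1 := by
    simp [hz, IsoInput.code]
  -- Including the atom of the empty string makes `T` nonempty and covers the values of variables
  -- for which the input lists no parameter.
  let T : Finset A := (ctx.map E.atom).toFinset
  have hT : ∀ g : A ≃[L] A, Maps E g ctx ctx ↔ ∀ s ∈ T, g s = s := by
    intro g
    rw [maps_self_iff]
    simp [T]
  have hne : T.Nonempty := ⟨E.atom [], by simp [T, hctx]⟩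
  have hval : ∀ i, E.val x.params i ∈ T := by
    intro i
    rw [Encoding.val, List.mem_toFinset]
    refine List.mem_map_of_mem ?_
    by_cases hi : i < x.params.length
    · rw [List.getD_eq_getElem _ _ hi]
      exact hp (List.getElem_mem hi)
    · rwa [List.getD_eq_default _ _ (by omega)]
  have hdef : ∀ e : SetExpr L, DefinableOver L T (e.eval (E.val x.params)) := fun e =>
    ⟨e, _, fun i _ => hval i, rfl⟩
  have hiso : (((K.cands ctx (E.exprCode x.univ₁) (E.exprCode x.univ₂) x.params).sublists'.any
      fun R => K.isoCheck (2 * d + 2 * z.2.1.length + 1) ctx (z.2.1.map fun c => clos c x.params)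
        (clos z.2.2.1.1 x.params, z.2.2.1.2.map fun c => clos c x.params)
        (clos z.2.2.2.1 x.params, z.2.2.2.2.map fun c => clos c x.params) R) = true) ↔
      IsoOver L T (x.signature E) (x.structure₁ E) (x.structure₂ E) := by
    rw [← K.exists_isoRel_iff hfin h0 hp hT hne rfl rfl, List.any_eq_true]
    refine exists_congr fun R => and_congr_right fun hR => ?_
    refine K.isoCheck_iff h0 (fun r hr => ?_) hl hsg hM hMI hN hNI hF
    obtain ⟨e₁, e₂, h1, h2, h3, h4, -⟩ :=
      K.exists_of_mem_cands ((List.mem_sublists'.1 hR).subset hr)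
    exact ⟨e₁, e₂, h1, h2, h3.le.trans hle.2.1.1, h4.le.trans hle.2.2.1⟩
  have key : K.decideIso z = true ↔ x.IsInstance E ∧
      IsoOver L T (x.signature E) (x.structure₁ E) (x.structure₂ E) := by
    rw [← hiso, IsoInput.IsInstance, and_assoc, and_assoc,
      ← K.sigCheck_iff h0 hl hsg (F := 2 * d + 2 * z.2.1.length + 1) (by omega),
      ← K.strCheck_iff h0 hl hsg hM hMI hF, ← K.strCheck_iff h0 hl hsg hN hNI hF,
      ← Bool.and_eq_true, ← Bool.and_eq_true, ← Bool.and_eq_true]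
    rfl
  rw [key]
  -- The procedure decides isomorphism over `T`; parameter elimination brings an arbitrary definable
  -- isomorphism down to `T`.
  refine and_congr_right fun h => ⟨fun h' => ⟨T, h'⟩, fun h' => ?_⟩
  exact helim T _ _ _ _ h.1 h.2.1 h.2.2 (fun i => hdef _) ⟨hdef _, fun i => hdef _⟩
    ⟨hdef _, fun i => hdef _⟩ h'

end Toolkit

end Decision
end AtomSets

theorem lemma3p2 {L : FirstOrder.Language.{v, w}} [L.IsRelational] [Finite (Σ n, L.Relations n)]
    {A : Type u} [L.Structure A] (E : AtomSets.Encoding L A)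
    (hcat : E.EffectivelyOmegaCategorical)
    (helim : AtomSets.ParameterElimination L A) :
    AtomSets.DefinableIsomorphismDecidable E := by
  obtain ⟨K⟩ := AtomSets.exists_toolkit hcat
  have hcount : Countable A := hcat.omegaCategorical.1
  have hfin : ∀ n, Finite (Quotient (AtomSets.orbitSetoid L A n)) := by
    intro n
    obtain ⟨f, -, hf⟩ := hcat.ryllNardzewski
    rw [← ENat.card_lt_top, hf]
    exact ENat.natCast_lt_top _
  exact ⟨fun z => K.decideIso z = true, ⟨inferInstance, by simpa using K.computable_decideIso⟩,
    fun x => (K.decideIso_iff hfin helim x).symm⟩
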